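/- **Theorem.** There are a deterministic real-RAM program $P$ and absolute constants $C_1, C_2 > 0$ and $c_1, c_2 \in \mathbb N$ such that the following holds. Let $(V,d)$ be a finite metric space with $n$ points, given to the program as labelled points $0,\dots,n-1$, let $w : V \to \mathbb R_{\ge 0}$ be a weight function, let $k \ge 1$ be an integer and let $\delta$ be a real number with $2 \le \delta \le n/k$. For nonempty $S \subseteq V$ put $$\mathrm{cost}(S) := \sum_{x \in V} w(x)\, d(x,S)^2, \qquad d(x,S) := \min_{y\in S} d(x,y),$$ and let $\Delta$ be the aspect ratio of $V$, i.e. the ratio of the maximum to the minimum distance between distinct points. Then $P$, with parameters $n$, $k$, $\delta$ and with access to $w$ and $d$ by queries for single values $w(x)$, $d(x,y)$, halts and outputs a set $S \subseteq V$ with $1 \le |S| \le k$ and $$\mathrm{cost}(S) \;\le\; C_1 \left(\frac{\log (n/k)}{\log \delta}\right)^{c_1} \cdot \min_{\emptyset \ne T \subseteq V,\ |T| \le k} \mathrm{cost}(T),$$ that is, a $\mathrm{poly}(\log(n/k)/\log\delta)$-approximate solution to $k$-means, and its running time is at most $$C_2 \cdot n k \delta \cdot (1 + \log n + \log \Delta)^{c_2}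 = \tilde O(nk\delta).$$ Here the real RAM is a random access machine with cells for natural numbers and cells for real numbers, whose program is a finite text (assignments, conditionals, while loops) without real constants. Queries, the arithmetic operations and comparisons of real numbers, and the conversion of a natural number to a real number cost one step each; each evaluation of a natural number (constant, memory access, sum, truncated difference, product, integer quotient) costs one plus the bit length of its value. There is no rounding of real numbers to integers. -/

import Mathlib

open scoped NNReal

/-! ## The machine model

A real random access machine, presented as a structured imperative language. A program is a finite
text without real constants. It has finitely many named arrays of natural numbers and of real
numbers (unbounded, indirectly addressed, initially zero) and read-only access to an input, whose
distances and weights it can only query entry by entry. Operations on reals have unit cost.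
Integers are charged by the logarithmic criterion: each evaluation of an integer-valued node costs
one plus the bit length of the integer that it produces. Real numbers cannot be rounded or otherwise
converted to integers; they can only influence the control flow through comparisons. -/

namespace RealRAM

/-- What a program is run on: the number of points (they are `0, …, n - 1`), the parameters `k` and
`δ`, and the tables of weights and distances, which are accessed as oracles. -/
structure Input where
  n : ℕ
  k : ℕ
  δ : ℝ
  weight : ℕ → ℝ
  dist : ℕ → ℕ → ℝ

/-- The memory: the cell with index `i` of the array with name `a` is `nat a i`, resp. `real a i`. -/
structure State where
  nat : ℕ → ℕ → ℕ
  real : ℕ → ℕ → ℝ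

/-- The initial memory. -/
def State.zero : State := ⟨fun _ _ => 0, fun _ _ => 0⟩

/-- `σ.setNat a i v` overwrites the cell `i` of the integer array `a` by `v`. -/
def State.setNat (σ : State) (a i v : ℕ) : State :=
  ⟨Function.update σ.nat a (Function.update (σ.nat a) i v), σ.real⟩

/-- `σ.setReal a i v` overwrites the cell `i` of the real array `a` by `v`. -/
noncomputable def State.setReal (σ : State) (a i : ℕ) (v : ℝ) : State :=
  ⟨σ.nat, Function.update σ.real a (Function.update (σ.real a) i v)⟩

/-- Integer expressions. `get a i` reads the cell `i` of the integer array `a`; `sub` is truncated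
subtraction and `div` is integer division. -/
inductive NExpr where
  | const (c : ℕ)
  | inputN
  | inputK
  | get (a : ℕ) (i : NExpr)
  | add (x y : NExpr)
  | sub (x y : NExpr)
  | mul (x y : NExpr)
  | div (x y : NExpr)

/-- Real expressions. `weight i` and `dist i j` are queries to the input. -/
inductive RExpr where
  | ofNat (x : NExpr)
  | inputDelta
  | weight (i : NExpr)
  | dist (i j : NExpr)
  | get (a : ℕ) (i : NExpr)
  | add (x y : RExpr)
  | sub (x y : RExpr)
  | mul (x y : RExpr)
  | div (x y : RExpr)

/-- Tests. -/
inductive BExpr where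
  | leNat (x y : NExpr)
  | leReal (x y : RExpr)
  | not (b : BExpr)
  | and (b c : BExpr)

/-- Programs. -/
inductive Cmd where
  | skip
  | setNat (a : ℕ) (i x : NExpr)
  | setReal (a : ℕ) (i : NExpr) (x : RExpr)
  | seq (p q : Cmd)
  | ite (b : BExpr) (p q : Cmd)
  | while (b : BExpr) (p : Cmd)

/-- Value of an integer expression. -/
def NExpr.eval (I : Input) (σ : State) : NExpr → ℕ
  | const c => c
  | inputN => I.n
  | inputK => I.k
  | get a i => σ.nat a (i.eval I σ)
  | add x y => x.eval I σ + y.eval I σ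
  | sub x y => x.eval I σ - y.eval I σ
  | mul x y => x.eval I σ * y.eval I σ
  | div x y => x.eval I σ / y.eval I σ

/-- Cost of evaluating an integer expression: every node costs one plus the bit length of its
value, so that addresses and operands are charged as well. -/
def NExpr.cost (I : Input) (σ : State) : NExpr → ℕ
  | const c => 1 + c.size
  | inputN => 1 + I.n.size
  | inputK => 1 + I.k.size
  | get a i => i.cost I σ + 1 + (σ.nat a (i.eval I σ)).size
  | add x y => x.cost I σ + y.cost I σ + 1 + (x.eval I σ + y.eval I σ).size
  | sub x y => x.cost I σ + y.cost I σ + 1 + (x.eval I σ - y.eval I σ).size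
  | mul x y => x.cost I σ + y.cost I σ + 1 + (x.eval I σ * y.eval I σ).size
  | div x y => x.cost I σ + y.cost I σ + 1 + (x.eval I σ / y.eval I σ).size

/-- Value of a real expression. -/
noncomputable def RExpr.eval (I : Input) (σ : State) : RExpr → ℝ
  | ofNat x => (x.eval I σ : ℝ)
  | inputDelta => I.δ
  | weight i => I.weight (i.eval I σ)
  | dist i j => I.dist (i.eval I σ) (j.eval I σ)
  | get a i => σ.real a (i.eval I σ)
  | add x y => x.eval I σ + y.eval I σ
  | sub x y => x.eval I σ - y.eval I σ
  | mul x y => x.eval I σ * y.eval I σ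
  | div x y => x.eval I σ / y.eval I σ

/-- Cost of evaluating a real expression. -/
def RExpr.cost (I : Input) (σ : State) : RExpr → ℕ
  | ofNat x => x.cost I σ + 1
  | inputDelta => 1
  | weight i => i.cost I σ + 1
  | dist i j => i.cost I σ + j.cost I σ + 1
  | get _ i => i.cost I σ + 1
  | add x y => x.cost I σ + y.cost I σ + 1
  | sub x y => x.cost I σ + y.cost I σ + 1
  | mul x y => x.cost I σ + y.cost I σ + 1
  | div x y => x.cost I σ + y.cost I σ + 1

/-- Truth of a test. -/
def BExpr.holds (I : Input) (σ : State) : BExpr → Prop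
  | leNat x y => x.eval I σ ≤ y.eval I σ
  | leReal x y => x.eval I σ ≤ y.eval I σ
  | not b => ¬ b.holds I σ
  | and b c => b.holds I σ ∧ c.holds I σ

/-- Cost of a test. -/
def BExpr.cost (I : Input) (σ : State) : BExpr → ℕ
  | leNat x y => x.cost I σ + y.cost I σ + 1
  | leReal x y => x.cost I σ + y.cost I σ + 1
  | not b => b.cost I σ + 1
  | and b c => b.cost I σ + c.cost I σ + 1

/-- `Exec I p σ t τ`: on the input `I`, the program `p` started with the memory `σ` halts after time
`t` with the memory `τ`. -/
inductive Exec (I : Input) : Cmd → State → ℕ → State → Prop where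
  | skip (σ : State) : Exec I .skip σ 1 σ
  | setNat (σ : State) (a : ℕ) (i x : NExpr) :
      Exec I (.setNat a i x) σ (i.cost I σ + x.cost I σ + 1)
        (σ.setNat a (i.eval I σ) (x.eval I σ))
  | setReal (σ : State) (a : ℕ) (i : NExpr) (x : RExpr) :
      Exec I (.setReal a i x) σ (i.cost I σ + x.cost I σ + 1)
        (σ.setReal a (i.eval I σ) (x.eval I σ))
  | seq {p q : Cmd} {σ τ ρ : State} {s t : ℕ} (hp : Exec I p σ s τ) (hq : Exec I q τ t ρ) :
      Exec I (.seq p q) σ (s + t) ρ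
  | iteTrue {b : BExpr} {p q : Cmd} {σ τ : State} {t : ℕ} (hb : b.holds I σ)
      (hp : Exec I p σ t τ) : Exec I (.ite b p q) σ (b.cost I σ + 1 + t) τ
  | iteFalse {b : BExpr} {p q : Cmd} {σ τ : State} {t : ℕ} (hb : ¬ b.holds I σ)
      (hq : Exec I q σ t τ) : Exec I (.ite b p q) σ (b.cost I σ + 1 + t) τ
  | whileTrue {b : BExpr} {p : Cmd} {σ τ ρ : State} {s t : ℕ} (hb : b.holds I σ)
      (hp : Exec I p σ s τ) (hw : Exec I (.while b p) τ t ρ) :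
      Exec I (.while b p) σ (b.cost I σ + 1 + s + t) ρ
  | whileFalse {b : BExpr} {p : Cmd} {σ : State} (hb : ¬ b.holds I σ) :
      Exec I (.while b p) σ (b.cost I σ + 1) σ

/-- Programs are deterministic: the running time and the final memory are unique. -/
theorem Exec.deterministic {I : Input} {p : Cmd} {σ τ τ' : State} {t t' : ℕ}
    (h : Exec I p σ t τ) (h' : Exec I p σ t' τ') : t = t' ∧ τ = τ' := by
  induction h generalizing t' τ' with
  | skip => cases h'; exact ⟨rfl, rfl⟩
  | setNat => cases h'; exact ⟨rfl, rfl⟩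
  | setReal => cases h'; exact ⟨rfl, rfl⟩
  | seq _ _ ih₁ ih₂ =>
    cases h' with
    | seq h₁ h₂ =>
      obtain ⟨rfl, rfl⟩ := ih₁ h₁
      obtain ⟨rfl, rfl⟩ := ih₂ h₂
      exact ⟨rfl, rfl⟩
  | iteTrue hb _ ih =>
    cases h' with
    | iteTrue _ h₁ =>
      obtain ⟨rfl, rfl⟩ := ih h₁
      exact ⟨rfl, rfl⟩
    | iteFalse hb' _ => exact absurd hb hb'
  | iteFalse hb _ ih =>
    cases h' with
    | iteTrue hb' _ => exact absurd hb' hb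
    | iteFalse _ h₁ =>
      obtain ⟨rfl, rfl⟩ := ih h₁
      exact ⟨rfl, rfl⟩
  | whileTrue hb _ _ ih₁ ih₂ =>
    cases h' with
    | whileTrue _ h₁ h₂ =>
      obtain ⟨rfl, rfl⟩ := ih₁ h₁
      obtain ⟨rfl, rfl⟩ := ih₂ h₂
      exact ⟨rfl, rfl⟩
    | whileFalse hb' => exact absurd hb hb'
  | whileFalse hb =>
    cases h' with
    | whileTrue hb' _ _ => exact absurd hb' hb
    | whileFalse _ => exact ⟨rfl, rfl⟩

end RealRAM

/-! ## Metric `k`-means -/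

section KMeans

variable {V : Type*} [MetricSpace V]

/-- The `k`-means objective of a nonempty set `S` of centers, `∑ x, w x * d(x, S) ^ 2`. -/
noncomputable def kMeansCost [Fintype V] (w : V → ℝ≥0) (S : Finset V) : ℝ :=
  ∑ x, (w x : ℝ) * Metric.infDist x (S : Set V) ^ 2

/-- `S` is an `α`-approximate solution to the `k`-means problem: it consists of at least one and at
most `k` centers, and its cost is at most `α` times the cost of any such set. -/
def IsApproxKMeans [Fintype V] (w : V → ℝ≥0) (k : ℕ) (α : ℝ) (S : Finset V) : Prop :=
  S.Nonempty ∧ S.card ≤ k ∧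
    ∀ T : Finset V, T.Nonempty → T.card ≤ k → kMeansCost w S ≤ α * kMeansCost w T

/-- The aspect ratio: the largest distance divided by the smallest distance of distinct points. -/
noncomputable def aspectRatio (V : Type*) [MetricSpace V] : ℝ :=
  Metric.diam (Set.univ : Set V) / (Set.univ : Set V).infsep

/-- The weighted metric space `(V, w, d)`, whose points are numbered by `e`, as an input of a
program; a query for an index that is not a point is answered by `0`. -/
noncomputable def kMeansInput {n : ℕ} (e : Fin n ≃ V) (w : V → ℝ≥0) (k : ℕ) (δ : ℝ) :
    RealRAM.Input where
  n := n
  k := k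
  δ := δ
  weight i := if h : i < n then (w (e ⟨i, h⟩) : ℝ) else 0
  dist i j := if h : i < n ∧ j < n then dist (e ⟨i, h.1⟩) (e ⟨j, h.2⟩) else 0

/-- The set `S` can be read off from the final memory `σ`: its elements are listed in the integer
array `1`, and the length of the list is the cell `0` of the integer array `0`. -/
def OutputsSet {n : ℕ} (e : Fin n ≃ V) (σ : RealRAM.State) (S : Finset V) : Prop :=
  (∀ j < σ.nat 0 0, σ.nat 1 j < n) ∧
    ∀ v : V, v ∈ S ↔ ∃ j < σ.nat 0 0, σ.nat 1 j = (e.symm v : ℕ)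

end KMeans

/-! The points are compressed in stages. A stage cuts the current weighted points into chunks of
size `k * Q`, replaces every chunk by at most `k` weighted centers that solve `k`-means on it up to
a constant factor, and then squares `Q`, which starts at `q = ⌊δ⌋`. The chunk solver takes time
quadratic in the chunk size, up to logarithms, so a stage on `N` points costs about `N * k * Q`. A
stage divides the number of points by `Q`, up to a factor of two, so `N * Q` at most doubles from
stage to stage, and the total is about `2 ^ (M + 1) * n * k * q`, where `2 ^ M` is of order `log (n
/ k) / log δ` (`exists_stages`). Any solution restricted to a chunk still has at most `k` centers,
so separate treatment of the chunks loses nothing (`IsReduction.append`), and by the triangle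
inequality one more stage multiplies the ratio by a constant, at most `2 ^ 24`
(`IsReduction.trans`). The final ratio `(2 ^ 24) ^ (M + 1)` is therefore polynomial in `log (n / k)
/ log δ`.

The chunk solver is a deterministic Lagrangian method. Every point carries a ball, valued by its
weight times its squared radius, and the cheapest ball that does not yet reach everything is doubled
again and again. The value `f` of the next ball to be doubled is a threshold: every ball is worth at
least `f`, and every ball that has grown was worth at most `f` at half of its radius
(`validRadii_level`). A greedy net of separated balls, each with its center optimized locally, is
Lagrangian multiplier preserving (`net_cost_le`): its cost plus a multiple of `f` per center is at
most a constant times the optimum plus the same multiple of `f` per optimal center. At the start the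
net consists of all points, at the end of at most one. A binary search finds two consecutive moments
at which it has more than `k` and at most `k` centers. One doubling lies between them and the same
`f` is valid for both, so that the two clusterings can be merged into `k` centers with the terms in
`f` cancelling (`clustering_cost_le`).

Programs are verified in a Hoare logic for total correctness, `Runs`, which counts assignments and
tests. A bound `B` on all integers in memory turns this count into logarithmic cost. -/

namespace RealRAM

/-! ## Weights of expressions -/

/-- The bit length of the value of an expression is at most `len` times the word size. -/
def NExpr.len : NExpr → ℕ
  | const c => c + 1
  | inputN => 1
  | inputK => 1
  | get _ _ => 1
  | add x y => x.len + y.len + 1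
  | sub x y => x.len + y.len + 1
  | mul x y => x.len + y.len + 1
  | div x y => x.len + y.len + 1

/-- The cost of an expression is at most `wt` times the word size. -/
def NExpr.wt : NExpr → ℕ
  | const c => c + 1
  | inputN => 1
  | inputK => 1
  | get _ i => i.wt + 1
  | add x y => x.wt + y.wt + 1 + (x.len + y.len + 1)
  | sub x y => x.wt + y.wt + 1 + (x.len + y.len + 1)
  | mul x y => x.wt + y.wt + 1 + (x.len + y.len + 1)
  | div x y => x.wt + y.wt + 1 + (x.len + y.len + 1)

/-- The cost of an expression is at most `wt` times the word size. -/
def RExpr.wt : RExpr → ℕ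
  | ofNat x => x.wt + 1
  | inputDelta => 1
  | weight i => i.wt + 1
  | dist i j => i.wt + j.wt + 1
  | get _ i => i.wt + 1
  | add x y => x.wt + y.wt + 1
  | sub x y => x.wt + y.wt + 1
  | mul x y => x.wt + y.wt + 1
  | div x y => x.wt + y.wt + 1

/-- The cost of a test is at most `wt` times the word size. -/
def BExpr.wt : BExpr → ℕ
  | leNat x y => x.wt + y.wt + 1
  | leReal x y => x.wt + y.wt + 1
  | not b => b.wt + 1
  | and b c => b.wt + c.wt + 1

/-- All integers in the input and in the memory are at most `B`. -/
def Good (I : Input) (B : ℕ) (σ : State) : Prop :=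
  I.n ≤ B ∧ I.k ≤ B ∧ ∀ a i, σ.nat a i ≤ B

theorem size_add_le (x y : ℕ) : (x + y).size ≤ x.size + y.size + 1 := by
  rw [Nat.size_le]
  have hx := Nat.lt_size_self x
  have hy := Nat.lt_size_self y
  have h1 : 2 ^ x.size ≤ 2 ^ (x.size + y.size) := Nat.pow_le_pow_right (by norm_num) (by omega)
  have h2 : 2 ^ y.size ≤ 2 ^ (x.size + y.size) := Nat.pow_le_pow_right (by norm_num) (by omega)
  rw [pow_succ]
  omega

theorem size_mul_le (x y : ℕ) : (x * y).size ≤ x.size + y.size := by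
  rw [Nat.size_le, pow_add]
  exact Nat.mul_lt_mul'' (Nat.lt_size_self x) (Nat.lt_size_self y)

theorem size_le_self (x : ℕ) : x.size ≤ x := Nat.size_le.2 Nat.lt_two_pow_self

variable {I : Input} {B : ℕ} {σ : State}

theorem NExpr.size_eval_le (hσ : Good I B σ) (e : NExpr) :
    (e.eval I σ).size ≤ e.len * (B.size + 1) := by
  induction e with
  | const c =>
    simp only [eval, len]
    nlinarith [size_le_self c]
  | inputN => simp only [eval, len]; have := Nat.size_le_size hσ.1; omega
  | inputK => simp only [eval, len]; have := Nat.size_le_size hσ.2.1; omega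
  | get a i => simp only [eval, len]; have := Nat.size_le_size (hσ.2.2 a (i.eval I σ)); omega
  | add x y hx hy =>
    simp only [eval, len]
    have := size_add_le (x.eval I σ) (y.eval I σ)
    nlinarith
  | sub x y hx hy =>
    simp only [eval, len]
    have := Nat.size_le_size (Nat.sub_le (x.eval I σ) (y.eval I σ))
    nlinarith
  | mul x y hx hy =>
    simp only [eval, len]
    have := size_mul_le (x.eval I σ) (y.eval I σ)
    nlinarith
  | div x y hx hy =>
    simp only [eval, len]
    have := Nat.size_le_size (Nat.div_le_self (x.eval I σ) (y.eval I σ))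
    nlinarith

theorem NExpr.cost_le (hσ : Good I B σ) (e : NExpr) :
    e.cost I σ ≤ e.wt * (B.size + 1) := by
  induction e with
  | const c =>
    simp only [cost, wt]
    nlinarith [size_le_self c]
  | inputN => simp only [cost, wt]; have := Nat.size_le_size hσ.1; omega
  | inputK => simp only [cost, wt]; have := Nat.size_le_size hσ.2.1; omega
  | get a i hi =>
    simp only [cost, wt]; have := Nat.size_le_size (hσ.2.2 a (i.eval I σ)); nlinarith
  | add x y hx hy =>
    have := NExpr.size_eval_le hσ (x.add y)
    simp only [cost, wt, eval, len] at *
    nlinarith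
  | sub x y hx hy =>
    have := NExpr.size_eval_le hσ (x.sub y)
    simp only [cost, wt, eval, len] at *
    nlinarith
  | mul x y hx hy =>
    have := NExpr.size_eval_le hσ (x.mul y)
    simp only [cost, wt, eval, len] at *
    nlinarith
  | div x y hx hy =>
    have := NExpr.size_eval_le hσ (x.div y)
    simp only [cost, wt, eval, len] at *
    nlinarith

theorem RExpr.cost_le (hσ : Good I B σ) (e : RExpr) :
    e.cost I σ ≤ e.wt * (B.size + 1) := by
  induction e with
  | ofNat x => simp only [cost, wt]; nlinarith [x.cost_le hσ]
  | inputDelta => simp only [cost, wt]; omega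
  | weight i => simp only [cost, wt]; nlinarith [i.cost_le hσ]
  | dist i j => simp only [cost, wt]; nlinarith [i.cost_le hσ, j.cost_le hσ]
  | get a i => simp only [cost, wt]; nlinarith [i.cost_le hσ]
  | add x y hx hy => simp only [cost, wt]; nlinarith
  | sub x y hx hy => simp only [cost, wt]; nlinarith
  | mul x y hx hy => simp only [cost, wt]; nlinarith
  | div x y hx hy => simp only [cost, wt]; nlinarith

theorem BExpr.cost_le (hσ : Good I B σ) (e : BExpr) :
    e.cost I σ ≤ e.wt * (B.size + 1) := by
  induction e with
  | leNat x y => simp only [cost, wt]; nlinarith [x.cost_le hσ, y.cost_le hσ]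
  | leReal x y => simp only [cost, wt]; nlinarith [x.cost_le hσ, y.cost_le hσ]
  | not b hb => simp only [cost, wt]; nlinarith
  | and b c hb hc => simp only [cost, wt]; nlinarith

/-! ## The arrays that a program writes -/

/-- The integer arrays that a program may write. -/
def Cmd.natW : Cmd → List ℕ
  | skip => []
  | setNat a _ _ => [a]
  | setReal _ _ _ => []
  | seq p q => p.natW ++ q.natW
  | ite _ p q => p.natW ++ q.natW
  | .while _ p => p.natW

/-- The real arrays that a program may write. -/
def Cmd.realW : Cmd → List ℕ
  | skip => []
  | setNat _ _ _ => []
  | setReal a _ _ => [a]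
  | seq p q => p.realW ++ q.realW
  | ite _ p q => p.realW ++ q.realW
  | .while _ p => p.realW

/-- The memories agree on all arrays that `p` does not write. -/
structure Agree (p : Cmd) (σ τ : State) : Prop where
  nat : ∀ a, a ∉ p.natW → τ.nat a = σ.nat a
  real : ∀ a, a ∉ p.realW → τ.real a = σ.real a

theorem Agree.refl (p : Cmd) (σ : State) : Agree p σ σ := ⟨fun _ _ => rfl, fun _ _ => rfl⟩

theorem Agree.trans {p q : Cmd} {σ τ ρ : State} (h : Agree p σ τ) (h' : Agree q τ ρ)
    (hn : ∀ a ∈ q.natW, a ∈ p.natW) (hr : ∀ a ∈ q.realW, a ∈ p.realW) : Agree p σ ρ :=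
  ⟨fun a ha => (h'.nat a fun hq => ha (hn a hq)).trans (h.nat a ha),
    fun a ha => (h'.real a fun hq => ha (hr a hq)).trans (h.real a ha)⟩

@[simp] theorem setNat_nat_same (σ : State) (a i v : ℕ) :
    (σ.setNat a i v).nat a = Function.update (σ.nat a) i v := by simp [State.setNat]

@[simp] theorem setNat_nat_ne (σ : State) {a b : ℕ} (i v : ℕ) (h : b ≠ a) :
    (σ.setNat a i v).nat b = σ.nat b := by simp [State.setNat, h]

@[simp] theorem setNat_real (σ : State) (a i v : ℕ) : (σ.setNat a i v).real = σ.real := rfl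

@[simp] theorem setReal_real_same (σ : State) (a i : ℕ) (v : ℝ) :
    (σ.setReal a i v).real a = Function.update (σ.real a) i v := by simp [State.setReal]

@[simp] theorem setReal_real_ne (σ : State) {a b : ℕ} (i : ℕ) (v : ℝ) (h : b ≠ a) :
    (σ.setReal a i v).real b = σ.real b := by simp [State.setReal, h]

@[simp] theorem setReal_nat (σ : State) (a i : ℕ) (v : ℝ) : (σ.setReal a i v).nat = σ.nat := rfl

/-- This is the frame rule. Since the lists of written arrays are computable, the persistence of an
untouched array is later settled by `decide` or `simp`. -/
theorem Exec.agree {p : Cmd} {σ τ : State} {t : ℕ} (h : Exec I p σ t τ) : Agree p σ τ := by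
  induction h with
  | skip σ => exact Agree.refl _ _
  | setNat σ a i x =>
    refine ⟨fun b hb => ?_, fun b _ => rfl⟩
    simp only [Cmd.natW, List.mem_singleton] at hb
    exact setNat_nat_ne _ _ _ hb
  | setReal σ a i x =>
    refine ⟨fun b _ => rfl, fun b hb => ?_⟩
    simp only [Cmd.realW, List.mem_singleton] at hb
    exact setReal_real_ne _ _ _ hb
  | seq _ _ h₁ h₂ =>
    constructor
    · intro a ha
      simp only [Cmd.natW, List.mem_append, not_or] at ha
      rw [h₂.nat a ha.2, h₁.nat a ha.1]
    · intro a ha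
      simp only [Cmd.realW, List.mem_append, not_or] at ha
      rw [h₂.real a ha.2, h₁.real a ha.1]
  | iteTrue _ _ h =>
    exact ⟨fun a ha => h.nat a fun h' => ha (List.mem_append_left _ h'),
      fun a ha => h.real a fun h' => ha (List.mem_append_left _ h')⟩
  | iteFalse _ _ h =>
    exact ⟨fun a ha => h.nat a fun h' => ha (List.mem_append_right _ h'),
      fun a ha => h.real a fun h' => ha (List.mem_append_right _ h')⟩
  | whileTrue _ _ _ h₁ h₂ =>
    exact ⟨fun a ha => (h₂.nat a ha).trans (h₁.nat a ha),
      fun a ha => (h₂.real a ha).trans (h₁.real a ha)⟩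
  | whileFalse => exact Agree.refl _ _

/-! ## Total correctness with time bounds -/

/-- An upper bound on the cost of one assignment or test. -/
def unit (B : ℕ) : ℕ := 1000 * (B.size + 1)

/-- Started in `σ`, whose integers are at most `B`, the program `p` halts after at most `T` units of
time; then `Q` holds, and the integers are still at most `B`. -/
def Runs (I : Input) (B : ℕ) (p : Cmd) (σ : State) (T : ℕ) (Q : State → Prop) : Prop :=
  Good I B σ → ∃ t τ, Exec I p σ t τ ∧ t ≤ T * unit B ∧ Good I B τ ∧ Q τ

variable {p q : Cmd} {T T₁ T₂ : ℕ} {Q Q₁ : State → Prop}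

theorem Runs.good (h : Good I B σ → Runs I B p σ T Q) : Runs I B p σ T Q := fun hσ => h hσ hσ

theorem Runs.mono (h : Runs I B p σ T₁ Q₁) (hT : T₁ ≤ T)
    (hQ : ∀ τ, Good I B τ → Agree p σ τ → Q₁ τ → Q τ) : Runs I B p σ T Q := fun hσ => by
  obtain ⟨t, τ, h₁, h₂, h₃, h₄⟩ := h hσ
  exact ⟨t, τ, h₁, h₂.trans (Nat.mul_le_mul_right _ hT), h₃, hQ τ h₃ h₁.agree h₄⟩

theorem Runs.time (h : Runs I B p σ T₁ Q) (hT : T₁ ≤ T) : Runs I B p σ T Q :=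
  h.mono hT fun _ _ _ h => h

theorem Runs.post (h : Runs I B p σ T Q₁) (hQ : ∀ τ, Good I B τ → Agree p σ τ → Q₁ τ → Q τ) :
    Runs I B p σ T Q := h.mono le_rfl hQ

theorem Runs.skip (h : Q σ) : Runs I B .skip σ 1 Q := fun hσ =>
  ⟨1, σ, .skip σ, by unfold unit; omega, hσ, h⟩

theorem Good.setNat (hσ : Good I B σ) {a i v : ℕ} (hv : v ≤ B) : Good I B (σ.setNat a i v) := by
  refine ⟨hσ.1, hσ.2.1, fun b j => ?_⟩
  by_cases hb : b = a
  · subst hb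
    rw [setNat_nat_same, Function.update_apply]
    split_ifs
    · exact hv
    · exact hσ.2.2 b j
  · rw [setNat_nat_ne _ _ _ hb]
    exact hσ.2.2 b j

/-- The weight depends only on the program text. The constant 1000 in `unit` is a crude bound for
all assignments and tests that occur, so one of them is one unit of time. -/
theorem Runs.setNat {a : ℕ} {i x : NExpr} (hw : i.wt + x.wt + 1 ≤ 1000) (hx : x.eval I σ ≤ B)
    (hQ : Q (σ.setNat a (i.eval I σ) (x.eval I σ))) : Runs I B (.setNat a i x) σ 1 Q := fun hσ =>
  ⟨_, _, .setNat σ a i x, by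
    have h₁ := i.cost_le hσ
    have h₂ := x.cost_le hσ
    unfold unit
    nlinarith, hσ.setNat hx, hQ⟩

theorem Runs.setReal {a : ℕ} {i : NExpr} {x : RExpr} (hw : i.wt + x.wt + 1 ≤ 1000)
    (hQ : Q (σ.setReal a (i.eval I σ) (x.eval I σ))) : Runs I B (.setReal a i x) σ 1 Q := fun hσ =>
  ⟨_, _, .setReal σ a i x, by
    have h₁ := i.cost_le hσ
    have h₂ := x.cost_le hσ
    unfold unit
    nlinarith, hσ, hQ⟩

theorem Runs.seq (hp : Runs I B p σ T₁ Q₁)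
    (hq : ∀ τ, Good I B τ → Agree p σ τ → Q₁ τ → Runs I B q τ T₂ Q) :
    Runs I B (.seq p q) σ (T₁ + T₂) Q := fun hσ => by
  obtain ⟨t, τ, h₁, h₂, h₃, h₄⟩ := hp hσ
  obtain ⟨t', τ', h₁', h₂', h₃', h₄'⟩ := hq τ h₃ h₁.agree h₄ h₃
  exact ⟨_, _, h₁.seq h₁', by rw [add_mul]; omega, h₃', h₄'⟩

theorem Runs.setNat_seq {a : ℕ} {i x : NExpr} (hw : i.wt + x.wt + 1 ≤ 1000)
    (hx : x.eval I σ ≤ B) (hq : Runs I B q (σ.setNat a (i.eval I σ) (x.eval I σ)) T Q) :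
    Runs I B (.seq (.setNat a i x) q) σ (T + 1) Q :=
  Nat.add_comm 1 T ▸ (Runs.setNat (Q := fun τ => τ = σ.setNat a (i.eval I σ) (x.eval I σ)) hw hx rfl).seq
    fun _ _ _ h => h ▸ hq

theorem Runs.setReal_seq {a : ℕ} {i : NExpr} {x : RExpr} (hw : i.wt + x.wt + 1 ≤ 1000)
    (hq : Runs I B q (σ.setReal a (i.eval I σ) (x.eval I σ)) T Q) :
    Runs I B (.seq (.setReal a i x) q) σ (T + 1) Q :=
  Nat.add_comm 1 T ▸ (Runs.setReal (Q := fun τ => τ = σ.setReal a (i.eval I σ) (x.eval I σ)) hw rfl).seq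
    fun _ _ _ h => h ▸ hq

theorem Runs.ite {b : BExpr} (hw : b.wt + 1 ≤ 1000) (hp : b.holds I σ → Runs I B p σ T Q)
    (hq : ¬ b.holds I σ → Runs I B q σ T Q) : Runs I B (.ite b p q) σ (T + 1) Q := fun hσ => by
  have hb := b.cost_le hσ
  have hu : b.cost I σ + 1 ≤ unit B := by unfold unit; nlinarith
  by_cases h : b.holds I σ
  · obtain ⟨t, τ, h₁, h₂, h₃, h₄⟩ := hp h hσ
    exact ⟨_, _, .iteTrue h h₁, by rw [add_mul]; omega, h₃, h₄⟩
  · obtain ⟨t, τ, h₁, h₂, h₃, h₄⟩ := hq h hσ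
    exact ⟨_, _, .iteFalse h h₁, by rw [add_mul]; omega, h₃, h₄⟩

/-- The amortized rule for loops: `Inv i` says that the remaining rounds take time at most `i`. -/
theorem Runs.while {b : BExpr} {Inv : ℕ → State → Prop} (hw : b.wt + 1 ≤ 1000)
    (step : ∀ i τ, Good I B τ → Agree p σ τ → Inv i τ → b.holds I τ →
      ∃ T, Runs I B p τ T fun τ' => ∃ j, j + T + 1 ≤ i ∧ Inv j τ')
    {i : ℕ} (h : Inv i σ) :
    Runs I B (.while b p) σ (i + 1) fun τ => ¬ b.holds I τ ∧ ∃ j, Inv j τ := by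
  suffices H : ∀ i τ, Agree p σ τ → Inv i τ →
      Runs I B (.while b p) τ (i + 1) fun τ => ¬ b.holds I τ ∧ ∃ j, Inv j τ from
    H i σ (Agree.refl _ _) h
  intro i
  induction i using Nat.strong_induction_on with
  | _ i ih =>
    intro τ ha hi hτ
    have hb := b.cost_le hτ
    have hu : b.cost I τ + 1 ≤ unit B := by unfold unit; nlinarith
    by_cases hbt : b.holds I τ
    · obtain ⟨T, hT⟩ := step i τ hτ ha hi hbt
      obtain ⟨t, τ', h₁, h₂, h₃, j, hj, h₄⟩ := hT hτ
      obtain ⟨t', ρ, h₁', h₂', h₃', h₄'⟩ := ih j (by omega) τ'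
        (ha.trans h₁.agree (fun _ h => h) fun _ h => h) h₄ h₃
      refine ⟨_, _, .whileTrue hbt h₁ h₁', ?_, h₃', h₄'⟩
      have : (j + T + 1) * unit B ≤ i * unit B := Nat.mul_le_mul_right _ hj
      simp only [add_mul, one_mul] at *
      omega
    · refine ⟨_, _, .whileFalse hbt, ?_, hτ, hbt, i, hi⟩
      rw [add_mul]
      omega

/-- The value of a scalar variable, which is the cell `0` of an array. -/
abbrev NExpr.var (a : ℕ) : NExpr := .get a (.const 0)

/-- `for iv = 0, …, b - 1 do p`, where `iv` and `b` are scalar variables. -/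
def Cmd.for (iv b : ℕ) (p : Cmd) : Cmd :=
  .seq (.setNat iv (.const 0) (.const 0))
    (.while (.leNat (.add (.var iv) (.const 1)) (.var b))
      (.seq p (.setNat iv (.const 0) (.add (.var iv) (.const 1)))))

/-- The two extra units per round pay for the test and the increment, the final two for the
initialization and the last test. The invariant is demanded after the increment because it may speak
about the whole memory. -/
theorem Runs.for {iv b s : ℕ} {Inv : ℕ → State → Prop} (hb : σ.nat b 0 = s)
    (hn : b ≠ iv ∧ iv ∉ p.natW ∧ b ∉ p.natW) (h0 : Inv 0 (σ.setNat iv 0 0))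
    (step : ∀ i τ, i < s → Good I B τ → Agree (.for iv b p) σ τ → τ.nat iv 0 = i → Inv i τ →
      Runs I B p τ T fun τ' => Inv (i + 1) (τ'.setNat iv 0 (i + 1))) :
    Runs I B (.for iv b p) σ (s * (T + 2) + 2) (Inv s) := by
  obtain ⟨hn, hi, hbp⟩ := hn
  refine Runs.good fun hσ => ?_
  have hsB : s ≤ B := hb ▸ hσ.2.2 b 0
  refine Runs.time (Runs.setNat_seq (T := s * (T + 2) + 1) (by decide) (Nat.zero_le _) ?_) (by omega)
  set σ' := σ.setNat iv ((NExpr.const 0).eval I σ) ((NExpr.const 0).eval I σ) with hσ'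
  have hσ'' : σ' = σ.setNat iv 0 0 := rfl
  have hA0 : Agree (.for iv b p) σ σ' := by
    refine ⟨fun a ha => setNat_nat_ne _ _ _ ?_, fun _ _ => rfl⟩
    rintro rfl
    exact ha (by simp [Cmd.for, Cmd.natW])
  refine Runs.post (Runs.while (σ := σ')
    (Inv := fun r τ => ∃ i, i ≤ s ∧ τ.nat iv 0 = i ∧ r = (s - i) * (T + 2) ∧ Inv i τ)
    (by simp +arith [BExpr.wt, NExpr.wt, NExpr.len]) ?_ ⟨0, Nat.zero_le _, by simp [hσ''], rfl, h0⟩) ?_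
  · rintro r τ hτ hA ⟨i, his, hiv, rfl, hI⟩ hbt
    have hA' : Agree (.for iv b p) σ τ :=
      hA0.trans hA (by simp +contextual [Cmd.for, Cmd.natW]) (by simp +contextual [Cmd.for, Cmd.realW])
    have hbτ : τ.nat b 0 = s := by
      rw [hA'.nat b (by simp [Cmd.for, Cmd.natW, hn, hbp]), hb]
    simp only [BExpr.holds, NExpr.eval, hiv, hbτ] at hbt
    refine ⟨T + 1, (step i τ hbt hτ hA' hiv hI).seq fun τ' hτ' hA' hI' => ?_⟩
    have hiv' : τ'.nat iv 0 = i := by rw [hA'.nat iv hi, hiv]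
    refine Runs.setNat (by simp +arith [NExpr.wt, NExpr.len]) ?_ ?_
    · simp only [NExpr.eval, hiv']
      omega
    · simp only [NExpr.eval, hiv']
      refine ⟨_, ?_, i + 1, hbt, by simp, rfl, hI'⟩
      obtain ⟨d, hd⟩ := Nat.exists_eq_add_of_le hbt
      have h1 : s - i = d + 1 := by omega
      have h2 : s - (i + 1) = d := by omega
      rw [h1, h2, add_mul]
      omega
  · rintro τ hτ hA ⟨hbt, _, i, his, hiv, -, hI⟩
    have hbτ : τ.nat b 0 = s := by
      rw [hA.nat b (by simp [Cmd.natW, hbp, hn]), hσ'', setNat_nat_ne _ _ _ hn, hb]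
    simp only [BExpr.holds, NExpr.eval, hiv, hbτ] at hbt
    obtain rfl : i = s := by omega
    exact hI

end RealRAM

namespace KMeans

open Finset

/-! ## The location of a minimum -/

open Classical in
/-- The first `j < i` that satisfies `p` and minimizes `g` among these; `s` if there is none. -/
noncomputable def argminUpTo (s : ℕ) (p : ℕ → Prop) (g : ℕ → ℝ) : ℕ → ℕ
  | 0 => s
  | i + 1 =>
    if p i ∧ ¬ (argminUpTo s p g i < s ∧ g (argminUpTo s p g i) ≤ g i) then i
    else argminUpTo s p g i

/-- The first `j < s` that satisfies `p` and minimizes `g` among these; `s` if there is none. -/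
noncomputable def argmin (s : ℕ) (p : ℕ → Prop) (g : ℕ → ℝ) : ℕ := argminUpTo s p g s

theorem argminUpTo_spec {s : ℕ} {p : ℕ → Prop} {g : ℕ → ℝ} {i : ℕ} (hi : i ≤ s) :
    (argminUpTo s p g i = s ∧ ∀ j < i, ¬ p j) ∨
      (argminUpTo s p g i < s ∧ p (argminUpTo s p g i) ∧
        ∀ j < i, p j → g (argminUpTo s p g i) ≤ g j) := by
  induction i with
  | zero => exact Or.inl ⟨rfl, fun j hj => absurd hj (Nat.not_lt_zero _)⟩
  | succ i ih =>
    specialize ih (by omega)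
    rw [argminUpTo]
    split_ifs with h
    · refine Or.inr ⟨hi, h.1, fun j hj hpj => ?_⟩
      rcases Nat.lt_succ_iff_lt_or_eq.1 hj with hj | rfl
      · rcases ih with ih | ih
        · exact absurd hpj (ih.2 j hj)
        · have := h.2
          simp only [ih.1, true_and, not_le] at this
          exact this.le.trans (ih.2.2 j hj hpj)
      · exact le_rfl
    · rcases ih with ih | ih
      · refine Or.inl ⟨ih.1, fun j hj => ?_⟩
        rcases Nat.lt_succ_iff_lt_or_eq.1 hj with hj | rfl
        · exact ih.2 j hj
        · intro hp
          exact h ⟨hp, fun h' => absurd h'.1 (by rw [ih.1]; exact lt_irrefl _)⟩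
      · refine Or.inr ⟨ih.1, ih.2.1, fun j hj hpj => ?_⟩
        rcases Nat.lt_succ_iff_lt_or_eq.1 hj with hj | rfl
        · exact ih.2.2 j hj hpj
        · by_contra hlt
          exact h ⟨hpj, fun h' => hlt h'.2⟩

section
variable {s : ℕ} {p : ℕ → Prop} {g : ℕ → ℝ}

theorem argmin_le : argmin s p g ≤ s := by
  rcases argminUpTo_spec (p := p) (g := g) (le_refl s) with h | h
  · exact h.1.le
  · exact h.1.le

theorem argmin_spec (h : ∃ i < s, p i) :
    argmin s p g < s ∧ p (argmin s p g) ∧ ∀ i < s, p i → g (argmin s p g) ≤ g i := by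
  rcases argminUpTo_spec (p := p) (g := g) (le_refl s) with h' | h'
  · obtain ⟨i, hi, hp⟩ := h
    exact absurd hp (h'.2 i hi)
  · exact h'

theorem argmin_eq (h : ∀ i < s, ¬ p i) : argmin s p g = s := by
  rcases argminUpTo_spec (p := p) (g := g) (le_refl s) with h' | h'
  · exact h'.1
  · exact absurd h'.2.1 (h _ h'.1)

theorem exists_of_argmin_lt (h : argmin s p g < s) : ∃ i < s, p i := by
  by_contra hn
  push Not at hn
  exact absurd (argmin_eq (g := g) hn) h.ne

end

/-! ## Clustering by separated balls -/

/-- `D` is a pseudometric on `0, …, s - 1`. -/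
structure MetricOn (s : ℕ) (D : ℕ → ℕ → ℝ) : Prop where
  self : ∀ i < s, D i i = 0
  symm : ∀ i < s, ∀ j < s, D i j = D j i
  tri : ∀ i < s, ∀ j < s, ∀ l < s, D i l ≤ D i j + D j l
  nonneg : ∀ i < s, ∀ j < s, 0 ≤ D i j

/-- The weight of a ball times the square of its radius. -/
noncomputable def ballValue (s : ℕ) (D : ℕ → ℕ → ℝ) (U : ℕ → ℝ) (i : ℕ) (r : ℝ) : ℝ :=
  (∑ j ∈ range s, if D i j ≤ r then U j else 0) * r * r

/-- `f` is a threshold for the values of the balls with the radii `R i`. -/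
structure ValidRadii (s : ℕ) (D : ℕ → ℕ → ℝ) (U : ℕ → ℝ) (r₀ f : ℝ) (R : ℕ → ℝ) : Prop where
  ge : ∀ i < s, r₀ ≤ R i
  le_value : ∀ i < s, f ≤ ballValue s D U i (R i)
  value_le : ∀ i < s, R i = r₀ ∨ ballValue s D U i (R i / 2) ≤ f

/-- A maximal family of centers of well separated balls. -/
structure IsNet (s : ℕ) (D : ℕ → ℕ → ℝ) (R : ℕ → ℝ) (Z : Finset ℕ) : Prop where
  lt : ∀ z ∈ Z, z < s
  sep : ∀ z ∈ Z, ∀ z' ∈ Z, z ≠ z' → 32 * R z < D z z' ∧ 32 * R z' < D z z'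
  dom : ∀ t < s, ∃ z ∈ Z, D z t ≤ 32 * R t ∧ R z ≤ R t

/-- The cost of the ball around `z` of radius `4 * R z` if it is served by `y`. -/
noncomputable def localCost (s : ℕ) (D : ℕ → ℕ → ℝ) (U R : ℕ → ℝ) (z y : ℕ) : ℝ :=
  ∑ i ∈ range s, if D i z ≤ 4 * R z then U i * D i y ^ 2 else 0

/-- `g z` is the best center for the ball around `z` of radius `4 * R z`. -/
structure IsRefinement (s : ℕ) (D : ℕ → ℕ → ℝ) (U R : ℕ → ℝ) (Z : Finset ℕ) (g : ℕ → ℕ) :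
    Prop where
  lt : ∀ z ∈ Z, g z < s
  near : ∀ z ∈ Z, D (g z) z ≤ 4 * R z
  best : ∀ z ∈ Z, ∀ y < s, D y z ≤ 4 * R z → localCost s D U R z (g z) ≤ localCost s D U R z y

section LMP

variable {s : ℕ} {D : ℕ → ℕ → ℝ} {U R : ℕ → ℝ} {r₀ f : ℝ} {Z T : Finset ℕ} {g τ : ℕ → ℕ}
  {h : ℕ → ℝ}

/-- The cost of the cluster of `t` exceeds its optimal cost by `f` at most. -/
theorem cluster_cost_le (hD : MetricOn s D) (hU : ∀ i < s, 0 ≤ U i) (hr : 0 < r₀)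
    (hsep : ∀ i < s, ∀ j < s, i ≠ j → 64 * r₀ ≤ D i j)
    (hR : ValidRadii s D U r₀ f R) (hZ : IsNet s D R Z) (hg : IsRefinement s D U R Z g)
    (hf : 0 ≤ f) (hh : ∀ i < s, 0 ≤ h i ∧ ∀ z ∈ Z, h i ≤ D i (g z)) {t : ℕ} (ht : t < s)
    {A : Finset ℕ} (hA : A ⊆ range s) :
    ∑ i ∈ A, U i * h i ^ 2 ≤ 5329 * (∑ i ∈ A, U i * D i t ^ 2 + f) := by
  obtain ⟨z, hz, hzt, hRz⟩ := hZ.dom t ht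
  have hzs := hZ.lt z hz
  have hgs := hg.lt z hz
  have hgz := hg.near z hz
  have hRt : r₀ ≤ R t := hR.ge t ht
  rcases hR.value_le t ht with h0 | h0
  -- The ball of `t` has never grown. The separation by `64 * r₀` then forces the net point that
  -- dominates `t`, and its refined center, to be `t` itself.
  · have hzt' : z = t := by
      by_contra hne
      linarith [hsep z hzs t ht hne]
    subst hzt'
    have hgz' : g z = z := by
      by_contra hne
      linarith [hsep _ hgs _ ht hne]
    have : ∑ i ∈ A, U i * h i ^ 2 ≤ ∑ i ∈ A, U i * D i z ^ 2 := by
      refine sum_le_sum fun i hi => ?_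
      have his := mem_range.1 (hA hi)
      have h1 := (hh i his).2 z hz
      rw [hgz'] at h1
      exact mul_le_mul_of_nonneg_left (pow_le_pow_left₀ (hh i his).1 h1 2) (hU i his)
    have h2 : 0 ≤ ∑ i ∈ A, U i * D i z ^ 2 :=
      sum_nonneg fun i hi => mul_nonneg (hU i (mem_range.1 (hA hi))) (sq_nonneg _)
    linarith
  -- The refined center lies within `32 * R t + 4 * R t` of `t`, so `h i ≤ D i t + 36 * R t`. This
  -- is at most 73 times the larger of `D i t` and `R t / 2`, and `5329 = 73 ^ 2`. The points within
  -- `R t / 2` are paid for by `f`.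
  · have key : ∀ i ∈ A, U i * h i ^ 2 ≤ 5329 * (U i * D i t ^ 2) +
        5329 * ((if D t i ≤ R t / 2 then U i else 0) * (R t / 2) * (R t / 2)) := by
      intro i hi
      have his := mem_range.1 (hA hi)
      have h1 := (hh i his).2 z hz
      have h2 := hD.tri i his t ht (g z) hgs
      have h3 := hD.tri t ht z hzs (g z) hgs
      rw [hD.symm t ht z hzs, hD.symm z hzs _ hgs] at h3
      have h4 : h i ≤ D i t + 36 * R t := by linarith
      have h5 := hD.symm i his t ht
      have h6 := hD.nonneg i his t ht
      have h0 := (hh i his).1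
      split_ifs with hc
      · have h7 : h i ≤ 73 * (R t / 2) := by linarith
        have h8 : h i ^ 2 ≤ (73 * (R t / 2)) ^ 2 := pow_le_pow_left₀ h0 h7 2
        have h9 := mul_le_mul_of_nonneg_left h8 (hU i his)
        nlinarith [mul_nonneg (hU i his) (sq_nonneg (D i t))]
      · have h7 : h i ≤ 73 * D i t := by linarith
        have h8 : h i ^ 2 ≤ (73 * D i t) ^ 2 := pow_le_pow_left₀ h0 h7 2
        have h9 := mul_le_mul_of_nonneg_left h8 (hU i his)
        nlinarith
    have h1 := sum_le_sum key
    rw [sum_add_distrib, ← mul_sum, ← mul_sum, ← sum_mul, ← sum_mul] at h1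
    have h2 : ∑ i ∈ A, (if D t i ≤ R t / 2 then U i else 0) ≤
        ∑ i ∈ range s, (if D t i ≤ R t / 2 then U i else 0) :=
      sum_le_sum_of_subset_of_nonneg hA fun i hi _ => by
        split_ifs
        exacts [hU i (mem_range.1 hi), le_rfl]
    have h3 : (∑ i ∈ A, (if D t i ≤ R t / 2 then U i else 0)) * (R t / 2) * (R t / 2) ≤ f := by
      refine le_trans ?_ h0
      unfold ballValue
      have : 0 ≤ R t / 2 := by linarith
      gcongr
    linarith

/-- A ball without optimal centers nearby has a large cost. -/
theorem le_ball_cost (hD : MetricOn s D) (hU : ∀ i < s, 0 ≤ U i) (hr : 0 < r₀)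
    (hR : ValidRadii s D U r₀ f R) (hτ : ∀ i < s, τ i < s) {z : ℕ} (hz : z < s)
    (hfar : ∀ i < s, 2 * R z < D z (τ i)) :
    f ≤ ∑ i ∈ range s with D z i ≤ R z, U i * D i (τ i) ^ 2 := by
  refine (hR.le_value z hz).trans ?_
  unfold ballValue
  rw [sum_mul, sum_mul, sum_filter]
  refine sum_le_sum fun i hi => ?_
  have his := mem_range.1 hi
  -- With all optimal centers farther than `2 * R z` from `z`, every point of the ball is at least
  -- `R z` away from its own center.
  split_ifs with hc
  · have h1 := hD.tri z hz i his (τ i) (hτ i his)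
    have h2 := hfar i his
    have h3 : R z ≤ D i (τ i) := by linarith
    have h4 : 0 ≤ R z := hr.le.trans (hR.ge z hz)
    have h5 : R z ^ 2 ≤ D i (τ i) ^ 2 := pow_le_pow_left₀ h4 h3 2
    nlinarith [mul_le_mul_of_nonneg_left h5 (hU i his)]
  · simp

/-- If the ball around `z` has exactly one optimal center nearby, then the refinement serves the
cluster of this center well. -/
theorem good_cluster_cost_le (hD : MetricOn s D) (hU : ∀ i < s, 0 ≤ U i) (hr : 0 < r₀)
    (hR : ∀ i < s, r₀ ≤ R i) (hZ : IsNet s D R Z) (hg : IsRefinement s D U R Z g)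
    (hh : ∀ i < s, 0 ≤ h i ∧ ∀ z ∈ Z, h i ≤ D i (g z))
    (hT : ∀ t ∈ T, t < s) (hτ : ∀ i < s, τ i ∈ T ∧ ∀ t ∈ T, D i (τ i) ≤ D i t)
    {z t : ℕ} (hz : z ∈ Z) (ht : t ∈ T) (hzt : D z t ≤ 2 * R z)
    (huniq : ∀ t' ∈ T, D z t' ≤ 16 * R z → t' = t) :
    ∑ i ∈ range s with τ i = t, U i * h i ^ 2 ≤
      5329 * ∑ i ∈ range s with τ i = t, U i * D i (τ i) ^ 2 := by
  have hzs := hZ.lt z hz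
  have hgs := hg.lt z hz
  have hgz := hg.near z hz
  have hts := hT t ht
  have hRz : 0 < R z := hr.trans_le (hR z hzs)
  -- Such a point is within `6 * R z` of `t`, hence of its own optimal center, which is then within
  -- `10 * R z` of `z`.
  have hin : ∀ i < s, D i z ≤ 4 * R z → τ i = t := by
    intro i hi hiz
    refine huniq _ (hτ i hi).1 ?_
    have h1 := hD.tri z hzs i hi (τ i) (hT _ (hτ i hi).1)
    have h2 := (hτ i hi).2 t ht
    have h3 := hD.tri i hi z hzs t hts
    rw [hD.symm z hzs i hi] at h1
    linarith
  have hloc := hg.best z hz t hts (by rw [hD.symm t hts z hzs]; linarith)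
  -- Inside the ball the refined center competes with `t`. A point of the cluster outside the ball
  -- has distance more than `2 * R z` from `t`, so its detour of at most `6 * R z` beyond `t` costs
  -- a factor of four in distance.
  have hsplit : ∀ i ∈ range s, (if τ i = t then U i * h i ^ 2 else 0) ≤
      (if D i z ≤ 4 * R z then U i * D i (g z) ^ 2 else 0) +
      (if D i z ≤ 4 * R z then 0 else if τ i = t then 16 * (U i * D i (τ i) ^ 2) else 0) := by
    intro i hi
    have his := mem_range.1 hi
    have h1 := (hh i his).2 z hz
    have h0 := (hh i his).1
    by_cases hc : D i z ≤ 4 * R z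
    · simp only [hc, hin i his hc, if_true, add_zero]
      exact mul_le_mul_of_nonneg_left (pow_le_pow_left₀ h0 h1 2) (hU i his)
    · simp only [hc, if_false, zero_add]
      split_ifs with hit
      · rw [hit]
        have h2 := hD.tri i his t hts z hzs
        have h3 := hD.tri i his t hts (g z) hgs
        have h4 := hD.tri t hts z hzs (g z) hgs
        rw [hD.symm t hts z hzs] at h2 h4
        rw [hD.symm z hzs _ hgs] at h4
        have h5 : h i ≤ 4 * D i t := by linarith
        have h6 : h i ^ 2 ≤ (4 * D i t) ^ 2 := pow_le_pow_left₀ h0 h5 2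
        nlinarith [mul_le_mul_of_nonneg_left h6 (hU i his)]
      · exact le_rfl
  rw [sum_filter, sum_filter]
  refine (sum_le_sum hsplit).trans ?_
  rw [sum_add_distrib]
  refine (add_le_add_left hloc _).trans ?_
  unfold localCost
  rw [← sum_add_distrib, mul_sum]
  refine sum_le_sum fun i hi => ?_
  have his := mem_range.1 hi
  have h7 := mul_nonneg (hU i his) (sq_nonneg (D i (τ i)))
  by_cases hc : D i z ≤ 4 * R z
  · have := hin i his hc
    simp only [hc, this, if_true, add_zero] at h7 ⊢
    linarith
  · simp only [hc, if_false, zero_add]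
    split_ifs <;> linarith

/-- The analysis of the clustering that consists of a refined net: it pays the threshold `f` for
every center beyond the number of optimal centers. -/
theorem net_cost_le (hD : MetricOn s D) (hU : ∀ i < s, 0 ≤ U i) (hr : 0 < r₀)
    (hsep : ∀ i < s, ∀ j < s, i ≠ j → 64 * r₀ ≤ D i j)
    (hR : ValidRadii s D U r₀ f R) (hZ : IsNet s D R Z) (hg : IsRefinement s D U R Z g)
    (hf : 0 ≤ f) (hh : ∀ i < s, 0 ≤ h i ∧ ∀ z ∈ Z, h i ≤ D i (g z))
    (hT : ∀ t ∈ T, t < s) (hτ : ∀ i < s, τ i ∈ T ∧ ∀ t ∈ T, D i (τ i) ≤ D i t) :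
    ∑ i ∈ range s, U i * h i ^ 2 + 10658 * f * Z.card ≤
      15987 * ∑ i ∈ range s, U i * D i (τ i) ^ 2 + 10658 * f * T.card := by
  classical
  set c : ℕ → ℝ := fun i => U i * D i (τ i) ^ 2 with hc
  have hc0 : ∀ i ∈ range s, 0 ≤ c i := fun i hi =>
    mul_nonneg (hU i (mem_range.1 hi)) (sq_nonneg _)
  have hRpos : ∀ i < s, 0 < R i := fun i hi => hr.trans_le (hR.ge i hi)
  -- disjointness of the zones
  have hdisj : ∀ z ∈ Z, ∀ z' ∈ Z, ∀ t < s, D z t ≤ 16 * R z → D z' t ≤ 16 * R z' → z = z' := by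
    intro z hz z' hz' t ht h1 h2
    by_contra hne
    have h3 := hZ.sep z hz z' hz' hne
    have h4 := hD.tri z (hZ.lt z hz) t ht z' (hZ.lt z' hz')
    rw [hD.symm t ht z' (hZ.lt z' hz')] at h4
    linarith
  -- The optimal centers claimed by `G` have clusters that are served without paying `f`. The balls
  -- in `A` pay `f` out of the optimal cost. Each remaining ball has two optimal centers in its zone
  -- of radius `16 * R z`.
  set G := Z.filter fun z => ∃ t ∈ T, D z t ≤ 2 * R z ∧ ∀ t' ∈ T, D z t' ≤ 16 * R z → t' = t
    with hG
  set A := Z.filter fun z => ∀ t ∈ T, 2 * R z < D z t with hA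
  have hφ : ∀ z, ∃ t, z ∈ G → t ∈ T ∧ D z t ≤ 2 * R z ∧ ∀ t' ∈ T, D z t' ≤ 16 * R z → t' = t := by
    intro z
    by_cases hz : z ∈ G
    · obtain ⟨t, ht⟩ := (mem_filter.1 hz).2
      exact ⟨t, fun _ => ht⟩
    · exact ⟨0, fun h => absurd h hz⟩
  choose φ hφ using hφ
  have hφinj : Set.InjOn φ G := by
    intro z hz z' hz' he
    have h1 := hφ z hz
    have h2 := hφ z' hz'
    have hz1 := (mem_filter.1 hz).1
    have hz2 := (mem_filter.1 hz').1
    refine hdisj z hz1 z' hz2 (φ z) (hT _ h1.1) ?_ ?_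
    · linarith [hRpos z (hZ.lt z hz1)]
    · rw [he]
      linarith [hRpos z' (hZ.lt z' hz2)]
  have hcardG : (G.image φ).card = G.card := card_image_of_injOn hφinj
  have himT : G.image φ ⊆ T := by
    intro t ht
    obtain ⟨z, hz, rfl⟩ := mem_image.1 ht
    exact (hφ z hz).1
  -- the cost of the clusters
  have hcl : ∀ t ∈ T, ∑ i ∈ range s with τ i = t, U i * h i ^ 2 ≤
      5329 * ∑ i ∈ range s with τ i = t, c i + if t ∉ G.image φ then 5329 * f else 0 := by
    intro t ht
    by_cases him : t ∈ G.image φ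
    · rw [if_neg (not_not.2 him)]
      obtain ⟨z, hz, rfl⟩ := mem_image.1 him
      obtain ⟨h1, h2, h3⟩ := hφ z hz
      have := good_cluster_cost_le hD hU hr hR.ge hZ hg hh hT hτ (mem_filter.1 hz).1 h1 h2 h3
      linarith
    · rw [if_pos him]
      have h1 := cluster_cost_le hD hU hr hsep hR hZ hg hf hh (hT t ht)
        (filter_subset (fun i => τ i = t) (range s))
      have h2 : ∑ i ∈ range s with τ i = t, U i * D i t ^ 2 = ∑ i ∈ range s with τ i = t, c i :=
        sum_congr rfl fun i hi => by rw [hc]; simp only [(mem_filter.1 hi).2]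
      linarith
  have hmaps : ∀ i ∈ range s, τ i ∈ T := fun i hi => (hτ i (mem_range.1 hi)).1
  have htot := sum_le_sum hcl
  rw [sum_fiberwise_of_maps_to hmaps, sum_add_distrib, ← mul_sum, sum_fiberwise_of_maps_to hmaps,
    ← sum_filter, sum_const, nsmul_eq_mul] at htot
  have hcard1 : ((T.filter fun t => t ∉ G.image φ).card : ℝ) + G.card = T.card := by
    rw [← hcardG]
    have h1 : T.filter (fun t => t ∉ G.image φ) = T \ G.image φ := by
      ext t; simp
    rw [h1]
    exact_mod_cast card_sdiff_add_card_eq_card himT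
  -- balls without optimal centers
  have hAf : f * A.card ≤ ∑ i ∈ range s, c i := by
    have h1 : ∑ z ∈ A, f ≤ ∑ z ∈ A, ∑ i ∈ range s with D z i ≤ R z, c i := by
      refine sum_le_sum fun z hz => ?_
      obtain ⟨hz, hfar⟩ := mem_filter.1 hz
      exact le_ball_cost hD hU hr hR (fun i hi => hT _ (hτ i hi).1) (hZ.lt z hz)
        fun i hi => hfar _ (hτ i hi).1
    rw [← sum_biUnion] at h1
    · rw [sum_const, nsmul_eq_mul] at h1
      have h2 : ∑ i ∈ A.biUnion (fun z => {i ∈ range s | D z i ≤ R z}), c i ≤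
          ∑ i ∈ range s, c i := by
        refine sum_le_sum_of_subset_of_nonneg ?_ fun i hi _ => hc0 i hi
        intro i hi
        obtain ⟨z, -, hi⟩ := mem_biUnion.1 hi
        exact (mem_filter.1 hi).1
      linarith
    · intro z hz z' hz' hne
      rw [Function.onFun, disjoint_left]
      intro i hi hi'
      have h3 := mem_filter.1 hi
      have h4 := mem_filter.1 hi'
      have hz1 := (mem_filter.1 hz).1
      have hz2 := (mem_filter.1 hz').1
      refine hne (hdisj z hz1 z' hz2 i (mem_range.1 h3.1) ?_ ?_)
      · linarith [hRpos z (hZ.lt z hz1)]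
      · linarith [hRpos z' (hZ.lt z' hz2)]
  -- counting
  have hcount : 2 * Z.card ≤ G.card + 2 * A.card + T.card := by
    -- Every ball collects two tokens: both from `A`, or one from `G` and one from its center, or
    -- one from each of two centers. The zones are disjoint, so no center is charged twice.
    have h1 : ∀ z ∈ Z, 2 ≤ (if z ∈ G then 1 else 0) + 2 * (if z ∈ A then 1 else 0) +
        (T.filter fun t => D z t ≤ 16 * R z).card := by
      intro z hz
      by_cases hzA : z ∈ A
      · simp only [hzA, if_true]
        omega
      · have hzA' := hzA
        rw [hA, mem_filter] at hzA
        push Not at hzA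
        obtain ⟨t, ht, hzt⟩ := hzA hz
        have hRz := hRpos z (hZ.lt z hz)
        have htm : t ∈ T.filter fun t => D z t ≤ 16 * R z :=
          mem_filter.2 ⟨ht, by linarith⟩
        by_cases hzG : z ∈ G
        · simp only [hzG, if_true]
          have := card_pos.2 ⟨t, htm⟩
          omega
        · simp only [hzG, hzA', if_false]
          rw [hG, mem_filter] at hzG
          push Not at hzG
          obtain ⟨t', ht', hzt', hne⟩ := hzG hz t ht hzt
          have := one_lt_card.2 ⟨t, htm, t', mem_filter.2 ⟨ht', hzt'⟩, hne.symm⟩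
          omega
    have h2 := sum_le_sum h1
    rw [sum_const, smul_eq_mul, sum_add_distrib, sum_add_distrib, ← mul_sum,
      ← card_filter, ← card_filter, ← card_biUnion] at h2
    · have h3 : (Z.filter fun z => z ∈ G).card ≤ G.card := card_le_card fun z hz => (mem_filter.1 hz).2
      have h4 : (Z.filter fun z => z ∈ A).card ≤ A.card := card_le_card fun z hz => (mem_filter.1 hz).2
      have h5 : (Z.biUnion fun z => T.filter fun t => D z t ≤ 16 * R z).card ≤ T.card :=
        card_le_card fun t ht => by
          obtain ⟨z, -, ht⟩ := mem_biUnion.1 ht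
          exact (mem_filter.1 ht).1
      omega
    · intro z hz z' hz' hne
      rw [Function.onFun, disjoint_left]
      intro t ht ht'
      have h3 := mem_filter.1 ht
      have h4 := mem_filter.1 ht'
      exact hne (hdisj z hz z' hz' t (hT t h3.1) h3.2 h4.2)
  have hcount' : 2 * (Z.card : ℝ) ≤ G.card + 2 * A.card + T.card := by exact_mod_cast hcount
  -- The clusters that pay `5329 * f` number at most `2 * |A| + 2 * (|T| - |Z|)`, and `f * |A|` is
  -- at most the optimal cost. This gives `15987 = 3 * 5329` and `10658 = 2 * 5329`.
  have hp : ((T.filter fun t => t ∉ G.image φ).card : ℝ) ≤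
      2 * A.card + 2 * (T.card - Z.card) := by linarith
  have := mul_le_mul_of_nonneg_right hp (show 0 ≤ 5329 * f by linarith)
  nlinarith
end LMP

end KMeans

namespace KMeans

open Finset

/-! ## Greedy nets -/

/-- The point `i` is not covered by the net `Z`. -/
def Uncovered (D : ℕ → ℕ → ℝ) (R : ℕ → ℝ) (Z : Finset ℕ) (i : ℕ) : Prop :=
  ∀ z ∈ Z, ¬ D z i ≤ 32 * R i

/-- The first `j` rounds of the greedy construction of a net. -/
noncomputable def greedyNet (s : ℕ) (D : ℕ → ℕ → ℝ) (R : ℕ → ℝ) : ℕ → Finset ℕ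
  | 0 => ∅
  | j + 1 =>
    if argmin s (Uncovered D R (greedyNet s D R j)) R < s then
      insert (argmin s (Uncovered D R (greedyNet s D R j)) R) (greedyNet s D R j)
    else greedyNet s D R j

section greedyNet

variable {s : ℕ} {D : ℕ → ℕ → ℝ} {R : ℕ → ℝ}

theorem greedyNet_lt (j : ℕ) : ∀ z ∈ greedyNet s D R j, z < s := by
  induction j with
  | zero => simp [greedyNet]
  | succ j ih =>
    rw [greedyNet]
    split_ifs with h
    · intro z hz
      rcases mem_insert.1 hz with rfl | hz
      · exact h
      · exact ih z hz
    · exact ih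

theorem not_uncovered_self (hD : MetricOn s D) (hR : ∀ i < s, 0 ≤ R i) {Z : Finset ℕ} {i : ℕ}
    (hi : i < s) (h : Uncovered D R Z i) : i ∉ Z := fun hZ => h i hZ (by
  rw [hD.self i hi]; linarith [hR i hi])

/-- Points are chosen in order of nondecreasing radius. A new point `b` is farther than `32 * R b`
from the earlier ones because it is uncovered, and their radii are no larger. A point first covered
by `b` was a candidate when `b` was chosen, so its radius is at least `R b`. The second clause
counts rounds: each adds a point until everything is covered. -/
theorem greedyNet_le (hD : MetricOn s D) (hR : ∀ i < s, 0 ≤ R i) (j : ℕ) :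
    (∀ z ∈ greedyNet s D R j, ∀ t < s, Uncovered D R (greedyNet s D R j) t → R z ≤ R t) ∧
    ((∀ t < s, ¬ Uncovered D R (greedyNet s D R j) t) ∨ (greedyNet s D R j).card = j) ∧
    (∀ z ∈ greedyNet s D R j, ∀ z' ∈ greedyNet s D R j, z ≠ z' →
      32 * R z < D z z' ∧ 32 * R z' < D z z') ∧
    (∀ t < s, ¬ Uncovered D R (greedyNet s D R j) t →
      ∃ z ∈ greedyNet s D R j, D z t ≤ 32 * R t ∧ R z ≤ R t) := by
  induction j with
  | zero => simp [greedyNet, Uncovered]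
  | succ j ih =>
    obtain ⟨h1, h2, h3, h4⟩ := ih
    have hlt := greedyNet_lt (s := s) (D := D) (R := R) j
    rw [greedyNet]
    split_ifs with h
    · obtain ⟨-, hb, hmin⟩ := argmin_spec (g := R) (exists_of_argmin_lt h)
      set b := argmin s (Uncovered D R (greedyNet s D R j)) R
      have hbZ := not_uncovered_self hD hR h hb
      have hmono : ∀ t, Uncovered D R (insert b (greedyNet s D R j)) t →
          Uncovered D R (greedyNet s D R j) t := fun t ht z hz => ht z (mem_insert_of_mem hz)
      refine ⟨?_, Or.inr ?_, ?_, ?_⟩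
      · intro z hz t ht hu
        rcases mem_insert.1 hz with rfl | hz
        · exact hmin t ht (hmono t hu)
        · exact h1 z hz t ht (hmono t hu)
      · rw [card_insert_of_notMem hbZ]
        rcases h2 with h2 | h2
        · exact absurd hb (h2 b h)
        · rw [h2]
      · have key : ∀ z ∈ greedyNet s D R j, 32 * R z < D z b ∧ 32 * R b < D z b := by
          intro z hz
          have h5 := not_le.1 (hb z hz)
          have h6 := h1 z hz b h hb
          exact ⟨by linarith, h5⟩
        intro z hz z' hz' hne
        rcases mem_insert.1 hz with rfl | hz
        · rcases mem_insert.1 hz' with rfl | hz'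
          · exact absurd rfl hne
          · rw [hD.symm _ h _ (hlt _ hz')]
            exact (key z' hz').symm
        · rcases mem_insert.1 hz' with rfl | hz'
          · exact key z hz
          · exact h3 z hz z' hz' hne
      · intro t ht hu
        by_cases hu' : Uncovered D R (greedyNet s D R j) t
        · refine ⟨b, mem_insert_self _ _, ?_, hmin t ht hu'⟩
          by_contra hc
          refine hu fun z hz => ?_
          rcases mem_insert.1 hz with rfl | hz
          · exact hc
          · exact hu' z hz
        · obtain ⟨z, hz, h5⟩ := h4 t ht hu'
          exact ⟨z, mem_insert_of_mem hz, h5⟩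
    · refine ⟨h1, Or.inl fun t ht hu => h ?_, h3, h4⟩
      exact (argmin_spec ⟨t, ht, hu⟩).1

/-- After `s` rounds either everything is covered or all points have been chosen, and a chosen point
covers itself. -/
theorem isNet_greedyNet (hD : MetricOn s D) (hR : ∀ i < s, 0 ≤ R i) :
    IsNet s D R (greedyNet s D R s) := by
  obtain ⟨h1, h2, h3, h4⟩ := greedyNet_le hD hR s
  refine ⟨greedyNet_lt s, h3, fun t ht => h4 t ht ?_⟩
  rcases h2 with h2 | h2
  · exact h2 t ht
  · have : greedyNet s D R s = range s :=
      eq_of_subset_of_card_le (fun z hz => mem_range.2 (greedyNet_lt s z hz)) (by simp [h2])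
    intro hu
    exact not_uncovered_self hD hR ht hu (this ▸ mem_range.2 ht)

/-- This and the next lemma supply the two ends of the binary search: all balls have reached
everything, respectively no ball has grown yet. -/
theorem card_net_le_one {Z : Finset ℕ} (hZ : IsNet s D R Z)
    (h : ∀ i < s, ∀ j < s, D i j ≤ 32 * R i) : Z.card ≤ 1 := by
  refine card_le_one.2 fun z hz z' hz' => ?_
  by_contra hne
  have h1 := (hZ.sep z hz z' hz' hne).1
  have h2 := h z (hZ.lt z hz) z' (hZ.lt z' hz')
  linarith

theorem card_net_eq {Z : Finset ℕ} (hZ : IsNet s D R Z)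
    (h : ∀ i < s, ∀ j < s, i ≠ j → 32 * R j < D i j) : Z.card = s := by
  have : Z = range s := by
    ext t
    refine ⟨fun ht => mem_range.2 (hZ.lt t ht), fun ht => ?_⟩
    have ht := mem_range.1 ht
    obtain ⟨z, hz, h1, -⟩ := hZ.dom t ht
    by_contra hn
    have hne : z ≠ t := fun h => hn (h ▸ hz)
    linarith [h z (hZ.lt z hz) t ht hne]
  rw [this, card_range]

/-- Refinement moves a center by at most four radii, while net points are more than 32 radii apart.
The larger of the two refined nets thus still has more than `k` centers. -/
theorem injOn_refinement {U : ℕ → ℝ} {Z : Finset ℕ} {g : ℕ → ℕ} (hD : MetricOn s D)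
    (hR : ∀ i < s, 0 ≤ R i) (hZ : IsNet s D R Z) (hg : IsRefinement s D U R Z g) :
    Set.InjOn g Z := by
  intro z hz z' hz' he
  by_contra hne
  have h1 := hZ.sep z hz z' hz' hne
  have h2 := hg.near z hz
  have h3 := hg.near z' hz'
  rw [← he] at h3
  have hzs := hZ.lt z hz
  have hzs' := hZ.lt z' hz'
  have h4 := hD.tri z hzs (g z) (hg.lt z hz) z' hzs'
  rw [hD.symm z hzs (g z) (hg.lt z hz)] at h4
  linarith [hR z hzs, hR z' hzs']

end greedyNet

/-! ## The growth of the radii -/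

section level

variable (s : ℕ) (D : ℕ → ℕ → ℝ) (U : ℕ → ℝ) (r₀ dmax : ℝ)

/-- The index of the ball that is doubled next. -/
noncomputable def nextBall (l : ℕ → ℕ) : ℕ :=
  argmin s (fun i => ¬ dmax ≤ r₀ * 2 ^ l i) fun i => ballValue s D U i (r₀ * 2 ^ l i)

/-- The logarithms of the radii after `M` doublings. -/
noncomputable def level : ℕ → ℕ → ℕ
  | 0 => fun _ => 0
  -- When every radius has reached `dmax`, `nextBall` is `s`, and the update hits an index that is
  -- not a point.
  | M + 1 => Function.update (level M) (nextBall s D U r₀ dmax (level M))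
      (level M (nextBall s D U r₀ dmax (level M)) + 1)

/-- The radii after `M` doublings. -/
noncomputable def levelRadius (M i : ℕ) : ℝ := r₀ * 2 ^ level s D U r₀ dmax M i

variable {s D U r₀ dmax}

theorem ballValue_mono (hU : ∀ i < s, 0 ≤ U i) {i : ℕ} {r r' : ℝ} (hr : 0 ≤ r) (hrr : r ≤ r') :
    ballValue s D U i r ≤ ballValue s D U i r' := by
  unfold ballValue
  have h1 : ∑ j ∈ range s, (if D i j ≤ r then U j else 0) ≤
      ∑ j ∈ range s, if D i j ≤ r' then U j else 0 := by
    refine sum_le_sum fun j hj => ?_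
    have := hU j (mem_range.1 hj)
    split_ifs with h h'
    · exact le_rfl
    · exact absurd (h.trans hrr) h'
    · exact this
    · exact le_rfl
  have h0 : 0 ≤ ∑ j ∈ range s, (if D i j ≤ r then U j else 0) := by
    refine sum_nonneg fun j hj => ?_
    split_ifs
    exacts [hU j (mem_range.1 hj), le_rfl]
  have h2 := h0.trans h1
  exact mul_le_mul (mul_le_mul h1 hrr hr h2) hrr hr (mul_nonneg h2 (hr.trans hrr))

theorem ballValue_nonneg (hU : ∀ i < s, 0 ≤ U i) {i : ℕ} {r : ℝ} (hr : 0 ≤ r) :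
    0 ≤ ballValue s D U i r := by
  have := ballValue_mono (D := D) (i := i) hU le_rfl hr
  simpa [ballValue] using this

/-- A ball of radius at least `dmax` contains all points. Saturated balls therefore respect any
threshold taken from an unsaturated one. -/
theorem ballValue_le_of_le (hU : ∀ i < s, 0 ≤ U i) (hd : ∀ i < s, ∀ j < s, D i j ≤ dmax) {i j : ℕ}
    (hj : j < s) {r r' : ℝ} (hr : 0 ≤ r) (h : r ≤ dmax) (h' : dmax ≤ r') :
    ballValue s D U i r ≤ ballValue s D U j r' := by
  unfold ballValue
  have h1 : ∑ l ∈ range s, (if D i l ≤ r then U l else 0) ≤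
      ∑ l ∈ range s, if D j l ≤ r' then U l else 0 := by
    refine sum_le_sum fun l hl => ?_
    have hls := mem_range.1 hl
    rw [if_pos ((hd j hj l hls).trans h')]
    split_ifs
    exacts [le_rfl, hU l hls]
  have h2 : 0 ≤ ∑ l ∈ range s, if D j l ≤ r' then U l else 0 := by
    refine sum_nonneg fun j hj => ?_
    split_ifs
    exacts [hU j (mem_range.1 hj), le_rfl]
  have h3 := h.trans h'
  exact mul_le_mul (mul_le_mul h1 h3 hr h2) h3 hr (mul_nonneg h2 (hr.trans h3))

variable (s D U r₀ dmax) in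
/-- The value of the ball that is doubled next. -/
noncomputable def nextValue (M : ℕ) : ℝ :=
  ballValue s D U (nextBall s D U r₀ dmax (level s D U r₀ dmax M))
    (levelRadius s D U r₀ dmax M (nextBall s D U r₀ dmax (level s D U r₀ dmax M)))

theorem levelRadius_succ (M i : ℕ) : levelRadius s D U r₀ dmax (M + 1) i =
    if i = nextBall s D U r₀ dmax (level s D U r₀ dmax M) then
      2 * levelRadius s D U r₀ dmax M i else levelRadius s D U r₀ dmax M i := by
  unfold levelRadius
  rw [level, Function.update_apply]
  split_ifs with h
  · rw [h, pow_succ]; ring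
  · rfl

theorem le_levelRadius (hr : 0 < r₀) (M i : ℕ) : r₀ ≤ levelRadius s D U r₀ dmax M i := by
  unfold levelRadius
  have : (1 : ℝ) ≤ 2 ^ level s D U r₀ dmax M i := one_le_pow₀ (by norm_num)
  nlinarith

theorem exists_lt_of_succ (hr : 0 < r₀) {M : ℕ}
    (h : ∃ i < s, ¬ dmax ≤ levelRadius s D U r₀ dmax (M + 1) i) :
    ∃ i < s, ¬ dmax ≤ levelRadius s D U r₀ dmax M i := by
  obtain ⟨i, hi, h⟩ := h
  refine ⟨i, hi, fun h' => h (h'.trans ?_)⟩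
  rw [levelRadius_succ]
  split_ifs
  · linarith [le_levelRadius (s := s) (D := D) (U := U) (dmax := dmax) hr M i]
  · exact le_rfl

/-- Half of a grown radius is the radius before the last doubling, when the value of this ball was
the minimum. The minimum never decreases afterwards, since it runs over ever fewer balls, and balls
only grow. -/
theorem value_half_le (hU : ∀ i < s, 0 ≤ U i) (hr : 0 < r₀) (M : ℕ)
    (h : ∃ i < s, ¬ dmax ≤ levelRadius s D U r₀ dmax M i) :
    ∀ i < s, levelRadius s D U r₀ dmax M i = r₀ ∨
      ballValue s D U i (levelRadius s D U r₀ dmax M i / 2) ≤ nextValue s D U r₀ dmax M := by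
  induction M with
  | zero => exact fun i _ => Or.inl (by simp [levelRadius, level])
  | succ M ih =>
    intro i hi
    have h' := exists_lt_of_succ hr h
    obtain ⟨hb, hbe, hmin⟩ := argmin_spec
      (g := fun i => ballValue s D U i (levelRadius s D U r₀ dmax M i)) h'
    obtain ⟨hb', hbe', -⟩ := argmin_spec
      (g := fun i => ballValue s D U i (levelRadius s D U r₀ dmax (M + 1) i)) h
    have hle : nextValue s D U r₀ dmax M ≤ nextValue s D U r₀ dmax (M + 1) := by
      set b' := nextBall s D U r₀ dmax (level s D U r₀ dmax (M + 1))
      have h1 : levelRadius s D U r₀ dmax M b' ≤ levelRadius s D U r₀ dmax (M + 1) b' := by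
        rw [levelRadius_succ]
        split_ifs
        · linarith [le_levelRadius (s := s) (D := D) (U := U) (dmax := dmax) hr M b']
        · exact le_rfl
      refine (hmin b' hb' fun h2 => hbe' (h2.trans h1)).trans ?_
      exact ballValue_mono hU (hr.le.trans (le_levelRadius hr _ _)) h1
    by_cases hib : i = nextBall s D U r₀ dmax (level s D U r₀ dmax M)
    · right
      rw [levelRadius_succ, if_pos hib, mul_div_cancel_left₀ _ (two_ne_zero), hib]
      exact hle
    · rw [levelRadius_succ, if_neg hib]
      exact (ih h' i hi).imp id fun h => h.trans hle

/-- One threshold serves both before and after a doubling: the doubled ball had exactly this value,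
which is now the value at half of its radius. This makes the two nets comparable in the merge. -/
theorem validRadii_level (hU : ∀ i < s, 0 ≤ U i) (hr : 0 < r₀)
    (hd : ∀ i < s, ∀ j < s, D i j ≤ dmax) (M : ℕ)
    (h : ∃ i < s, ¬ dmax ≤ levelRadius s D U r₀ dmax M i) :
    0 ≤ nextValue s D U r₀ dmax M ∧
    ValidRadii s D U r₀ (nextValue s D U r₀ dmax M) (levelRadius s D U r₀ dmax M) ∧
    ValidRadii s D U r₀ (nextValue s D U r₀ dmax M) (levelRadius s D U r₀ dmax (M + 1)) := by
  obtain ⟨hb, hbe, hmin⟩ := argmin_spec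
    (g := fun i => ballValue s D U i (levelRadius s D U r₀ dmax M i)) h
  have hpos : ∀ M i, 0 ≤ levelRadius s D U r₀ dmax M i := fun M i =>
    hr.le.trans (le_levelRadius hr _ _)
  have hge : ∀ i < s, nextValue s D U r₀ dmax M ≤
      ballValue s D U i (levelRadius s D U r₀ dmax M i) := by
    intro i hi
    by_cases hie : dmax ≤ levelRadius s D U r₀ dmax M i
    · exact ballValue_le_of_le hU hd hi (hpos _ _) (not_le.1 hbe).le hie
    · exact hmin i hi hie
  have hhalf := value_half_le hU hr M h
  refine ⟨ballValue_nonneg hU (hpos _ _), ⟨fun i _ => le_levelRadius hr _ _, hge, hhalf⟩,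
    ⟨fun i _ => le_levelRadius hr _ _, fun i hi => (hge i hi).trans ?_, fun i hi => ?_⟩⟩
  · refine ballValue_mono hU (hpos _ _) ?_
    rw [levelRadius_succ]
    split_ifs
    · linarith [hpos M i]
    · exact le_rfl
  · by_cases hib : i = nextBall s D U r₀ dmax (level s D U r₀ dmax M)
    · right
      rw [levelRadius_succ, if_pos hib, mul_div_cancel_left₀ _ (two_ne_zero), hib]
      exact le_rfl
    · rw [levelRadius_succ, if_neg hib]
      exact hhalf i hi

/-- Only balls of level below `L` are doubled, and until all are saturated each doubling raises the
sum of the levels by one. The sum `s * L` forces every level to be `L`. -/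
theorem le_levelRadius_of_mul_le (hr : 0 < r₀) {L : ℕ} (hL : dmax ≤ r₀ * 2 ^ L) {i : ℕ}
    (hi : i < s) : dmax ≤ levelRadius s D U r₀ dmax (s * L) i := by
  have key : ∀ M, (∀ i < s, level s D U r₀ dmax M i ≤ L) ∧
      ((∀ i < s, dmax ≤ levelRadius s D U r₀ dmax M i) ∨
        ∑ i ∈ range s, level s D U r₀ dmax M i = M) := by
    intro M
    induction M with
    | zero => exact ⟨fun i _ => Nat.zero_le _, Or.inr (by simp [level])⟩
    | succ M ih =>
      obtain ⟨h1, h2⟩ := ih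
      by_cases h : ∃ i < s, ¬ dmax ≤ levelRadius s D U r₀ dmax M i
      · obtain ⟨hb, hbe, -⟩ := argmin_spec
          (g := fun i => ballValue s D U i (levelRadius s D U r₀ dmax M i)) h
        change nextBall s D U r₀ dmax (level s D U r₀ dmax M) < s at hb
        set b := nextBall s D U r₀ dmax (level s D U r₀ dmax M) with hbdef
        have hlt : level s D U r₀ dmax M b < L := by
          by_contra hge
          refine hbe (hL.trans ?_)
          have : (2 : ℝ) ^ L ≤ 2 ^ level s D U r₀ dmax M b :=
            pow_le_pow_right₀ (by norm_num) (not_lt.1 hge)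
          exact mul_le_mul_of_nonneg_left this hr.le
        constructor
        · intro i hi
          rw [level, Function.update_apply, ← hbdef]
          split_ifs
          · omega
          · exact h1 i hi
        · right
          rcases h2 with h2 | h2
          · exact absurd (h2 b hb) hbe
          · rw [level, ← hbdef, sum_update_of_mem (mem_range.2 hb)]
            rw [← add_sum_erase _ _ (mem_range.2 hb)] at h2
            rw [← erase_eq]
            omega
      · push Not at h
        have hb : nextBall s D U r₀ dmax (level s D U r₀ dmax M) = s :=
          argmin_eq fun i hi hn => hn (h i hi)
        constructor
        · intro i hi
          rw [level, hb, Function.update_of_ne hi.ne]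
          exact h1 i hi
        · left
          intro i hi
          rw [levelRadius_succ, hb, if_neg hi.ne]
          exact h i hi
  obtain ⟨h1, h2 | h2⟩ := key (s * L)
  · exact h2 i hi
  · have h3 : ∑ i ∈ range s, level s D U r₀ dmax (s * L) i = ∑ i ∈ range s, L := by
      rw [h2, sum_const, card_range, smul_eq_mul]
    rw [sum_eq_sum_iff_of_le fun i hi => h1 i (mem_range.1 hi)] at h3
    unfold levelRadius
    rw [h3 i (mem_range.2 hi)]
    exact hL

end level

/-! ## Merging two clusterings -/

section fill

variable (S₂ : Finset ℕ) (v : ℕ → ℝ) (s k : ℕ)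

/-- Extend `F` by elements of `S₂` of largest value, up to the size `k`. -/
noncomputable def fill (F : Finset ℕ) : ℕ → Finset ℕ
  | 0 => F
  | j + 1 =>
    if (fill F j).card < k then
      insert (argmin s (fun i => i ∈ S₂ ∧ i ∉ fill F j) fun i => -v i) (fill F j)
    else fill F j

variable {S₂ v s k}

/-- Each addition takes a largest remaining value, so whatever is left out is worth no more than
whatever was added. At most `k` rounds are effective; later ones are idle. -/
theorem fill_spec {N : Finset ℕ} (hS : ∀ i ∈ S₂, i < s) (hN : N ⊆ S₂) (hNk : N.card ≤ k)
    (hk : k ≤ S₂.card) (j : ℕ) :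
    N ⊆ fill S₂ v s k N j ∧ fill S₂ v s k N j ⊆ S₂ ∧ (fill S₂ v s k N j).card ≤ k ∧
    min j k ≤ (fill S₂ v s k N j).card ∧
    ∀ a ∈ S₂ \ fill S₂ v s k N j, ∀ b ∈ fill S₂ v s k N j \ N, v a ≤ v b := by
  induction j with
  | zero => simp [fill, hN, hNk]
  | succ j ih =>
    obtain ⟨h1, h2, h3, h4, h5⟩ := ih
    rw [fill]
    split_ifs with hc
    · have hex : ∃ i < s, i ∈ S₂ ∧ i ∉ fill S₂ v s k N j := by
        obtain ⟨i, hi, hi'⟩ := exists_mem_notMem_of_card_lt_card (hc.trans_le hk)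
        exact ⟨i, hS i hi, hi, hi'⟩
      obtain ⟨-, ⟨hb1, hb2⟩, hmin⟩ := argmin_spec (g := fun i => -v i) hex
      set b := argmin s (fun i => i ∈ S₂ ∧ i ∉ fill S₂ v s k N j) fun i => -v i
      refine ⟨h1.trans (subset_insert _ _), insert_subset hb1 h2, ?_, ?_, ?_⟩
      · rw [card_insert_of_notMem hb2]; omega
      · rw [card_insert_of_notMem hb2]; omega
      · intro a ha e he
        rw [mem_sdiff, mem_insert, not_or] at ha
        rw [mem_sdiff, mem_insert] at he
        rcases he.1 with rfl | he'
        · have := hmin a (hS a ha.1) ⟨ha.1, ha.2.2⟩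
          linarith
        · exact h5 a (mem_sdiff.2 ⟨ha.1, ha.2.2⟩) e (mem_sdiff.2 ⟨he', he.2⟩)
    · exact ⟨h1, h2, h3, by omega, h5⟩

end fill

/-- If `F` consists of `N` and the elements of `S₂ \ N` of the largest value, then the values of
the other elements of `S₂` are below the average. -/
theorem sum_rest_le {S₂ N F : Finset ℕ} {v : ℕ → ℝ} (hNF : N ⊆ F) (hF : F ⊆ S₂)
    (hv : ∀ i ∈ S₂, 0 ≤ v i) (hmax : ∀ a ∈ S₂ \ F, ∀ b ∈ F \ N, v a ≤ v b) :
    ((S₂.card : ℝ) - N.card) * ∑ a ∈ S₂ \ F, v a ≤ ((S₂.card : ℝ) - F.card) * ∑ a ∈ S₂, v a := by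
  -- The comparison is summed over all pairs of an omitted and an added element.
  have h1 : ∑ b ∈ F \ N, ∑ a ∈ S₂ \ F, v a ≤ ∑ b ∈ F \ N, ∑ a ∈ S₂ \ F, v b :=
    sum_le_sum fun b hb => sum_le_sum fun a ha => hmax a ha b hb
  simp only [sum_const, nsmul_eq_mul, ← mul_sum] at h1
  have c1 : ((F \ N).card : ℝ) + N.card = F.card := by
    exact_mod_cast card_sdiff_add_card_eq_card hNF
  have c2 : ((S₂ \ F).card : ℝ) + F.card = S₂.card := by
    exact_mod_cast card_sdiff_add_card_eq_card hF
  have s1 : ∑ b ∈ F \ N, v b ≤ ∑ b ∈ F, v b :=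
    sum_le_sum_of_subset_of_nonneg sdiff_subset fun i hi _ => hv i (hF hi)
  have s2 := sum_sdiff (f := v) hF
  have h2 := mul_le_mul_of_nonneg_left s1 (Nat.cast_nonneg (α := ℝ) (S₂ \ F).card)
  have e1 : (S₂.card : ℝ) - N.card = (S₂ \ F).card + (F \ N).card := by linarith
  have e2 : (S₂.card : ℝ) - F.card = (S₂ \ F).card := by linarith
  rw [e1, e2, ← s2]
  linarith

/-- The cost of merging the clusterings `S₁` and `S₂` into a subset `F` of `S₂`. -/
theorem merge_cost_le {s : ℕ} {D : ℕ → ℕ → ℝ} {U : ℕ → ℝ} {S₁ S₂ F : Finset ℕ} {n₁ n₂ : ℕ → ℕ}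
    {h : ℕ → ℝ} (hD : MetricOn s D) (hU : ∀ i < s, 0 ≤ U i)
    (hS₁ : ∀ i ∈ S₁, i < s) (hS₂ : ∀ i ∈ S₂, i < s)
    (h₁ : ∀ i < s, n₁ i ∈ S₁) (h₂ : ∀ i < s, n₂ i ∈ S₂ ∧ ∀ j ∈ S₂, D i (n₂ i) ≤ D i j)
    (hF : S₁.image n₂ ⊆ F) (hh : ∀ i < s, 0 ≤ h i ∧ ∀ z ∈ F, h i ≤ D i z) :
    ∑ i ∈ range s, U i * h i ^ 2 ≤ ∑ i ∈ range s, U i * D i (n₂ i) ^ 2 +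
      8 * ∑ a ∈ S₂ \ F, ∑ i ∈ range s with n₂ i = a,
        U i * (D i (n₁ i) ^ 2 + D i (n₂ i) ^ 2) := by
  have key : ∀ i ∈ range s, U i * h i ^ 2 ≤ U i * D i (n₂ i) ^ 2 +
      8 * (if n₂ i ∈ S₂ \ F then U i * (D i (n₁ i) ^ 2 + D i (n₂ i) ^ 2) else 0) := by
    intro i hi
    have his := mem_range.1 hi
    obtain ⟨hn2, hmin⟩ := h₂ i his
    have hn1 := h₁ i his
    have h0 := (hh i his).1
    by_cases hc : n₂ i ∈ F
    · rw [if_neg fun h => (mem_sdiff.1 h).2 hc]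
      have := pow_le_pow_left₀ h0 ((hh i his).2 _ hc) 2
      nlinarith [mul_le_mul_of_nonneg_left this (hU i his)]
    · rw [if_pos (mem_sdiff.2 ⟨hn2, hc⟩)]
      -- A point whose center in `S₂` was dropped travels to its center in `S₁` and on to the point
      -- of `S₂` nearest to that one, which was kept.
      have hs1 := hS₁ _ hn1
      have hs2 := hS₂ _ hn2
      obtain ⟨hn3, hmin3⟩ := h₂ (n₁ i) hs1
      have h3 := (hh i his).2 (n₂ (n₁ i)) (hF (mem_image_of_mem _ hn1))
      have h4 := hD.tri i his (n₁ i) hs1 (n₂ (n₁ i)) (hS₂ _ hn3)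
      have h5 := hmin3 (n₂ i) hn2
      have h6 := hD.tri (n₁ i) hs1 i his (n₂ i) hs2
      rw [hD.symm (n₁ i) hs1 i his] at h6
      have h7 : h i ≤ 2 * D i (n₁ i) + D i (n₂ i) := by linarith
      have h8 := pow_le_pow_left₀ h0 h7 2
      have h9 : h i ^ 2 ≤ D i (n₂ i) ^ 2 + 8 * (D i (n₁ i) ^ 2 + D i (n₂ i) ^ 2) := by
        nlinarith [sq_nonneg (2 * D i (n₁ i) - D i (n₂ i)), sq_nonneg (D i (n₂ i))]
      nlinarith [mul_le_mul_of_nonneg_left h9 (hU i his)]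
  refine (sum_le_sum key).trans ?_
  rw [sum_add_distrib, ← mul_sum, ← sum_filter]
  gcongr
  rw [← sum_fiberwise_of_maps_to (s := (range s).filter fun i => n₂ i ∈ S₂ \ F) (t := S₂ \ F)
    (g := n₂) fun i hi => (mem_filter.1 hi).2]
  refine le_of_eq (sum_congr rfl fun a ha => sum_congr ?_ fun _ _ => rfl)
  ext i
  simp only [mem_filter]
  constructor
  · rintro ⟨⟨h, -⟩, h'⟩; exact ⟨h, h'⟩
  · rintro ⟨h, rfl⟩; exact ⟨⟨h, ha⟩, rfl⟩

/-- The approximation ratio of the clustering of a small number of points. -/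
theorem clustering_cost_le {s k : ℕ} {D : ℕ → ℕ → ℝ} {U R₁ R₂ : ℕ → ℝ} {r₀ f : ℝ}
    {Z₁ Z₂ T F : Finset ℕ} {g₁ g₂ n₁ n₂ τ : ℕ → ℕ} {h : ℕ → ℝ}
    (hD : MetricOn s D) (hU : ∀ i < s, 0 ≤ U i) (hr : 0 < r₀)
    (hsep : ∀ i < s, ∀ j < s, i ≠ j → 64 * r₀ ≤ D i j) (hf : 0 ≤ f)
    (hR₁ : ValidRadii s D U r₀ f R₁) (hZ₁ : IsNet s D R₁ Z₁) (hg₁ : IsRefinement s D U R₁ Z₁ g₁)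
    (hR₂ : ValidRadii s D U r₀ f R₂) (hZ₂ : IsNet s D R₂ Z₂) (hg₂ : IsRefinement s D U R₂ Z₂ g₂)
    (hk₁ : Z₁.card ≤ k) (hk₂ : k < Z₂.card)
    (hn₁ : ∀ i < s, n₁ i ∈ Z₁.image g₁ ∧ ∀ j ∈ Z₁.image g₁, D i (n₁ i) ≤ D i j)
    (hn₂ : ∀ i < s, n₂ i ∈ Z₂.image g₂ ∧ ∀ j ∈ Z₂.image g₂, D i (n₂ i) ≤ D i j)
    (hNF : (Z₁.image g₁).image n₂ ⊆ F) (hF : F ⊆ Z₂.image g₂) (hFk : F.card = k)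
    (hmax : ∀ a ∈ Z₂.image g₂ \ F, ∀ b ∈ F \ (Z₁.image g₁).image n₂,
      ∑ i ∈ range s with n₂ i = a, U i * (D i (n₁ i) ^ 2 + D i (n₂ i) ^ 2) ≤
      ∑ i ∈ range s with n₂ i = b, U i * (D i (n₁ i) ^ 2 + D i (n₂ i) ^ 2))
    (hh : ∀ i < s, 0 ≤ h i ∧ ∀ z ∈ F, h i ≤ D i z)
    (hT : ∀ t ∈ T, t < s) (hTk : T.card ≤ k)
    (hτ : ∀ i < s, τ i ∈ T ∧ ∀ t ∈ T, D i (τ i) ≤ D i t) :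
    ∑ i ∈ range s, U i * h i ^ 2 ≤ 399675 * ∑ i ∈ range s, U i * D i (τ i) ^ 2 := by
  have hR₂' : ∀ i < s, 0 ≤ R₂ i := fun i hi => hr.le.trans (hR₂.ge i hi)
  have hS₁ : ∀ i ∈ Z₁.image g₁, i < s := by
    intro i hi
    obtain ⟨z, hz, rfl⟩ := mem_image.1 hi
    exact hg₁.lt z hz
  have hS₂ : ∀ i ∈ Z₂.image g₂, i < s := by
    intro i hi
    obtain ⟨z, hz, rfl⟩ := mem_image.1 hi
    exact hg₂.lt z hz
  have hc₂ : (Z₂.image g₂).card = Z₂.card := card_image_of_injOn (injOn_refinement hD hR₂' hZ₂ hg₂)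
  have hc₁ : ((Z₁.image g₁).image n₂).card ≤ Z₁.card := card_image_le.trans card_image_le
  have b₁ := net_cost_le hD hU hr hsep hR₁ hZ₁ hg₁ hf (h := fun i => D i (n₁ i))
    (fun i hi => ⟨hD.nonneg i hi _ (hS₁ _ (hn₁ i hi).1),
      fun z hz => (hn₁ i hi).2 _ (mem_image_of_mem _ hz)⟩) hT hτ
  have b₂ := net_cost_le hD hU hr hsep hR₂ hZ₂ hg₂ hf (h := fun i => D i (n₂ i))
    (fun i hi => ⟨hD.nonneg i hi _ (hS₂ _ (hn₂ i hi).1),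
      fun z hz => (hn₂ i hi).2 _ (mem_image_of_mem _ hz)⟩) hT hτ
  have hm := merge_cost_le hD hU hS₁ hS₂ (fun i hi => (hn₁ i hi).1) hn₂ hNF hh
  have hrest := sum_rest_le hNF hF (v := fun a => ∑ i ∈ range s with n₂ i = a,
    U i * (D i (n₁ i) ^ 2 + D i (n₂ i) ^ 2)) (fun a _ => sum_nonneg fun i hi =>
      mul_nonneg (hU i (mem_range.1 (mem_filter.1 hi).1)) (by positivity)) hmax
  rw [sum_fiberwise_of_maps_to fun i hi => (hn₂ i (mem_range.1 hi)).1, hc₂, hFk] at hrest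
  simp only [mul_add, sum_add_distrib] at hrest hm
  simp only [← sum_add_distrib, ← mul_add] at hm hrest
  rw [show ∑ i ∈ range s, U i * (D i (n₁ i) ^ 2 + D i (n₂ i) ^ 2) =
    ∑ i ∈ range s, U i * D i (n₁ i) ^ 2 + ∑ i ∈ range s, U i * D i (n₂ i) ^ 2 by
      rw [← sum_add_distrib]; exact sum_congr rfl fun i _ => by ring] at hrest
  set c₁ := ∑ i ∈ range s, U i * D i (n₁ i) ^ 2
  set c₂ := ∑ i ∈ range s, U i * D i (n₂ i) ^ 2
  set E := ∑ a ∈ Z₂.image g₂ \ F, ∑ i ∈ range s with n₂ i = a,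
    U i * (D i (n₁ i) ^ 2 + D i (n₂ i) ^ 2)
  set O := ∑ i ∈ range s, U i * D i (τ i) ^ 2 with hO
  have hO0 : 0 ≤ O := sum_nonneg fun i hi => mul_nonneg (hU i (mem_range.1 hi)) (sq_nonneg _)
  have hc0 : 0 ≤ c₂ := sum_nonneg fun i hi => mul_nonneg (hU i (mem_range.1 hi)) (sq_nonneg _)
  have hE0 : 0 ≤ E := sum_nonneg fun a _ => sum_nonneg fun i hi =>
      mul_nonneg (hU i (mem_range.1 (mem_filter.1 hi).1)) (by positivity)
  have r₁ : (Z₁.card : ℝ) ≤ k := by exact_mod_cast hk₁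
  have r₂ : (k : ℝ) + 1 ≤ Z₂.card := by exact_mod_cast hk₂
  have rT : (T.card : ℝ) ≤ k := by exact_mod_cast hTk
  have rN : (((Z₁.image g₁).image n₂).card : ℝ) ≤ Z₁.card := by exact_mod_cast hc₁
  -- `a` is the excess of the large clustering and `b` the room left in the small one.
  obtain ⟨a, ha⟩ : ∃ a : ℝ, a = Z₂.card - k := ⟨_, rfl⟩
  obtain ⟨b, hb⟩ : ∃ b : ℝ, b = k - Z₁.card := ⟨_, rfl⟩
  have ha0 : 1 ≤ a := by linarith
  have hb0 : 0 ≤ b := by linarith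
  have e₁ : c₁ ≤ 15987 * O + 10658 * f * b := by
    have := mul_le_mul_of_nonneg_left rT hf
    rw [hb]
    nlinarith
  have e₂ : c₂ + 10658 * f * a ≤ 15987 * O := by
    have := mul_le_mul_of_nonneg_left rT hf
    rw [ha]
    nlinarith
  have e₃ : (a + b) * E ≤ a * (c₁ + c₂) := by
    refine le_trans (mul_le_mul_of_nonneg_right ?_ hE0) (hrest.trans (le_of_eq ?_))
    · linarith
    · rw [ha]
  -- The small clustering may exceed its share of the optimum by a multiple of `f * b`. Weighted
  -- with `a` this is `b` times a multiple of `f * a`, which `e₂` bounds by the optimum, so `f`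
  -- disappears. The final constant is `15987 + 8 * 47961`.
  have e₄ : (a + b) * E ≤ (a + b) * (47961 * O) := by
    have h1 : a * (c₁ + c₂) ≤ a * (31974 * O + 10658 * f * b) :=
      mul_le_mul_of_nonneg_left (by nlinarith [mul_nonneg hf (by linarith : (0:ℝ) ≤ a)]) (by linarith)
    have h2 : b * (10658 * f * a) ≤ b * (15987 * O) :=
      mul_le_mul_of_nonneg_left (by linarith) hb0
    nlinarith [mul_nonneg hb0 hO0, mul_nonneg (by linarith : (0:ℝ) ≤ a) hO0]
  have e₅ : E ≤ 47961 * O := le_of_mul_le_mul_left e₄ (by linarith)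
  have e₆ : c₂ ≤ 15987 * O := by
    nlinarith [mul_nonneg hf (by linarith : (0:ℝ) ≤ a)]
  linarith

open Classical in
theorem argminUpTo_congr {s : ℕ} {p p' : ℕ → Prop} {g g' : ℕ → ℝ}
    (hp : ∀ i < s, p i ↔ p' i) (hg : ∀ i < s, g i = g' i) {i : ℕ} (hi : i ≤ s) :
    argminUpTo s p g i = argminUpTo s p' g' i := by
  induction i with
  | zero => rfl
  | succ i ih =>
    rw [argminUpTo, argminUpTo, ih (by omega)]
    have h : (argminUpTo s p' g' i < s ∧ g (argminUpTo s p' g' i) ≤ g i) ↔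
        (argminUpTo s p' g' i < s ∧ g' (argminUpTo s p' g' i) ≤ g' i) :=
      and_congr_right fun h => by rw [hg _ h, hg i hi]
    exact ite_congr (propext (and_congr (hp i hi) (not_congr h))) (fun _ => rfl) fun _ => rfl

/-- The array of radii in memory agrees with `levelRadius` only at indices of points. -/
theorem greedyNet_congr {s : ℕ} {D : ℕ → ℕ → ℝ} {R R' : ℕ → ℝ} (h : ∀ i < s, R i = R' i) (j : ℕ) :
    greedyNet s D R j = greedyNet s D R' j := by
  induction j with
  | zero => rfl
  | succ j ih =>
    have : argmin s (Uncovered D R (greedyNet s D R' j)) R =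
        argmin s (Uncovered D R' (greedyNet s D R' j)) R' :=
      argminUpTo_congr (fun i hi => by simp only [Uncovered, h i hi]) h le_rfl
    simp only [greedyNet, ih, this]

theorem ValidRadii.congr {s : ℕ} {D : ℕ → ℕ → ℝ} {U R R' : ℕ → ℝ} {r f : ℝ}
    (hR : ValidRadii s D U r f R) (h : ∀ i < s, R' i = R i) : ValidRadii s D U r f R' :=
  ⟨fun i hi => h i hi ▸ hR.ge i hi, fun i hi => h i hi ▸ hR.le_value i hi,
    fun i hi => h i hi ▸ hR.value_le i hi⟩

end KMeans

namespace RealRAM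

open KMeans

attribute [local simp] NExpr.eval RExpr.eval BExpr.holds Function.update_apply
attribute [local simp] NExpr.wt RExpr.wt BExpr.wt NExpr.len

variable {I : Input} {B s : ℕ} {σ : State}

/-! ## Program blocks

Scalar variables are the cells `0` of arrays. The integer arrays are:
`0` number of points; `1` points; `2` chunk factor; `4` start of the chunk; `5` end of the output;
`6` size of the chunk; `7` points of the chunk; `8` selected centers; `10`, `11`, `12`, `17`, `23`
loop variables; `13` location of a minimum; `14`, `15` search interval; `16` number of doublings;
`18` number of levels; `20` covered points; `21` net; `22` counter; `24` owners; `26`, `27` refined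
nets; `28` nearest centers. The real arrays are: `0` weights of the chunk; `1` weights; `2` smallest
radius; `3` largest distance; `4` radii; `5` values of balls; `6` current minimum; `7` accumulator;
`8` local costs; `9` distances to the first refined net; `10` values of centers; `11` new weights. -/

/-- The distance of two points of the chunk. -/
abbrev RExpr.dst (x y : NExpr) : RExpr := .dist (.get 7 x) (.get 7 y)

/-- The distances of the points of the chunk. -/
def dst (I : Input) (σ : State) (i j : ℕ) : ℝ := I.dist (σ.nat 7 i) (σ.nat 7 j)

/-- Locate the minimum of `x` under the condition `b`, where both depend on the scalar `12`. -/
def argminCmd (b : BExpr) (x : RExpr) : Cmd :=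
  .seq (.setNat 13 (.const 0) (.var 6))
    (.for 12 6
      (.ite (.and b (.not (.and (.not (.leNat (.var 6) (.var 13))) (.leReal (.get 6 (.const 0)) x))))
        (.seq (.setNat 13 (.const 0) (.var 12)) (.setReal 6 (.const 0) x)) .skip))

theorem natW_argminCmd (b : BExpr) (x : RExpr) : (argminCmd b x).natW = [13, 12, 13, 12] := rfl

theorem realW_argminCmd (b : BExpr) (x : RExpr) : (argminCmd b x).realW = [6] := rfl

/-- The test and the expression must have the right meaning in every memory the loop can reach, that
is, up to its own scratch cells. As long as the cell `13` holds `s`, nothing has been found and the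
stored minimum is meaningless, which is why the test of the loop checks this before the comparison.
-/
theorem runs_argminCmd {b : BExpr} {x : RExpr} (p : ℕ → Prop) (g : ℕ → ℝ)
    (hw : b.wt + x.wt ≤ 900) (hs : σ.nat 6 0 = s)
    (h : ∀ τ : State, (∀ a, a ≠ 12 → a ≠ 13 → τ.nat a = σ.nat a) →
      (∀ a, a ≠ 6 → τ.real a = σ.real a) → τ.nat 12 0 < s →
      (b.holds I τ ↔ p (τ.nat 12 0)) ∧ x.eval I τ = g (τ.nat 12 0)) :
    Runs I B (argminCmd b x) σ (s * 5 + 3) fun τ => τ.nat 13 0 = argmin s p g := by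
  refine Runs.good fun hσ => ?_
  have hsB : s ≤ B := hs ▸ hσ.2.2 6 0
  refine Runs.time (Runs.setNat_seq (T := s * (3 + 2) + 2) (by decide) (by simpa [hs]) ?_) (by omega)
  refine Runs.post (Runs.for (s := s) (T := 3) (Inv := fun i τ => τ.nat 13 0 = argminUpTo s p g i ∧
    (τ.nat 13 0 < s → τ.real 6 0 = g (τ.nat 13 0)))
    (by simpa using hs) (by simp [Cmd.natW]) (by simp [hs, argminUpTo]) ?_) fun τ _ _ h => h.1
  rintro i τ hi hτ hA hiv ⟨hbest, hval⟩
  have h6 : τ.nat 6 0 = s := by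
    rw [hA.nat 6 (by simp [Cmd.for, Cmd.natW])]
    simpa using hs
  obtain ⟨hb, hx⟩ := h τ (fun a h1 h2 => by
      rw [hA.nat a (by simp [Cmd.for, Cmd.natW, h1, h2]), setNat_nat_ne _ _ _ h2])
    (fun a h1 => by
      rw [hA.real a (by simp [Cmd.for, Cmd.realW, h1])]; rfl) (hiv ▸ hi)
  rw [hiv] at hb hx
  have hcond : (BExpr.and b (.not (.and (.not (.leNat (.var 6) (.var 13)))
      (.leReal (.get 6 (.const 0)) x)))).holds I τ ↔
      p i ∧ ¬ (argminUpTo s p g i < s ∧ g (argminUpTo s p g i) ≤ g i) := by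
    simp only [BExpr.holds, NExpr.eval, RExpr.eval, h6, hb, hx, not_le]
    refine and_congr_right fun _ => not_congr ?_
    rw [← hbest]
    exact and_congr_right fun hlt => by rw [hval hlt]
  refine Runs.ite (T := 2) ?_ (fun hc => ?_) fun hc => ?_
  · simp only [BExpr.wt, RExpr.wt, NExpr.wt]
    omega
  · have hc' := hcond.1 hc
    refine Runs.setNat_seq (by decide) (by simp [hiv]; omega) ?_
    refine Runs.setReal (by simp only [NExpr.wt]; omega) ?_
    have hx' := (h (τ.setNat 13 0 i) (fun a h1 h2 => by
      rw [setNat_nat_ne _ _ _ h2, hA.nat a (by simp [Cmd.for, Cmd.natW, h1, h2]),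
        setNat_nat_ne _ _ _ h2])
      (fun a h1 => by
        rw [setNat_real, hA.real a (by simp [Cmd.for, Cmd.realW, h1])]; rfl)
      (by simpa [hiv] using hi)).2
    simp [hiv] at hx' ⊢
    rw [argminUpTo, if_pos hc']
    exact ⟨rfl, fun _ => hx'⟩
  · refine Runs.time (Runs.skip ?_) (by omega)
    have hc' := mt hcond.2 hc
    simp
    rw [argminUpTo, if_neg hc']
    exact ⟨hbest, hval⟩

/-- Compute the value of the ball with the index `13`. -/
def valueCmd : Cmd :=
  .seq (.setReal 7 (.const 0) (.ofNat (.const 0)))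
    (.seq (.for 11 6 (.ite (.leReal (.dst (.var 13) (.var 11)) (.get 4 (.var 13)))
        (.setReal 7 (.const 0) (.add (.get 7 (.const 0)) (.get 0 (.var 11)))) .skip))
      (.setReal 5 (.var 13)
        (.mul (.mul (.get 7 (.const 0)) (.get 4 (.var 13))) (.get 4 (.var 13)))))

theorem runs_valueCmd (hs : σ.nat 6 0 = s) :
    Runs I B valueCmd σ (s * 4 + 4) fun τ => τ.real 5 = Function.update (σ.real 5) (σ.nat 13 0)
      (ballValue s (dst I σ) (σ.real 0) (σ.nat 13 0) (σ.real 4 (σ.nat 13 0))) := by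
  refine Runs.time (Runs.setReal_seq (T := (s * (2 + 2) + 2) + 1) (by decide) ?_) (by omega)
  refine Runs.seq (Runs.for (s := s) (Inv := fun i τ => τ.real 7 0 = ∑ j ∈ Finset.range i,
    if dst I σ (σ.nat 13 0) j ≤ σ.real 4 (σ.nat 13 0) then σ.real 0 j else 0)
    (by simpa using hs) (by simp [Cmd.natW]) (by simp) ?_) fun τ hτ hA hI => ?_
  · intro i τ hi hτ hA hiv hI
    have e7 := hA.nat 7 (by decide)
    have e13 := hA.nat 13 (by decide)
    have r4 := hA.real 4 (by decide)
    have r0 := hA.real 0 (by decide)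
    simp at e7 e13 r4 r0
    refine Runs.ite (T := 1) (by decide) (fun hc => Runs.setReal (by decide) ?_)
      fun hc => Runs.skip ?_
    · simp [e7, e13, r4, hiv] at hc
      simp [Finset.sum_range_succ, hI, r0, hiv, dst, hc]
    · simp [e7, e13, r4, hiv] at hc
      simp [Finset.sum_range_succ, hI, dst, not_le.2 hc]
  · have e13 := hA.nat 13 (by decide)
    have r4 := hA.real 4 (by decide)
    have r5 := hA.real 5 (by decide)
    simp at e13 r4 r5
    refine Runs.setReal (by decide) ?_
    simp [hI, e13, r4, r5, ballValue]

end RealRAM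

namespace RealRAM

open KMeans

attribute [local simp] NExpr.eval RExpr.eval BExpr.holds Function.update_apply
attribute [local simp] NExpr.wt RExpr.wt BExpr.wt NExpr.len

variable {I : Input} {B s : ℕ} {σ : State}

/-- Double radii as often as the scalar `16` says, starting from the smallest radius. -/
def radiiCmd : Cmd :=
  .seq
    (.for 10 6 (.seq (.setNat 13 (.const 0) (.var 10))
      (.seq (.setReal 4 (.var 10) (.get 2 (.const 0))) valueCmd)))
    (.for 17 16 (.seq
      (argminCmd (.not (.leReal (.get 3 (.const 0)) (.get 4 (.var 12)))) (.get 5 (.var 12)))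
      (.seq (.setReal 4 (.var 13) (.add (.get 4 (.var 13)) (.get 4 (.var 13)))) valueCmd)))

theorem dst_eq {τ : State} (h : τ.nat 7 = σ.nat 7) : dst I τ = dst I σ := by
  unfold dst
  rw [h]

/-- The values of all balls are kept in an array. A doubling changes only one of them, so it takes
linear time. If all balls are saturated, the cell `s` is doubled, which does no harm. -/
theorem runs_radiiCmd (hs : σ.nat 6 0 = s) :
    Runs I B radiiCmd σ ((s + σ.nat 16 0) * (9 * s + 12) + 4) fun τ => ∀ i < s, τ.real 4 i =
      levelRadius s (dst I σ) (σ.real 0) (σ.real 2 0) (σ.real 3 0) (σ.nat 16 0) i := by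
  set M := σ.nat 16 0 with hM
  set U := σ.real 0 with hU
  set r := σ.real 2 0 with hr
  set dm := σ.real 3 0 with hdm
  refine Runs.good fun hσ => ?_
  have hsB : s ≤ B := hs ▸ hσ.2.2 6 0
  refine Runs.time (T₁ := (s * ((s * 4 + 6) + 2) + 2) + (M * ((s * 5 + 3 + (s * 4 + 5)) + 2) + 2))
    ?_ (by nlinarith)
  refine Runs.seq (Runs.for (s := s) (Inv := fun i τ => ∀ j < i, τ.real 4 j = r ∧
    τ.real 5 j = ballValue s (dst I σ) U j r) hs (by decide) (by simp) ?_) fun τ hτ hA hI => ?_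
  · intro i τ hi hτ hA hiv hI
    have e6 := hA.nat 6 (by decide)
    have e7 := hA.nat 7 (by decide)
    have r0 := hA.real 0 (by decide)
    have r2 := hA.real 2 (by decide)
    refine Runs.setNat_seq (by decide) (by simp [hiv]; omega) ?_
    refine Runs.setReal_seq (by decide) ?_
    refine Runs.post (runs_valueCmd (s := s) (by simp [e6, hs])) fun ρ _ hA' hρ => ?_
    have r4 := hA'.real 4 (by decide)
    simp [hiv] at hρ r4
    intro j hj
    rw [setNat_real, hρ, r4]
    simp only [Function.update_apply, r0, r2]
    rcases Nat.lt_succ_iff_lt_or_eq.1 hj with hj' | rfl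
    · have := hI j hj'
      simp only [hj'.ne, if_false]
      exact this
    · simp only [if_true]
      exact ⟨hr.symm, by rw [dst_eq]; simp [e7]⟩
  · have e6 := hA.nat 6 (by decide)
    have e7 := hA.nat 7 (by decide)
    have e16 := hA.nat 16 (by decide)
    have r0 := hA.real 0 (by decide)
    have r2 := hA.real 2 (by decide)
    have r3 := hA.real 3 (by decide)
    refine Runs.post (Runs.for (s := M) (T := s * 5 + 3 + (s * 4 + 5)) (Inv := fun m τ => ∀ i < s,
      τ.real 4 i = levelRadius s (dst I σ) U r dm m i ∧
      τ.real 5 i = ballValue s (dst I σ) U i (levelRadius s (dst I σ) U r dm m i))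
      (by rw [e16]) (by decide) ?_ ?_) fun ρ _ _ h i hi => (h i hi).1
    · intro i hi
      simpa [levelRadius, level] using hI i hi
    · intro m τ' hm hτ' hA' hiv hI'
      have e6' := hA'.nat 6 (by decide)
      have e7' := hA'.nat 7 (by decide)
      have r0' := hA'.real 0 (by decide)
      have r3' := hA'.real 3 (by decide)
      rw [e6] at e6'
      rw [e7] at e7'
      rw [r0] at r0'
      rw [r3] at r3'
      refine Runs.seq (runs_argminCmd (s := s)
        (fun i => ¬ dm ≤ r * 2 ^ level s (dst I σ) U r dm m i)
        (fun i => ballValue s (dst I σ) U i (r * 2 ^ level s (dst I σ) U r dm m i))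
        (by decide) (by rw [e6', hs]) ?_) fun ρ hρ hAρ hb => ?_
      · intro ρ hn hr hlt
        obtain ⟨h4, h5⟩ := hI' _ hlt
        simp only [BExpr.holds, RExpr.eval, NExpr.eval, hr 3 (by decide), hr 4 (by decide),
          hr 5 (by decide), r3', h4, h5]
        exact ⟨Iff.rfl, rfl⟩
      · have e6'' := hAρ.nat 6 (by simp [natW_argminCmd])
        have e7'' := hAρ.nat 7 (by simp [natW_argminCmd])
        have r0'' := hAρ.real 0 (by simp [realW_argminCmd])
        have r4'' := hAρ.real 4 (by simp [realW_argminCmd])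
        have r5'' := hAρ.real 5 (by simp [realW_argminCmd])
        refine Runs.setReal_seq (by decide) ?_
        refine Runs.post (runs_valueCmd (s := s) (by simp [e6'', e6', hs])) fun κ _ hA' hκ => ?_
        have r4 := hA'.real 4 (by decide)
        change ρ.nat 13 0 = nextBall s (dst I σ) U r dm (level s (dst I σ) U r dm m) at hb
        rw [dst_eq (σ := σ) (by simp [e7'', e7'])] at hκ
        simp [hb, r0'', r0', r5'', r4''] at hκ r4
        intro i hi
        simp only [setNat_real, hκ, r4, levelRadius_succ, Function.update_apply]
        split_ifs with hib
        · subst hib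
          rw [(hI' _ hi).1]
          exact ⟨by ring, by rw [two_mul]⟩
        · exact hI' i hi

/-! ### Programs for nets and their refinement -/

/-- The indicator function of a set of indices. -/
noncomputable def ind (Z : Finset ℕ) (i : ℕ) : ℕ := if i ∈ Z then 1 else 0

theorem one_le_ind {Z : Finset ℕ} {i : ℕ} : 1 ≤ ind Z i ↔ i ∈ Z := by
  unfold ind
  split_ifs with h <;> simp [h]

theorem ind_insert {Z : Finset ℕ} {b i : ℕ} :
    ind (insert b Z) i = if i = b then 1 else ind Z i := by
  unfold ind
  by_cases h : i = b <;> simp [h]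

/-- Construct a net. -/
def greedyCmd : Cmd :=
  .seq (.for 10 6 (.seq (.setNat 20 (.var 10) (.const 0)) (.setNat 21 (.var 10) (.const 0))))
    (.seq (.setNat 22 (.const 0) (.const 0))
      (.for 23 6 (.seq (argminCmd (.leNat (.get 20 (.var 12)) (.const 0)) (.get 4 (.var 12)))
        (.ite (.not (.leNat (.var 6) (.var 13)))
          (.seq (.setNat 21 (.var 13) (.const 1))
            (.seq (.setNat 22 (.const 0) (.add (.var 22) (.const 1)))
              (.for 11 6
                (.ite (.leReal (.dst (.var 13) (.var 11))
                    (.mul (.ofNat (.const 32)) (.get 4 (.var 11))))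
                  (.setNat 20 (.var 11) (.const 1)) .skip))))
          .skip))))

theorem card_le_of_lt {Z : Finset ℕ} (h : ∀ z ∈ Z, z < s) : Z.card ≤ s := by
  have := Finset.card_le_card (fun z hz => Finset.mem_range.2 (h z hz) : Z ⊆ Finset.range s)
  simpa using this

theorem runs_greedyCmd (hs : σ.nat 6 0 = s) (hD : MetricOn s (dst I σ))
    (hR : ∀ i < s, 0 ≤ σ.real 4 i) :
    Runs I B greedyCmd σ (s * (9 * s + 14) + 6) fun τ =>
      (∀ i < s, τ.nat 21 i = ind (greedyNet s (dst I σ) (σ.real 4) s) i) ∧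
      τ.nat 22 0 = (greedyNet s (dst I σ) (σ.real 4) s).card := by
  set R := σ.real 4 with hRdef
  set N := greedyNet s (dst I σ) R with hN
  refine Runs.good fun hσ => ?_
  have hsB : s ≤ B := hs ▸ hσ.2.2 6 0
  refine Runs.time (T₁ := (s * (2 + 2) + 2) + ((s * ((s * 5 + 3 + (s * 4 + 5)) + 2) + 2) + 1))
    ?_ (by nlinarith)
  refine Runs.seq (Runs.for (s := s) (Inv := fun i τ => ∀ j < i, τ.nat 20 j = 0 ∧ τ.nat 21 j = 0)
    hs (by decide) (by simp) ?_) fun τ hτ hA hI => ?_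
  · intro i τ hi hτ hA hiv hI
    refine Runs.setNat_seq (by decide) (by simp) (Runs.setNat (by decide) (by simp) ?_)
    intro j hj
    simp [hiv]
    rcases Nat.lt_succ_iff_lt_or_eq.1 hj with hj' | rfl
    · simpa [hj'.ne] using hI j hj'
    · simp
  · have e6 := hA.nat 6 (by decide)
    have e7 := hA.nat 7 (by decide)
    have r4 := hA.real 4 (by decide)
    refine Runs.setNat_seq (by decide) (by simp) ?_
    refine Runs.post (Runs.for (s := s) (T := s * 5 + 3 + (s * 4 + 5)) (Inv := fun m τ =>
      (∀ i < s, (τ.nat 20 i ≤ 0 ↔ Uncovered (dst I σ) R (N m) i) ∧ τ.nat 21 i = ind (N m) i) ∧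
      τ.nat 22 0 = (N m).card)
      (by simp [e6, hs]) (by decide) ?_ ?_) fun ρ _ _ h => ⟨fun i hi => (h.1 i hi).2, h.2⟩
    · refine ⟨fun i hi => ?_, ?_⟩
      · simp [(hI i hi).1, (hI i hi).2, hN, greedyNet, Uncovered, ind]
      · simp [hN, greedyNet]
    · intro m τ' hm hτ' hA' hiv hI'
      have e6' := hA'.nat 6 (by decide)
      have e7' := hA'.nat 7 (by decide)
      have r4' := hA'.real 4 (by decide)
      simp [e6] at e6'
      simp [e7] at e7'
      simp [r4] at r4'
      refine Runs.seq (runs_argminCmd (s := s) (Uncovered (dst I σ) R (N m)) R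
        (by decide) (by rw [e6']; exact hs) ?_) fun ρ hρ hAρ hb => ?_
      · intro ρ hn hr hlt
        simp only [BExpr.holds, RExpr.eval, NExpr.eval, hr 4 (by decide),
          hn 20 (by decide) (by decide), r4', (hI'.1 _ hlt).1, true_and]
        rfl
      · have e6'' := hAρ.nat 6 (by simp [natW_argminCmd])
        have e7'' := hAρ.nat 7 (by simp [natW_argminCmd])
        have e20 := hAρ.nat 20 (by simp [natW_argminCmd])
        have e21 := hAρ.nat 21 (by simp [natW_argminCmd])
        have e22 := hAρ.nat 22 (by simp [natW_argminCmd])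
        have r4'' := hAρ.real 4 (by simp [realW_argminCmd])
        set b := argmin s (Uncovered (dst I σ) R (N m)) R with hbdef
        refine Runs.ite (by decide) (fun hc => ?_) fun hc => ?_
        · simp [e6'', e6', hs, hb] at hc
          have hNs : N (m + 1) = insert b (N m) := by
            rw [hN, greedyNet, if_pos hc]
          have hbu := (argmin_spec (g := R) (exists_of_argmin_lt hc)).2.1
          have hbN : b ∉ N m := not_uncovered_self hD hR hc hbu
          have hcard : (N (m + 1)).card = (N m).card + 1 := by
            rw [hNs, Finset.card_insert_of_notMem hbN]
          have hcs : (N (m + 1)).card ≤ s := card_le_of_lt (greedyNet_lt _)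
          refine Runs.setNat_seq (by decide) (by simp; omega) ?_
          refine Runs.setNat_seq (by decide) (by simp [e22, hI'.2]; omega) ?_
          -- The inner invariant interpolates between being uncovered by `N m` and being uncovered
          -- by `insert b (N m)`.
          refine Runs.post (Runs.for (s := s) (T := 2) (Inv := fun m' τ => ∀ i < s, τ.nat 20 i ≤ 0 ↔
            Uncovered (dst I σ) R (N m) i ∧ (i < m' → ¬ dst I σ b i ≤ 32 * R i))
            (by simp [e6'', e6', hs]) (by decide) ?_ ?_) fun κ _ hAκ h => ?_
          · intro i hi
            simpa [e20] using (hI'.1 i hi).1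
          · intro i κ hi hκ hAκ hiv hIκ
            have k7 := hAκ.nat 7 (by decide)
            have k13 : κ.nat 13 0 = b := by
              rw [hAκ.nat 13 (by decide)]
              simpa using hb
            have k4 := hAκ.real 4 (by decide)
            simp [e7'', e7'] at k7
            simp [r4'', r4'] at k4
            have hcond : (BExpr.leReal (.dst (.var 13) (.var 11))
                (.mul (.ofNat (.const 32)) (.get 4 (.var 11)))).holds I κ ↔
                dst I σ b i ≤ 32 * R i := by
              simp [k7, k13, k4, hiv, dst, hRdef]
            refine Runs.ite (T := 1) (by decide) (fun hc => Runs.setNat (by decide) (by simp; omega) ?_)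
              fun hc => Runs.skip ?_
            · rw [hcond] at hc
              intro j hj
              simp [hiv]
              by_cases hji : j = i
              · subst hji
                simpa using fun _ => hc
              · have := hIκ j hj
                simp [hji] at this ⊢
                rw [this]
                refine and_congr_right fun _ => imp_congr_left ⟨fun h => by omega, fun h => by omega⟩
            · rw [hcond] at hc
              intro j hj
              have := hIκ j hj
              simp at this ⊢
              rw [this]
              refine and_congr_right fun _ => ⟨fun h hlt => ?_, fun h hlt => h (by omega)⟩
              rcases Nat.lt_or_eq_of_le hlt with hj' | rfl
              · exact h hj'
              · exact not_le.1 hc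
          · have k21 := hAκ.nat 21 (by decide)
            have k22 := hAκ.nat 22 (by decide)
            simp [e21, hb] at k21
            simp [e22, hI'.2] at k22
            refine ⟨fun i hi => ⟨?_, ?_⟩, ?_⟩
            · have := h i hi
              rw [hNs]
              simp only [hi, true_imp_iff] at this
              rw [setNat_nat_ne _ _ _ (by decide), this]
              simp only [Uncovered, Finset.mem_insert, forall_eq_or_imp]
              exact and_comm
            · rw [hNs, ind_insert]
              simp [k21]
              rw [(hI'.1 i hi).2]
            · simp [k22, hcard]
        · refine Runs.time (Runs.skip ?_) (by omega)
          simp [e6'', e6', hs, hb] at hc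
          have hNs : N (m + 1) = N m := by
            rw [hN, greedyNet, if_neg (not_lt.2 hc)]
          rw [hNs]
          simpa [e20, e21, e22] using hI'

/-- Find the ball of the net around each point. -/
def ownerCmd : Cmd :=
  .for 10 6 (.seq (.setNat 24 (.var 10) (.var 6)) (.seq (.setNat 27 (.var 10) (.const 0))
    (.for 11 6 (.ite (.and (.leNat (.const 1) (.get 21 (.var 11)))
        (.leReal (.dst (.var 10) (.var 11)) (.mul (.ofNat (.const 4)) (.get 4 (.var 11)))))
      (.setNat 24 (.var 10) (.var 11)) .skip))))

/-- Because the balls of radius `4 * R z` are disjoint, one owner per point describes them all, and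
the local costs of all candidates take a single quadratic pass. -/
theorem owner_unique {D : ℕ → ℕ → ℝ} {R : ℕ → ℝ} {Z : Finset ℕ} (hD : MetricOn s D)
    (hR : ∀ i < s, 0 ≤ R i) (hZ : IsNet s D R Z) {i z z' : ℕ} (hi : i < s) (hz : z ∈ Z)
    (hz' : z' ∈ Z) (h : D i z ≤ 4 * R z) (h' : D i z' ≤ 4 * R z') : z = z' := by
  by_contra hne
  have hs := hZ.lt z hz
  have hs' := hZ.lt z' hz'
  have h1 := hZ.sep z hz z' hz' hne
  have h2 := hD.tri z hs i hi z' hs'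
  rw [hD.symm z hs i hi] at h2
  linarith [hR z hs, hR z' hs']

/-- The owner `s` stands for no owner, so the equivalence is restricted to `z < s`. -/
theorem runs_ownerCmd {Z : Finset ℕ} (hs : σ.nat 6 0 = s) (hD : MetricOn s (dst I σ))
    (hR : ∀ i < s, 0 ≤ σ.real 4 i) (hZ : IsNet s (dst I σ) (σ.real 4) Z)
    (hmk : ∀ i < s, σ.nat 21 i = ind Z i) :
    Runs I B ownerCmd σ (s * (4 * s + 6) + 2) fun τ => ∀ i < s, τ.nat 27 i = 0 ∧
      ∀ z < s, τ.nat 24 i = z ↔ z ∈ Z ∧ dst I σ i z ≤ 4 * σ.real 4 z := by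
  set R := σ.real 4 with hRdef
  refine Runs.good fun hσ => ?_
  have hsB : s ≤ B := hs ▸ hσ.2.2 6 0
  refine Runs.time (T₁ := s * ((s * 4 + 4) + 2) + 2) ?_ (by nlinarith)
  refine Runs.for (s := s) (Inv := fun m τ => ∀ i < m, τ.nat 27 i = 0 ∧
      ∀ z < s, τ.nat 24 i = z ↔ z ∈ Z ∧ dst I σ i z ≤ 4 * R z)
    hs (by decide) (by simp) ?_
  intro i τ hi hτ hA hiv hI
  have e6 := hA.nat 6 (by decide)
  have e7 := hA.nat 7 (by decide)
  have e21 := hA.nat 21 (by decide)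
  have r4 := hA.real 4 (by decide)
  refine Runs.setNat_seq (by decide) (by simp [e6, hs, hsB]) ?_
  refine Runs.setNat_seq (by decide) (by simp) ?_
  refine Runs.post (Runs.for (s := s) (T := 2) (Inv := fun m ρ =>
    (∀ j < i, ρ.nat 24 j = τ.nat 24 j) ∧
    ∀ z < s, ρ.nat 24 i = z ↔ z < m ∧ z ∈ Z ∧ dst I σ i z ≤ 4 * R z)
    (by simp [e6, hs]) (by decide) ?_ ?_) ?_
  · simp [hiv, e6, hs]
    exact ⟨fun j hj h => absurd h hj.ne, fun z hz h => absurd h hz.ne'⟩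
  · rintro m ρ hm hρ hAρ hmv ⟨hI1, hI2⟩
    have k7 := hAρ.nat 7 (by decide)
    have k10 := hAρ.nat 10 (by decide)
    have k21 := hAρ.nat 21 (by decide)
    have k4 := hAρ.real 4 (by decide)
    simp [e7] at k7
    simp at k10
    simp [e21] at k21
    simp [r4] at k4
    have hcond : (BExpr.and (.leNat (.const 1) (.get 21 (.var 11)))
        (.leReal (.dst (.var 10) (.var 11))
          (.mul (.ofNat (.const 4)) (.get 4 (.var 11))))).holds I ρ ↔
        m ∈ Z ∧ dst I σ i m ≤ 4 * R m := by
      simp only [BExpr.holds, NExpr.eval, RExpr.eval, k7, k10, k21, k4, hmv, hiv, dst, hmk m hm,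
        one_le_ind, hRdef, Nat.cast_ofNat]
    refine Runs.ite (T := 1) (by decide)
      (fun hc => Runs.setNat (by decide) (by simp [hmv]; omega) ?_) fun hc => Runs.skip ?_
    · rw [hcond] at hc
      simp [hmv, k10, hiv]
      refine ⟨fun j hj => by simpa [hj.ne] using hI1 j hj, fun z hz => ?_⟩
      constructor
      · rintro rfl
        exact ⟨le_rfl, hc⟩
      · rintro ⟨-, hzZ, hzd⟩
        exact owner_unique hD hR hZ hi hc.1 hzZ hc.2 hzd
    · rw [hcond] at hc
      refine ⟨by simpa using hI1, fun z hz => ?_⟩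
      rw [setNat_nat_ne _ _ _ (by decide), hI2 z hz]
      constructor
      · rintro ⟨h1, h2⟩
        exact ⟨by omega, h2⟩
      · rintro ⟨h1, h2⟩
        refine ⟨lt_of_le_of_ne (by omega) ?_, h2⟩
        rintro rfl
        exact hc h2
  · rintro ρ hρ hAρ ⟨hI1, hI2⟩ j hj
    have k27 := hAρ.nat 27 (by decide)
    simp [hiv] at k27
    rcases Nat.lt_succ_iff_lt_or_eq.1 hj with hj' | rfl
    · refine ⟨?_, fun z hz => ?_⟩
      · simpa [k27, hj'.ne] using (hI j hj').1
      · rw [setNat_nat_ne _ _ _ (by decide), hI1 j hj', (hI j hj').2 z hz]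
    · refine ⟨by simp [k27], fun z hz => ?_⟩
      rw [setNat_nat_ne _ _ _ (by decide), hI2 z hz]
      simp [hz]

/-- Compute the cost of each point as a center of the ball of the net around it. -/
def localCostCmd : Cmd :=
  .for 10 6 (.seq (.setReal 7 (.const 0) (.ofNat (.const 0)))
    (.seq (.for 11 6 (.ite (.and (.leNat (.get 24 (.var 11)) (.get 24 (.var 10)))
          (.leNat (.get 24 (.var 10)) (.get 24 (.var 11))))
        (.setReal 7 (.const 0) (.add (.get 7 (.const 0)) (.mul (.get 0 (.var 11))
          (.mul (.dst (.var 11) (.var 10)) (.dst (.var 11) (.var 10)))))) .skip))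
      (.setReal 8 (.var 10) (.get 7 (.const 0)))))

/-- Points without owner form a group as well; the refinement never looks at their costs. -/
theorem runs_localCostCmd (hs : σ.nat 6 0 = s) :
    Runs I B localCostCmd σ (s * (4 * s + 6) + 2) fun τ => ∀ i < s, τ.real 8 i =
      ∑ j ∈ Finset.range s, if σ.nat 24 j = σ.nat 24 i then σ.real 0 j * dst I σ j i ^ 2 else 0 := by
  refine Runs.time (T₁ := s * ((s * 4 + 2 + 1 + 1) + 2) + 2) ?_ (by nlinarith)
  refine Runs.for (s := s) (Inv := fun m τ => ∀ i < m, τ.real 8 i =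
      ∑ j ∈ Finset.range s, if σ.nat 24 j = σ.nat 24 i then σ.real 0 j * dst I σ j i ^ 2 else 0)
    hs (by decide) (by simp) ?_
  intro i τ hi hτ hA hiv hI
  have e6 := hA.nat 6 (by decide)
  have e7 := hA.nat 7 (by decide)
  have e24 := hA.nat 24 (by decide)
  have r0 := hA.real 0 (by decide)
  refine Runs.setReal_seq (by decide) ?_
  refine Runs.seq (T₂ := 1) (Runs.for (s := s) (T := 2) (Inv := fun m ρ => ρ.real 7 0 =
    ∑ j ∈ Finset.range m, if σ.nat 24 j = σ.nat 24 i then σ.real 0 j * dst I σ j i ^ 2 else 0)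
    (by simp [e6, hs]) (by decide) (by simp) ?_) ?_
  · intro m ρ hm hρ hAρ hmv hI'
    have k7 := hAρ.nat 7 (by decide)
    have k10 := hAρ.nat 10 (by decide)
    have k24 := hAρ.nat 24 (by decide)
    have k0 := hAρ.real 0 (by decide)
    simp [e7] at k7
    simp at k10
    simp [e24] at k24
    simp [r0] at k0
    have hcond : (BExpr.and (.leNat (.get 24 (.var 11)) (.get 24 (.var 10)))
          (.leNat (.get 24 (.var 10)) (.get 24 (.var 11)))).holds I ρ ↔
        σ.nat 24 m = σ.nat 24 i := by
      simp only [BExpr.holds, NExpr.eval, k10, k24, hmv, hiv]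
      exact le_antisymm_iff.symm
    refine Runs.ite (T := 1) (by decide) (fun hc => Runs.setReal (by decide) ?_)
      fun hc => Runs.skip ?_
    · rw [hcond] at hc
      simp [Finset.sum_range_succ, hc, hI', k7, k10, k0, hmv, hiv, dst, sq]
    · rw [hcond] at hc
      simp [Finset.sum_range_succ, hc, hI']
  · intro ρ hρ hAρ hI'
    have k10 := hAρ.nat 10 (by decide)
    have k8 := hAρ.real 8 (by decide)
    simp at k10 k8
    refine Runs.setReal (by decide) ?_
    intro j hj
    simp [k10, k8, hiv, hI']
    rcases Nat.lt_succ_iff_lt_or_eq.1 hj with hj' | rfl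
    · simpa [hj'.ne] using hI j hj'
    · simp

/-- Replace every center of the net by the best center for its ball. -/
def refineCmd : Cmd :=
  .seq ownerCmd (.seq localCostCmd
    (.for 10 6 (.ite (.leNat (.const 1) (.get 21 (.var 10)))
      (.seq (argminCmd (.and (.leNat (.get 24 (.var 12)) (.var 10))
          (.leNat (.var 10) (.get 24 (.var 12)))) (.get 8 (.var 12)))
        (.setNat 27 (.var 13) (.const 1)))
      .skip)))

theorem runs_refineCmd {Z : Finset ℕ} (hs : σ.nat 6 0 = s) (hD : MetricOn s (dst I σ))
    (hR : ∀ i < s, 0 ≤ σ.real 4 i) (hZ : IsNet s (dst I σ) (σ.real 4) Z)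
    (hmk : ∀ i < s, σ.nat 21 i = ind Z i) :
    Runs I B refineCmd σ (s * (13 * s + 20) + 6) fun τ =>
      ∃ g, IsRefinement s (dst I σ) (σ.real 0) (σ.real 4) Z g ∧
        ∀ i < s, τ.nat 27 i = ind (Z.image g) i := by
  set R := σ.real 4 with hRdef
  refine Runs.good fun hσ => ?_
  have hsB : s ≤ B := hs ▸ hσ.2.2 6 0
  refine Runs.time (T₁ := (s * (4 * s + 6) + 2) + ((s * (4 * s + 6) + 2) +
    (s * ((s * 5 + 3 + 1 + 1) + 2) + 2))) ?_ (by nlinarith)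
  refine Runs.seq (runs_ownerCmd hs hD hR hZ hmk) fun τ hτ hA hO => ?_
  have e6 := hA.nat 6 (by decide)
  have e7 := hA.nat 7 (by decide)
  have e21 := hA.nat 21 (by decide)
  have r0 := hA.real 0 (by decide)
  refine Runs.seq (runs_localCostCmd (s := s) (by rw [e6, hs])) fun ρ hρ hAρ hC => ?_
  have k6 := hAρ.nat 6 (by decide)
  have k21 := hAρ.nat 21 (by decide)
  have k24 := hAρ.nat 24 (by decide)
  have k27 := hAρ.nat 27 (by decide)
  rw [e6] at k6
  rw [e21] at k21
  simp only [dst_eq e7, r0] at hC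
  have hball : ∀ z ∈ Z, ∀ j < s, τ.nat 24 j = z ↔ dst I σ j z ≤ 4 * R z := by
    intro z hz j hj
    rw [(hO j hj).2 z (hZ.lt z hz)]
    simp [hz, hRdef]
  have hloc : ∀ z ∈ Z, ∀ j < s, dst I σ j z ≤ 4 * R z →
      ρ.real 8 j = localCost s (dst I σ) (σ.real 0) R z j := by
    intro z hz j hj hjz
    rw [hC j hj, (hball z hz j hj).2 hjz]
    unfold localCost
    refine Finset.sum_congr rfl fun i hi => ?_
    simp only [hball z hz i (Finset.mem_range.1 hi)]
  obtain ⟨g, hg⟩ : ∃ g : ℕ → ℕ, ∀ z, g z = argmin s (fun j => τ.nat 24 j = z) (ρ.real 8) :=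
    ⟨_, fun z => rfl⟩
  have hgs : ∀ z ∈ Z, g z < s ∧ τ.nat 24 (g z) = z ∧
      ∀ j < s, τ.nat 24 j = z → ρ.real 8 (g z) ≤ ρ.real 8 j := by
    intro z hz
    rw [hg]
    refine argmin_spec ⟨z, hZ.lt z hz, (hball z hz z (hZ.lt z hz)).2 ?_⟩
    rw [hD.self z (hZ.lt z hz)]
    linarith [hR z (hZ.lt z hz)]
  have href : IsRefinement s (dst I σ) (σ.real 0) R Z g := by
    refine ⟨fun z hz => (hgs z hz).1, fun z hz => (hball z hz _ (hgs z hz).1).1 (hgs z hz).2.1,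
      fun z hz y hy hyz => ?_⟩
    rw [← hloc z hz y hy hyz, ← hloc z hz _ (hgs z hz).1
      ((hball z hz _ (hgs z hz).1).1 (hgs z hz).2.1)]
    exact (hgs z hz).2.2 y hy ((hball z hz y hy).2 hyz)
  refine Runs.post (Runs.for (s := s) (T := s * 5 + 3 + 1 + 1) (Inv := fun m κ => ∀ i < s,
    κ.nat 27 i = ind ((Z.filter (· < m)).image g) i) (by rw [k6, hs]) (by decide) ?_ ?_)
    fun κ _ _ hκ => ⟨g, href, fun i hi => ?_⟩
  · intro i hi
    simp [k27, (hO i hi).1, ind]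
  · intro m κ hm hκ hAκ hmv hI
    have l6 := hAκ.nat 6 (by decide)
    have l21 := hAκ.nat 21 (by decide)
    have l24 := hAκ.nat 24 (by decide)
    have l8 := hAκ.real 8 (by decide)
    rw [k6] at l6
    rw [k21] at l21
    rw [k24] at l24
    refine Runs.ite (by decide) (fun hc => ?_) fun hc => Runs.time (Runs.skip ?_) (by omega)
    · simp only [BExpr.holds, NExpr.eval, hmv, l21, hmk m hm, one_le_ind] at hc
      refine Runs.seq (T₂ := 1) (runs_argminCmd (s := s) (fun j => τ.nat 24 j = m) (ρ.real 8)
        (by decide) (by rw [l6, hs]) ?_) fun κ' _ hA' hb => Runs.setNat (by decide) ?_ ?_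
      · intro κ' hn hr hlt
        simp only [BExpr.holds, RExpr.eval, NExpr.eval, hr 8 (by decide),
          hn 24 (by decide) (by decide), hn 10 (by decide) (by decide), l24, l8, hmv, and_true]
        exact le_antisymm_iff.symm
      · simp only [NExpr.eval]
        have := (hgs m hc).1
        omega
      · have m27 := hA'.nat 27 (by simp [natW_argminCmd])
        rw [← hg] at hb
        have : Z.filter (· < m + 1) = insert m (Z.filter (· < m)) := by
          ext z
          simp only [Finset.mem_filter, Finset.mem_insert]
          constructor
          · rintro ⟨h1, h2⟩
            rcases Nat.lt_succ_iff_lt_or_eq.1 h2 with h | h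
            exacts [Or.inr ⟨h1, h⟩, Or.inl h]
          · rintro (rfl | ⟨h1, h2⟩)
            exacts [⟨hc, by omega⟩, ⟨h1, by omega⟩]
        intro i hi
        rw [this, Finset.image_insert, ind_insert]
        simp [hb, m27, hI i hi]
    · simp only [BExpr.holds, NExpr.eval, hmv, l21, hmk m hm, one_le_ind] at hc
      have : Z.filter (· < m + 1) = Z.filter (· < m) := by
        ext z
        simp only [Finset.mem_filter]
        refine and_congr_right fun h1 => ⟨fun h2 => lt_of_le_of_ne (by omega) ?_, fun h => by omega⟩
        rintro rfl
        exact hc h1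
      rw [this]
      simpa using hI
  · rw [hκ i hi, Finset.filter_true_of_mem hZ.lt]

/-! ### Programs for merging two refined nets -/

/-- Find the nearest point of the set with the indicator function `mk`. -/
def nearCmd (mk : ℕ) : Cmd :=
  .for 10 6 (.seq (argminCmd (.leNat (.const 1) (.get mk (.var 12))) (.dst (.var 10) (.var 12)))
    (.setNat 28 (.var 10) (.var 13)))

/-- The element of `S` nearest to `i`. -/
noncomputable def nearest (s : ℕ) (D : ℕ → ℕ → ℝ) (S : Finset ℕ) (i : ℕ) : ℕ :=
  argmin s (fun j => j ∈ S) (D i)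

theorem nearest_spec {D : ℕ → ℕ → ℝ} {S : Finset ℕ} (hS : ∀ i ∈ S, i < s) (hne : S.Nonempty)
    (i : ℕ) : nearest s D S i ∈ S ∧ ∀ j ∈ S, D i (nearest s D S i) ≤ D i j := by
  obtain ⟨j, hj⟩ := hne
  obtain ⟨h1, h2, h3⟩ := argmin_spec (g := D i) (p := fun j => j ∈ S) ⟨j, hS j hj, hj⟩
  exact ⟨h2, fun j hj => h3 j (hS j hj) hj⟩

theorem runs_nearCmd {mk : ℕ} {S : Finset ℕ} (hmk : mk ∉ [10, 12, 13, 28]) (hs : σ.nat 6 0 = s)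
    (hS : ∀ i < s, σ.nat mk i = ind S i) :
    Runs I B (nearCmd mk) σ (s * (5 * s + 6) + 2) fun τ =>
      ∀ i < s, τ.nat 28 i = nearest s (dst I σ) S i := by
  simp at hmk
  refine Runs.good fun hσ => ?_
  have hsB : s ≤ B := hs ▸ hσ.2.2 6 0
  refine Runs.time (T₁ := s * ((s * 5 + 3 + 1) + 2) + 2) ?_ (by nlinarith)
  refine Runs.for (s := s) (Inv := fun m τ => ∀ i < m, τ.nat 28 i = nearest s (dst I σ) S i)
    hs (by simp [Cmd.natW, natW_argminCmd]) (by simp) ?_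
  intro i τ hi hτ hA hiv hI
  have e6 := hA.nat 6 (by simp [Cmd.for, Cmd.natW, natW_argminCmd])
  have e7 := hA.nat 7 (by simp [Cmd.for, Cmd.natW, natW_argminCmd])
  have em := hA.nat mk (by simp [Cmd.for, Cmd.natW, natW_argminCmd]; omega)
  refine Runs.seq (T₂ := 1) (runs_argminCmd (s := s) (fun j => j ∈ S) (dst I σ i)
    (by simp only [BExpr.wt, RExpr.wt, NExpr.wt]; omega) (by rw [e6, hs]) ?_)
    fun ρ _ hA' hb => Runs.setNat (by decide) ?_ ?_
  · intro ρ hn hr hlt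
    simp only [BExpr.holds, RExpr.eval, NExpr.eval, hn 7 (by decide) (by decide), e7,
      hn 10 (by decide) (by decide), hn mk (by omega) (by omega), em, hS _ hlt, one_le_ind, hiv]
    exact ⟨trivial, rfl⟩
  · simp only [NExpr.eval, hb]
    exact argmin_le.trans hsB
  · have k28 := hA'.nat 28 (by simp [natW_argminCmd])
    have k10 := hA'.nat 10 (by simp [natW_argminCmd])
    intro j hj
    simp [k28, k10, hb, hiv]
    rcases Nat.lt_succ_iff_lt_or_eq.1 hj with hj' | rfl
    · simpa [hj'.ne] using hI j hj'
    · simp [nearest]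

/-- Compute the values of the centers in the second refined net, and mark those that are nearest to
a center in the first one. -/
def centerValueCmd : Cmd :=
  .seq (nearCmd 26) (.seq
    (.for 10 6 (.seq (.setReal 9 (.var 10) (.dst (.var 10) (.get 28 (.var 10))))
      (.seq (.setNat 8 (.var 10) (.const 0)) (.setReal 10 (.var 10) (.ofNat (.const 0))))))
    (.seq (nearCmd 27)
    (.for 10 6 (.seq (.setReal 10 (.get 28 (.var 10)) (.add (.get 10 (.get 28 (.var 10)))
        (.mul (.get 0 (.var 10)) (.add (.mul (.get 9 (.var 10)) (.get 9 (.var 10)))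
          (.mul (.dst (.var 10) (.get 28 (.var 10))) (.dst (.var 10) (.get 28 (.var 10))))))))
      (.ite (.leNat (.const 1) (.get 26 (.var 10))) (.setNat 8 (.get 28 (.var 10)) (.const 1))
        .skip)))))

/-- The value of the center `a` in the second of two clusterings. -/
noncomputable def centerValue (s : ℕ) (D : ℕ → ℕ → ℝ) (U : ℕ → ℝ) (n₁ n₂ : ℕ → ℕ) (a : ℕ) : ℝ :=
  ∑ i ∈ Finset.range s with n₂ i = a, U i * (D i (n₁ i) ^ 2 + D i (n₂ i) ^ 2)

theorem filter_lt_succ {Z : Finset ℕ} {m : ℕ} : Z.filter (· < m + 1) =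
    if m ∈ Z then insert m (Z.filter (· < m)) else Z.filter (· < m) := by
  ext z
  split_ifs with h
  · simp only [Finset.mem_filter, Finset.mem_insert]
    constructor
    · rintro ⟨h1, h2⟩
      rcases Nat.lt_succ_iff_lt_or_eq.1 h2 with h' | h'
      exacts [Or.inr ⟨h1, h'⟩, Or.inl h']
    · rintro (rfl | ⟨h1, h2⟩)
      exacts [⟨h, by omega⟩, ⟨h1, by omega⟩]
  · simp only [Finset.mem_filter]
    refine and_congr_right fun h1 => ⟨fun h2 => lt_of_le_of_ne (by omega) ?_, fun h => by omega⟩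
    rintro rfl
    exact h h1

/-- The array of nearest centers is used for both nets in turn, so the distances to the first net
are saved before it is overwritten. The second loop accumulates all values at once, one point at a
time. -/
theorem runs_centerValueCmd {S₁ S₂ : Finset ℕ} (hs : σ.nat 6 0 = s)
    (h₁ : ∀ i < s, σ.nat 26 i = ind S₁ i) (h₂ : ∀ i < s, σ.nat 27 i = ind S₂ i)
    (hS₁ : ∀ i ∈ S₁, i < s) :
    Runs I B centerValueCmd σ (s * (10 * s + 22) + 8) fun τ => ∀ j < s,
      τ.real 10 j = centerValue s (dst I σ) (σ.real 0) (nearest s (dst I σ) S₁)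
        (nearest s (dst I σ) S₂) j ∧
      τ.nat 8 j = ind (S₁.image (nearest s (dst I σ) S₂)) j := by
  set D := dst I σ with hD
  refine Runs.good fun hσ => ?_
  have hsB : s ≤ B := hs ▸ hσ.2.2 6 0
  refine Runs.time (T₁ := (s * (5 * s + 6) + 2) + ((s * (3 + 2) + 2) + ((s * (5 * s + 6) + 2) +
    (s * (3 + 2) + 2)))) ?_ (by nlinarith)
  refine Runs.seq (runs_nearCmd (by decide) hs h₁) fun τ hτ hA hN₁ => ?_
  have e6 := hA.nat 6 (by decide)
  have e7 := hA.nat 7 (by decide)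
  have e26 := hA.nat 26 (by decide)
  have e27 := hA.nat 27 (by decide)
  have r0 := hA.real 0 (by decide)
  refine Runs.seq (Runs.for (s := s) (T := 3) (Inv := fun m ρ => ∀ i < m,
    ρ.real 9 i = D i (nearest s D S₁ i) ∧ ρ.nat 8 i = 0 ∧ ρ.real 10 i = 0)
    (by rw [e6, hs]) (by decide) (by simp) ?_) fun ρ hρ hAρ hI => ?_
  · intro i ρ hi hρ hAρ hiv hI
    have k7 := hAρ.nat 7 (by decide)
    have k28 := hAρ.nat 28 (by decide)
    refine Runs.setReal_seq (by decide) (Runs.setNat_seq (by decide) (by simp)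
      (Runs.setReal (by decide) ?_))
    intro j hj
    simp [hiv]
    rcases Nat.lt_succ_iff_lt_or_eq.1 hj with hj' | rfl
    · simpa [hj'.ne] using hI j hj'
    · simp [k7, k28, hN₁ j hi, e7, hD, dst]
  have k6 := hAρ.nat 6 (by decide)
  have k7 := hAρ.nat 7 (by decide)
  have k26 := hAρ.nat 26 (by decide)
  have k27 := hAρ.nat 27 (by decide)
  have k0 := hAρ.real 0 (by decide)
  rw [e6] at k6
  rw [e7] at k7
  rw [e26] at k26
  rw [e27] at k27
  rw [r0] at k0
  refine Runs.seq (runs_nearCmd (s := s) (S := S₂) (by decide) (by rw [k6, hs])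
    (by rw [k27]; exact h₂)) fun κ hκ hAκ hN₂ => ?_
  have l6 := hAκ.nat 6 (by decide)
  have l7 := hAκ.nat 7 (by decide)
  have l8 := hAκ.nat 8 (by decide)
  have l26 := hAκ.nat 26 (by decide)
  have l0 := hAκ.real 0 (by decide)
  have l9 := hAκ.real 9 (by decide)
  have l10 := hAκ.real 10 (by decide)
  rw [k6] at l6
  rw [k7] at l7
  rw [k26] at l26
  rw [k0] at l0
  rw [dst_eq k7, ← hD] at hN₂
  refine Runs.post (Runs.for (s := s) (T := 3) (Inv := fun m τ' => ∀ j < s,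
    τ'.real 10 j = centerValue m D (σ.real 0) (nearest s D S₁) (nearest s D S₂) j ∧
    τ'.nat 8 j = ind ((S₁.filter (· < m)).image (nearest s D S₂)) j)
    (by rw [l6, hs]) (by decide) ?_ ?_) ?_
  · intro j hj
    simp [l8, l10, hI j hj, ind, centerValue]
  · intro i τ' hi hτ' hA' hiv hI'
    have m7 := hA'.nat 7 (by decide)
    have m26 := hA'.nat 26 (by decide)
    have m28 := hA'.nat 28 (by decide)
    have m0 := hA'.real 0 (by decide)
    have m9 := hA'.real 9 (by decide)
    rw [l7] at m7
    rw [l26] at m26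
    rw [l0] at m0
    rw [l9] at m9
    have v28 : τ'.nat 28 i = nearest s D S₂ i := by rw [m28, hN₂ i hi]
    have hval : ∀ j, centerValue (i + 1) D (σ.real 0) (nearest s D S₁) (nearest s D S₂) j =
        if j = nearest s D S₂ i then
          centerValue i D (σ.real 0) (nearest s D S₁) (nearest s D S₂) j +
            σ.real 0 i * (D i (nearest s D S₁ i) ^ 2 + D i (nearest s D S₂ i) ^ 2)
        else centerValue i D (σ.real 0) (nearest s D S₁) (nearest s D S₂) j := by
      intro j
      unfold centerValue
      rw [Finset.sum_filter, Finset.sum_range_succ, ← Finset.sum_filter]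
      by_cases hj : nearest s D S₂ i = j
      · rw [if_pos hj, if_pos hj.symm]
      · rw [if_neg hj, if_neg (Ne.symm hj), add_zero]
    refine Runs.setReal_seq (by decide) (Runs.ite (T := 1) (by decide) (fun hc => ?_) fun hc => ?_)
    · simp only [BExpr.holds, NExpr.eval, setReal_nat, hiv, m26, h₁ i hi, one_le_ind] at hc
      refine Runs.setNat (by decide) (by simp; omega) fun j hj => ?_
      rw [hval, filter_lt_succ, if_pos hc, Finset.image_insert, ind_insert]
      simp [hiv, v28, m7, m0, m9, (hI i hi).1, hI' j hj]
      split_ifs with h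
      · subst h
        rw [(hI' _ hj).1, hD]
        simp only [dst]
        ring
      · rfl
    · simp only [BExpr.holds, NExpr.eval, setReal_nat, hiv, m26, h₁ i hi, one_le_ind] at hc
      refine Runs.skip fun j hj => ?_
      rw [hval, filter_lt_succ, if_neg hc]
      simp [hiv, v28, m7, m0, m9, (hI i hi).1, hI' j hj]
      split_ifs with h
      · subst h
        rw [(hI' _ hj).1, hD]
        simp only [dst]
        ring
      · rfl
  · intro τ' _ _ h j hj
    have := h j hj
    rwa [Finset.filter_true_of_mem hS₁] at this

/-- Select the most valuable centers of the second refined net. -/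
def fillCmd : Cmd :=
  .seq (.setNat 22 (.const 0) (.const 0)) (.seq
    (.for 10 6 (.ite (.leNat (.const 1) (.get 8 (.var 10)))
      (.setNat 22 (.const 0) (.add (.var 22) (.const 1))) .skip))
    (.for 23 6 (.ite (.leNat (.add (.var 22) (.const 1)) .inputK)
      (.seq (argminCmd (.and (.leNat (.const 1) (.get 27 (.var 12)))
          (.not (.leNat (.const 1) (.get 8 (.var 12)))))
          (.sub (.ofNat (.const 0)) (.get 10 (.var 12))))
        (.seq (.setNat 8 (.var 13) (.const 1))
          (.setNat 22 (.const 0) (.add (.var 22) (.const 1)))))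
      .skip)))

theorem runs_fillCmd {S₂ N : Finset ℕ} {v : ℕ → ℝ} (hs : σ.nat 6 0 = s)
    (h₂ : ∀ i < s, σ.nat 27 i = ind S₂ i) (hS₂ : ∀ i ∈ S₂, i < s)
    (hN : ∀ i < s, σ.nat 8 i = ind N i) (hv : ∀ i < s, σ.real 10 i = v i) (hNS : N ⊆ S₂)
    (hk : I.k ≤ S₂.card) :
    Runs I B fillCmd σ (s * (5 * s + 14) + 6) fun τ =>
      ∀ i < s, τ.nat 8 i = ind (fill S₂ v s I.k N s) i := by
  refine Runs.good fun hσ => ?_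
  have hsB : s ≤ B := hs ▸ hσ.2.2 6 0
  have hkB : I.k ≤ B := hσ.2.1
  refine Runs.time (T₁ := (s * (2 + 2) + 2 + (s * (((s * 5 + 3) + 2 + 1) + 2) + 2)) + 1) ?_
    (by nlinarith)
  refine Runs.setNat_seq (by decide) (by simp) ?_
  refine Runs.seq (Runs.for (s := s) (T := 2) (Inv := fun m τ => τ.nat 22 0 =
    (N.filter (· < m)).card) (by simpa using hs) (by decide) (by simp) ?_)
    fun τ hτ hA hI => ?_
  · intro i τ hi hτ hA hiv hI
    have e8 := hA.nat 8 (by decide)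
    simp at e8
    have hcard : (N.filter (· < i + 1)).card ≤ s :=
      card_le_of_lt fun z hz => hS₂ z (hNS (Finset.mem_filter.1 hz).1)
    rw [filter_lt_succ] at hcard ⊢
    refine Runs.ite (T := 1) (by decide) (fun hc => ?_) fun hc => Runs.skip ?_
    · simp only [BExpr.holds, NExpr.eval, hiv, e8, hN i hi, one_le_ind] at hc
      rw [if_pos hc, Finset.card_insert_of_notMem (by simp)] at hcard ⊢
      exact Runs.setNat (by decide) (by simp [hI]; omega) (by simp [hI])
    · simp only [BExpr.holds, NExpr.eval, hiv, e8, hN i hi, one_le_ind] at hc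
      rw [if_neg hc]
      simpa using hI
  · rw [Finset.filter_true_of_mem fun z hz => hS₂ z (hNS hz)] at hI
    have e6 := hA.nat 6 (by decide)
    have e8 := hA.nat 8 (by decide)
    have e27 := hA.nat 27 (by decide)
    have r10 := hA.real 10 (by decide)
    simp at e6 e8 e27 r10
    refine Runs.post (Runs.for (s := s) (T := (s * 5 + 3) + 2 + 1) (Inv := fun m τ =>
      (∀ i < s, τ.nat 8 i = ind (fill S₂ v s I.k N m) i) ∧
      τ.nat 22 0 = (fill S₂ v s I.k N m).card)
      (by rw [e6, hs]) (by decide) ?_ ?_) fun ρ _ _ h => h.1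
    · simpa [e8, fill, hI] using hN
    · rintro m ρ hm hρ hAρ hmv ⟨hI1, hI2⟩
      have k6 := hAρ.nat 6 (by decide)
      have k27 := hAρ.nat 27 (by decide)
      have k10 := hAρ.real 10 (by decide)
      rw [e6] at k6
      rw [e27] at k27
      rw [r10] at k10
      rw [fill]
      refine Runs.ite (by decide) (fun hc => ?_) fun hc => Runs.time (Runs.skip ?_) (by omega)
      · simp only [BExpr.holds, NExpr.eval, hI2] at hc
        have hc' : (fill S₂ v s I.k N m).card < I.k := hc
        rw [if_pos hc']
        refine Runs.seq (T₂ := 2) (runs_argminCmd (s := s)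
          (fun i => i ∈ S₂ ∧ i ∉ fill S₂ v s I.k N m) (fun i => -v i) (by decide)
          (by rw [k6, hs]) ?_) fun κ _ hA' hb => ?_
        · intro κ hn hr hlt
          simp only [BExpr.holds, RExpr.eval, NExpr.eval, hn 8 (by decide) (by decide),
            hn 27 (by decide) (by decide), hr 10 (by decide), k27, k10, hI1 _ hlt, h₂ _ hlt,
            hv _ hlt, one_le_ind, Nat.cast_zero, zero_sub, and_self]
        · have l8 := hA'.nat 8 (by simp [natW_argminCmd])
          have l22 := hA'.nat 22 (by simp [natW_argminCmd])
          have hex : ∃ i < s, i ∈ S₂ ∧ i ∉ fill S₂ v s I.k N m := by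
            obtain ⟨i, hi, hi'⟩ := Finset.exists_mem_notMem_of_card_lt_card (hc'.trans_le hk)
            exact ⟨i, hS₂ i hi, hi, hi'⟩
          have hb' := (argmin_spec (g := fun i => -v i) hex).2.1.2
          refine Runs.setNat_seq (by decide) (by simp; omega)
            (Runs.setNat (by decide) (by simp [l22, hI2]; omega) ⟨fun i hi => ?_, ?_⟩)
          · rw [ind_insert]
            simp [l8, hb, hI1 i hi]
          · rw [Finset.card_insert_of_notMem hb']
            simp [l22, hI2]
      · simp only [BExpr.holds, NExpr.eval, hI2] at hc
        have hc' : ¬ (fill S₂ v s I.k N m).card < I.k := hc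
        rw [if_neg hc']
        simpa using ⟨hI1, hI2⟩

/-! ### The binary search and the clustering of one chunk -/

/-- Compute the smallest radius, which is `1 / 64` times the smallest distance, and the largest
distance. -/
def boundsCmd : Cmd :=
  .seq (.setReal 2 (.const 0) (.dst (.const 0) (.const 1)))
    (.seq (.setReal 3 (.const 0) (.dst (.const 0) (.const 1)))
      -- The inner loop is bounded by the variable of the outer one, so every pair is inspected
      -- once.
      (.seq (.for 10 6 (.for 11 10 (.seq
          (.ite (.leReal (.get 2 (.const 0)) (.dst (.var 10) (.var 11))) .skip
            (.setReal 2 (.const 0) (.dst (.var 10) (.var 11))))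
          (.ite (.leReal (.dst (.var 10) (.var 11)) (.get 3 (.const 0))) .skip
            (.setReal 3 (.const 0) (.dst (.var 10) (.var 11)))))))
        (.setReal 2 (.const 0) (.div (.get 2 (.const 0)) (.ofNat (.const 64))))))

theorem runs_boundsCmd (hs : σ.nat 6 0 = s) (hs2 : 2 ≤ s) :
    Runs I B boundsCmd σ (s * (6 * s + 4) + 5) fun τ =>
      (∀ i j, j < i → i < s → 64 * τ.real 2 0 ≤ dst I σ i j ∧ dst I σ i j ≤ τ.real 3 0) ∧
      (∃ i < s, ∃ j < s, i ≠ j ∧ 64 * τ.real 2 0 = dst I σ i j) ∧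
      ∃ i < s, ∃ j < s, i ≠ j ∧ τ.real 3 0 = dst I σ i j := by
  refine Runs.time (T₁ := (s * ((s * (4 + 2) + 2) + 2) + 2) + 1 + 1 + 1) ?_ (by nlinarith)
  refine Runs.setReal_seq (by decide) (Runs.setReal_seq (by decide) ?_)
  refine Runs.seq (T₂ := 1) (Runs.for (s := s) (Inv := fun m τ =>
    (∀ i j, j < i → i < m → τ.real 2 0 ≤ dst I σ i j ∧ dst I σ i j ≤ τ.real 3 0) ∧
    (∃ i < s, ∃ j < s, i ≠ j ∧ τ.real 2 0 = dst I σ i j) ∧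
    ∃ i < s, ∃ j < s, i ≠ j ∧ τ.real 3 0 = dst I σ i j)
    (by simpa using hs) (by decide) ?_ ?_) ?_
  · have h01 : ∃ i < s, ∃ j < s, i ≠ j ∧ dst I σ 0 1 = dst I σ i j :=
      ⟨0, by omega, 1, by omega, by decide, rfl⟩
    simpa [dst] using h01
  · rintro i τ hi hτ hA hiv ⟨h1, h2, h3⟩
    have e7 := hA.nat 7 (by decide)
    simp at e7
    refine Runs.time (T₁ := i * (4 + 2) + 2) ?_ (by nlinarith)
    refine Runs.post (Runs.for (s := i) (T := 4) (Inv := fun m τ =>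
      (∀ i' j, j < i' → (i' < i ∨ i' = i ∧ j < m) →
        τ.real 2 0 ≤ dst I σ i' j ∧ dst I σ i' j ≤ τ.real 3 0) ∧
      (∃ i < s, ∃ j < s, i ≠ j ∧ τ.real 2 0 = dst I σ i j) ∧
      ∃ i < s, ∃ j < s, i ≠ j ∧ τ.real 3 0 = dst I σ i j) hiv (by decide) ?_ ?_) ?_
    · simpa using ⟨h1, h2, h3⟩
    · rintro j ρ hj hρ hAρ hjv ⟨g1, g2, g3⟩
      have k7 := hAρ.nat 7 (by decide)
      have k10 := hAρ.nat 10 (by decide)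
      rw [e7] at k7
      have hd : ∀ κ : State, κ.nat = ρ.nat →
          (RExpr.dst (.var 10) (.var 11)).eval I κ = dst I σ i j := by
        intro κ hκ
        simp [hκ, k7, k10, hjv, hiv, dst]
      refine Runs.seq (T₁ := 2) (T₂ := 2) (Q₁ := fun κ => κ.nat = ρ.nat ∧
        (κ.real 2 0 ≤ ρ.real 2 0 ∧ κ.real 2 0 ≤ dst I σ i j ∧
          (κ.real 2 0 = ρ.real 2 0 ∨ κ.real 2 0 = dst I σ i j)) ∧ κ.real 3 0 = ρ.real 3 0)
        (Runs.ite (by decide) (fun hc => Runs.skip ?_) fun hc => Runs.setReal (by decide) ?_)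
        fun κ _ _ hκ => ?_
      · rw [BExpr.holds, hd ρ rfl] at hc
        exact ⟨rfl, ⟨le_rfl, hc, Or.inl rfl⟩, rfl⟩
      · rw [BExpr.holds, hd ρ rfl] at hc
        rw [hd ρ rfl]
        simp only [RExpr.eval, NExpr.eval, not_le] at hc
        simpa using hc.le
      · obtain ⟨hn, ⟨q1, q2, q3⟩, q4⟩ := hκ
        have hfin : ∀ κ' : State, κ'.real 2 0 = κ.real 2 0 →
            (ρ.real 3 0 ≤ κ'.real 3 0 ∧ dst I σ i j ≤ κ'.real 3 0 ∧
              (κ'.real 3 0 = ρ.real 3 0 ∨ κ'.real 3 0 = dst I σ i j)) →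
            (∀ i' j', j' < i' → (i' < i ∨ i' = i ∧ j' < j + 1) →
              κ'.real 2 0 ≤ dst I σ i' j' ∧ dst I σ i' j' ≤ κ'.real 3 0) ∧
            (∃ i < s, ∃ j < s, i ≠ j ∧ κ'.real 2 0 = dst I σ i j) ∧
            ∃ i < s, ∃ j < s, i ≠ j ∧ κ'.real 3 0 = dst I σ i j := by
          rintro κ' h2' ⟨t1, t2, t3⟩
          have hij : ∃ i' < s, ∃ j' < s, i' ≠ j' ∧ dst I σ i j = dst I σ i' j' :=
            ⟨i, hi, j, by omega, by omega, rfl⟩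
          rw [h2']
          refine ⟨fun i' j' hj' hor => ?_, ?_, ?_⟩
          · by_cases heq : i' = i ∧ j' = j
            · rw [heq.1, heq.2]
              exact ⟨q2, t2⟩
            · have := g1 i' j' hj' (by omega)
              exact ⟨q1.trans this.1, this.2.trans t1⟩
          · rcases q3 with q3 | q3 <;> rw [q3] <;> assumption
          · rcases t3 with t3 | t3 <;> rw [t3] <;> assumption
        refine Runs.ite (by decide) (fun hc => Runs.skip ?_) fun hc => Runs.setReal (by decide) ?_
        · rw [BExpr.holds, hd κ hn] at hc
          simp only [RExpr.eval, NExpr.eval, q4] at hc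
          exact hfin _ rfl ⟨q4.ge, by simpa [q4] using hc, Or.inl q4⟩
        · rw [BExpr.holds, hd κ hn] at hc
          rw [hd κ hn]
          simp only [RExpr.eval, NExpr.eval, q4, not_le] at hc
          exact hfin _ (by simp) ⟨by simpa using hc.le, by simp, Or.inr (by simp)⟩
    · rintro ρ _ _ ⟨g1, g2, g3⟩
      refine ⟨fun i' j hj hi' => g1 i' j hj ?_, g2, g3⟩
      omega
  · rintro τ _ _ ⟨h1, h2, h3⟩
    refine Runs.setReal (by decide) ?_
    have e : (64 : ℝ) * (τ.real 2 0 / 64) = τ.real 2 0 := by ring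
    simp [e]
    exact ⟨h1, h2, h3⟩

/-- Compute the number of doublings that take the smallest radius beyond the largest distance. -/
def levelsCmd : Cmd :=
  .seq (.setNat 18 (.const 0) (.const 0)) (.seq (.setReal 7 (.const 0) (.get 2 (.const 0)))
    (.while (.not (.leReal (.get 3 (.const 0)) (.get 7 (.const 0))))
      (.seq (.setReal 7 (.const 0) (.add (.get 7 (.const 0)) (.get 7 (.const 0))))
        (.setNat 18 (.const 0) (.add (.var 18) (.const 1))))))

theorem runs_levelsCmd {L : ℕ} (hL : σ.real 3 0 ≤ σ.real 2 0 * 2 ^ L)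
    (hLB : L ≤ B) :
    Runs I B levelsCmd σ (L * 3 + 3) fun τ =>
      τ.nat 18 0 ≤ L ∧ σ.real 3 0 ≤ σ.real 2 0 * 2 ^ τ.nat 18 0 := by
  refine Runs.setNat_seq (by decide) (by simp) (Runs.setReal_seq (by decide) ?_)
  refine Runs.post (Runs.while (Inv := fun r τ => τ.nat 18 0 ≤ L ∧
    τ.real 7 0 = σ.real 2 0 * 2 ^ τ.nat 18 0 ∧ r = (L - τ.nat 18 0) * 3) (by decide) ?_
    (i := L * 3) (by simp)) ?_
  · rintro r τ hτ hA ⟨h1, h2, rfl⟩ hb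
    have r3 := hA.real 3 (by decide)
    simp at r3
    simp only [BExpr.holds, RExpr.eval, NExpr.eval, r3, h2] at hb
    have hlt : τ.nat 18 0 < L := by
      refine lt_of_le_of_ne h1 fun h => hb ?_
      rw [h]
      exact hL
    refine ⟨2, Runs.setReal_seq (by decide) (Runs.setNat (by decide) (by simp; omega) ?_)⟩
    refine ⟨(L - (τ.nat 18 0 + 1)) * 3, by omega, ?_⟩
    simp [h2, pow_succ]
    exact ⟨hlt, by ring⟩
  · rintro τ _ hA ⟨hb, _, h1, h2, -⟩
    have r3 := hA.real 3 (by decide)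
    simp at r3
    simp only [BExpr.holds, RExpr.eval, NExpr.eval, r3, h2, not_not] at hb
    exact ⟨h1, hb⟩

/-- Compute the radii after the number of doublings in `16`, and a net. -/
def netCmd : Cmd := .seq radiiCmd greedyCmd

/-- The net for the radii after `M` doublings. -/
noncomputable def levelNet (s : ℕ) (D : ℕ → ℕ → ℝ) (U : ℕ → ℝ) (r dmax : ℝ) (M : ℕ) : Finset ℕ :=
  greedyNet s D (levelRadius s D U r dmax M) s

theorem runs_netCmd (hs : σ.nat 6 0 = s) (hD : MetricOn s (dst I σ)) (hr : 0 < σ.real 2 0) :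
    Runs I B netCmd σ ((s + σ.nat 16 0) * (9 * s + 12) + s * (9 * s + 14) + 10) fun τ =>
      (∀ i < s, τ.real 4 i =
        levelRadius s (dst I σ) (σ.real 0) (σ.real 2 0) (σ.real 3 0) (σ.nat 16 0) i) ∧
      (∀ i < s, τ.nat 21 i = ind
        (levelNet s (dst I σ) (σ.real 0) (σ.real 2 0) (σ.real 3 0) (σ.nat 16 0)) i) ∧
      τ.nat 22 0 =
        (levelNet s (dst I σ) (σ.real 0) (σ.real 2 0) (σ.real 3 0) (σ.nat 16 0)).card := by
  refine Runs.time (T₁ := ((s + σ.nat 16 0) * (9 * s + 12) + 4) + (s * (9 * s + 14) + 6)) ?_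
    (by omega)
  refine Runs.seq (runs_radiiCmd hs) fun τ hτ hA hR => ?_
  have e6 := hA.nat 6 (by decide)
  have e7 := hA.nat 7 (by decide)
  refine Runs.post (runs_greedyCmd (s := s) (by rw [e6, hs]) (by rw [dst_eq e7]; exact hD)
    fun i hi => ?_) fun ρ _ hAρ h => ?_
  · rw [hR i hi]
    exact hr.le.trans (le_levelRadius hr _ _)
  · have r4 := hAρ.real 4 (by decide)
    rw [dst_eq e7, greedyNet_congr hR] at h
    exact ⟨by rw [r4]; exact hR, h⟩

/-- Search for a number `14` of doublings for which the net has more than `k` centers, while it has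
at most `k` centers after the next doubling, whose number is `15`. -/
def searchCmd : Cmd :=
  .seq (.setNat 14 (.const 0) (.const 0)) (.seq (.setNat 15 (.const 0) (.mul (.var 6) (.var 18)))
    (.while (.leNat (.add (.var 14) (.const 2)) (.var 15))
      (.seq (.setNat 16 (.const 0) (.div (.add (.var 14) (.var 15)) (.const 2)))
        (.seq netCmd
          (.ite (.leNat (.var 22) .inputK) (.setNat 15 (.const 0) (.var 16))
            (.setNat 14 (.const 0) (.var 16)))))))

/-- Monotonicity of the net sizes is not needed: the search only keeps opposite outcomes at the two
ends of its interval. The interval starts with length at most `s * L ≤ B`, hence `B.size` halvings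
suffice, and every probe recomputes the radii from scratch. -/
theorem runs_searchCmd {L : ℕ} (hs : σ.nat 6 0 = s) (hs1 : 1 ≤ s) (hL : σ.nat 18 0 ≤ L)
    (hB : s * L ≤ B) (hD : MetricOn s (dst I σ)) (hr : 0 < σ.real 2 0)
    (h0 : I.k < (levelNet s (dst I σ) (σ.real 0) (σ.real 2 0) (σ.real 3 0) 0).card)
    (h1 : (levelNet s (dst I σ) (σ.real 0) (σ.real 2 0) (σ.real 3 0) (s * σ.nat 18 0)).card ≤ I.k) :
    Runs I B searchCmd σ (80 * s ^ 2 * (L + 1) * (B.size + 1)) fun τ =>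
      τ.nat 15 0 = τ.nat 14 0 + 1 ∧ τ.nat 15 0 ≤ s * L ∧
      I.k < (levelNet s (dst I σ) (σ.real 0) (σ.real 2 0) (σ.real 3 0) (τ.nat 14 0)).card ∧
      (levelNet s (dst I σ) (σ.real 0) (σ.real 2 0) (σ.real 3 0) (τ.nat 15 0)).card ≤ I.k := by
  set N := levelNet s (dst I σ) (σ.real 0) (σ.real 2 0) (σ.real 3 0) with hN
  obtain ⟨Tb, hTb⟩ : ∃ Tb, Tb = (s + s * L) * (9 * s + 12) + s * (9 * s + 14) + 10 + 3 := ⟨_, rfl⟩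
  have hTb' : Tb + 1 ≤ 60 * s ^ 2 * (L + 1) := by
    have h2 : s ≤ s ^ 2 := by nlinarith
    have h3 : s * L ≤ s ^ 2 * L := Nat.mul_le_mul_right _ h2
    rw [hTb]
    nlinarith
  refine Runs.time (T₁ := B.size * (Tb + 1) + 1 + 1 + 1) ?_ (by
    have h5 := Nat.mul_le_mul_left B.size hTb'
    have h6 : 1 ≤ s ^ 2 * (L + 1) := Nat.mul_pos (pow_pos hs1 2) (by omega)
    nlinarith)
  have hsL : s * σ.nat 18 0 ≤ s * L := Nat.mul_le_mul_left _ hL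
  refine Runs.setNat_seq (by decide) (by simp) ?_
  refine Runs.setNat_seq (by decide) (by simp [hs]; omega) ?_
  refine Runs.post (Runs.while (i := B.size * (Tb + 1)) (Inv := fun r τ => ∃ t,
    r = t * (Tb + 1) ∧ τ.nat 14 0 < τ.nat 15 0 ∧ τ.nat 15 0 ≤ s * L ∧
    τ.nat 15 0 - τ.nat 14 0 ≤ 2 ^ t ∧ I.k < (N (τ.nat 14 0)).card ∧ (N (τ.nat 15 0)).card ≤ I.k)
    (by decide) ?_ ⟨B.size, rfl, ?_⟩) ?_
  · rintro r τ hτ hA ⟨t, rfl, hlt, hhi, ht, hk0, hk1⟩ hb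
    have e6 := hA.nat 6 (by decide)
    have e7 := hA.nat 7 (by decide)
    have r0 := hA.real 0 (by decide)
    have r2 := hA.real 2 (by decide)
    have r3 := hA.real 3 (by decide)
    simp at e6 e7 r0 r2 r3
    simp only [BExpr.holds, NExpr.eval] at hb
    obtain ⟨m, hm⟩ : ∃ m, m = (τ.nat 14 0 + τ.nat 15 0) / 2 := ⟨_, rfl⟩
    have ht1 : 1 ≤ t := by
      rcases Nat.eq_zero_or_pos t with rfl | h
      · simp at ht; omega
      · exact h
    have hpow : 2 ^ t = 2 * 2 ^ (t - 1) := by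
      rw [← pow_succ']; congr 1; omega
    refine ⟨Tb, ?_⟩
    refine Runs.time (T₁ := ((s + m) * (9 * s + 12) + s * (9 * s + 14) + 10 + 2) + 1) ?_ (by
      have : m ≤ s * L := by omega
      rw [hTb]
      have := Nat.mul_le_mul_right (9 * s + 12) (Nat.add_le_add_left this s)
      omega)
    refine Runs.setNat_seq (by decide) (by simp; omega) ?_
    have hm' : (NExpr.div (.add (.var 14) (.var 15)) (.const 2)).eval I τ = m := by simp [hm]
    rw [hm']
    refine Runs.seq (T₁ := (s + m) * (9 * s + 12) + s * (9 * s + 14) + 10) (T₂ := 2)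
      (Runs.time (runs_netCmd (s := s) (by simp [e6, hs])
        (by rw [dst_eq (σ := σ) (by simp [e7])]; exact hD) (by simpa [r2] using hr)) (by simp))
      fun ρ hρ hAρ hρN => ?_
    have k14 := hAρ.nat 14 (by decide)
    have k15 := hAρ.nat 15 (by decide)
    have k16 := hAρ.nat 16 (by decide)
    rw [dst_eq (σ := σ) (by simp [e7])] at hρN
    simp [r0, r2, r3, ← hN] at hρN k14 k15 k16
    have hmul : (t - 1) * (Tb + 1) + Tb + 1 ≤ t * (Tb + 1) := by
      obtain ⟨t', rfl⟩ := Nat.exists_eq_add_of_le ht1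
      simp only [Nat.add_sub_cancel_left, Nat.add_mul]
      omega
    refine Runs.ite (T := 1) (by decide) (fun hc => ?_) fun hc => ?_
    · simp only [BExpr.holds, NExpr.eval, hρN.2.2] at hc
      refine Runs.setNat (by decide) (by simp [k16]; omega)
        ⟨(t - 1) * (Tb + 1), hmul, t - 1, rfl, ?_⟩
      simp [k14, k16]
      exact ⟨by omega, by omega, by omega, hk0, hc⟩
    · simp only [BExpr.holds, NExpr.eval, hρN.2.2] at hc
      refine Runs.setNat (by decide) (by simp [k16]; omega)
        ⟨(t - 1) * (Tb + 1), hmul, t - 1, rfl, ?_⟩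
      simp [k15, k16]
      exact ⟨by omega, by omega, by omega, by omega, hk1⟩
  · have hne : s * σ.nat 18 0 ≠ 0 := by
      intro h
      rw [h] at h1
      omega
    have hlt := (Nat.lt_size_self B)
    refine ⟨by simpa [hs] using Nat.pos_of_ne_zero hne, by simpa [hs] using hsL, ?_, ?_, ?_⟩
    · simp [hs]
      omega
    · simpa using h0
    · simpa [hs] using h1
  · rintro τ _ _ ⟨hb, r, t, -, h2, h3, -, h5, h6⟩
    simp only [BExpr.holds, NExpr.eval] at hb
    exact ⟨by omega, h3, h5, h6⟩

/-- Copy the refined net. -/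
def copyCmd : Cmd := .for 10 6 (.setNat 26 (.var 10) (.get 27 (.var 10)))

theorem runs_copyCmd (hs : σ.nat 6 0 = s) :
    Runs I B copyCmd σ (s * 3 + 2) fun τ => ∀ i < s, τ.nat 26 i = σ.nat 27 i := by
  refine Runs.for (s := s) (T := 1) (Inv := fun m τ => ∀ i < m, τ.nat 26 i = σ.nat 27 i)
    hs (by decide) (by simp) fun i τ hi hτ hA hiv hI => ?_
  have e27 := hA.nat 27 (by decide)
  refine Runs.setNat (by decide) (by simpa using hτ.2.2 _ _) fun j hj => ?_
  simp [hiv, e27]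
  rcases Nat.lt_succ_iff_lt_or_eq.1 hj with hj' | rfl
  · simpa [hj'.ne] using hI j hj'
  · simp

/-- Compute the refined net for the number of doublings in `16`. -/
def refinedNetCmd : Cmd := .seq netCmd refineCmd

theorem runs_refinedNetCmd {M : ℕ} {f : ℝ} (hs : σ.nat 6 0 = s) (hD : MetricOn s (dst I σ))
    (hr : 0 < σ.real 2 0) (hM : σ.nat 16 0 = M)
    (hf : ValidRadii s (dst I σ) (σ.real 0) (σ.real 2 0) f
      (levelRadius s (dst I σ) (σ.real 0) (σ.real 2 0) (σ.real 3 0) M)) :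
    Runs I B refinedNetCmd σ ((s + M) * (9 * s + 12) + s * (22 * s + 34) + 16) fun τ =>
      ∃ R g, ValidRadii s (dst I σ) (σ.real 0) (σ.real 2 0) f R ∧
        IsNet s (dst I σ) R
          (levelNet s (dst I σ) (σ.real 0) (σ.real 2 0) (σ.real 3 0) M) ∧
        IsRefinement s (dst I σ) (σ.real 0) R
          (levelNet s (dst I σ) (σ.real 0) (σ.real 2 0) (σ.real 3 0) M) g ∧
        ∀ i < s, τ.nat 27 i = ind
          ((levelNet s (dst I σ) (σ.real 0) (σ.real 2 0) (σ.real 3 0) M).image g) i := by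
  subst hM
  refine Runs.time (T₁ := ((s + σ.nat 16 0) * (9 * s + 12) + s * (9 * s + 14) + 10) +
    (s * (13 * s + 20) + 6)) ?_ (by nlinarith)
  refine Runs.seq (runs_netCmd hs hD hr) fun τ hτ hA hI => ?_
  obtain ⟨h4, h21, -⟩ := hI
  have e6 := hA.nat 6 (by decide)
  have e7 := hA.nat 7 (by decide)
  have r0 := hA.real 0 (by decide)
  have hv := hf.congr h4
  have hpos : ∀ i < s, 0 ≤ τ.real 4 i := fun i hi => hr.le.trans (hv.ge i hi)
  have hnet := isNet_greedyNet (R := τ.real 4) hD hpos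
  rw [greedyNet_congr h4] at hnet
  refine Runs.post (runs_refineCmd (s := s) (by rw [e6, hs]) (by rw [dst_eq e7]; exact hD) hpos
    (by rw [dst_eq e7]; exact hnet) h21) fun ρ _ _ h => ?_
  rw [dst_eq e7, r0] at h
  obtain ⟨g, hg, h27⟩ := h
  exact ⟨τ.real 4, g, hv, hnet, hg, h27⟩

/-- Select `k` centers in a chunk of more than `k` points. -/
def clusterCmd : Cmd :=
  .seq boundsCmd (.seq levelsCmd (.seq searchCmd
    (.seq (.setNat 16 (.const 0) (.var 15)) (.seq refinedNetCmd (.seq copyCmd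
      (.seq (.setNat 16 (.const 0) (.var 14)) (.seq refinedNetCmd
        (.seq centerValueCmd fillCmd))))))))

/-- `F` is at most `C` times as expensive as any clustering with at most `k` centers. -/
def IsApprox (s : ℕ) (D : ℕ → ℕ → ℝ) (U : ℕ → ℝ) (k : ℕ) (C : ℝ) (F : Finset ℕ) : Prop :=
  ∀ (T : Finset ℕ) (τ : ℕ → ℕ) (h : ℕ → ℝ), (∀ t ∈ T, t < s) → T.card ≤ k →
    (∀ i < s, τ i ∈ T ∧ ∀ t ∈ T, D i (τ i) ≤ D i t) →
    (∀ i < s, 0 ≤ h i ∧ ∀ z ∈ F, h i ≤ D i z) →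
    ∑ i ∈ Finset.range s, U i * h i ^ 2 ≤ C * ∑ i ∈ Finset.range s, U i * D i (τ i) ^ 2

/-- The initial radius is `1 / 64` of the smallest distance, which adds six doublings to the `L`
that the aspect ratio allows for. -/
theorem runs_clusterCmd {L : ℕ} (hs : σ.nat 6 0 = s) (hk : 1 ≤ I.k) (hks : I.k < s)
    (hB : s * (L + 6) ≤ B) (hD : MetricOn s (dst I σ)) (hU : ∀ i < s, 0 ≤ σ.real 0 i)
    (hpos : ∀ i < s, ∀ j < s, i ≠ j → 0 < dst I σ i j)
    (hL : ∀ i < s, ∀ j < s, ∀ i' < s, ∀ j' < s, i' ≠ j' → dst I σ i j ≤ 2 ^ L * dst I σ i' j') :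
    Runs I B clusterCmd σ (1000 * s ^ 2 * (L + 7) * (B.size + 1)) fun τ => ∃ F : Finset ℕ,
      (∀ i < s, τ.nat 8 i = ind F i) ∧ (∀ i ∈ F, i < s) ∧ F.card = I.k ∧
      IsApprox s (dst I σ) (σ.real 0) I.k 399675 F := by
  set D := dst I σ with hDdef
  set U := σ.real 0 with hUdef
  have hs2 : 2 ≤ s := by omega
  refine Runs.time (T₁ := (s * (6 * s + 4) + 5) + (((L + 6) * 3 + 3) +
    ((80 * s ^ 2 * (L + 6 + 1) * (B.size + 1)) +
    ((((s + s * (L + 6)) * (9 * s + 12) + s * (22 * s + 34) + 16) + ((s * 3 + 2) +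
    ((((s + s * (L + 6)) * (9 * s + 12) + s * (22 * s + 34) + 16) +
      ((s * (10 * s + 22) + 8) + (s * (5 * s + 14) + 6))) + 1))) + 1)))) ?_ (by
    have h1 : 2 * s ≤ s ^ 2 := by nlinarith
    have h2 : 4 ≤ s ^ 2 := by nlinarith
    have h3 : 2 * s * (L + 7) ≤ s ^ 2 * (L + 7) := Nat.mul_le_mul_right _ h1
    have h4 : 4 * (L + 7) ≤ s ^ 2 * (L + 7) := Nat.mul_le_mul_right _ h2
    have h5 : s ^ 2 * 7 ≤ s ^ 2 * (L + 7) := Nat.mul_le_mul_left _ (by omega)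
    have h6 : s ^ 2 * (L + 7) * 1 ≤ s ^ 2 * (L + 7) * (B.size + 1) :=
      Nat.mul_le_mul_left _ (by omega)
    nlinarith)
  refine Runs.seq (runs_boundsCmd hs hs2) fun τ₁ _ hA₁ h₁ => ?_
  have a6 := hA₁.nat 6 (by decide)
  have a7 := hA₁.nat 7 (by decide)
  have a0 := hA₁.real 0 (by decide)
  obtain ⟨hbd, ⟨i₀, hi₀, j₀, hj₀, hne₀, hmin⟩, i₁, hi₁, j₁, hj₁, hne₁, hmax⟩ := h₁
  obtain ⟨r, hr⟩ : ∃ r, r = τ₁.real 2 0 := ⟨_, rfl⟩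
  obtain ⟨dm, hdm⟩ : ∃ dm, dm = τ₁.real 3 0 := ⟨_, rfl⟩
  rw [← hr] at hmin
  rw [← hdm] at hmax
  simp only [← hr, ← hdm] at hbd
  have hrpos : 0 < r := by linarith [hpos i₀ hi₀ j₀ hj₀ hne₀]
  have hsep : ∀ i < s, ∀ j < s, i ≠ j → 64 * r ≤ D i j ∧ D i j ≤ dm := by
    intro i hi j hj hne
    rcases lt_or_gt_of_ne hne with h | h
    · rw [hD.symm i hi j hj]
      exact hbd j i h hj
    · exact hbd i j h hi
  have hdm0 : 0 ≤ dm := by linarith [hpos i₁ hi₁ j₁ hj₁ hne₁]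
  have hdmax : ∀ i < s, ∀ j < s, D i j ≤ dm := by
    intro i hi j hj
    by_cases hne : i = j
    · rw [hne, hD.self j hj]
      exact hdm0
    · exact (hsep i hi j hj hne).2
  have hdL : dm ≤ r * 2 ^ (L + 6) := by
    have := hL i₁ hi₁ j₁ hj₁ i₀ hi₀ j₀ hj₀ hne₀
    rw [← hDdef] at hmin hmax
    rw [← hmin, ← hmax] at this
    rw [pow_add]
    linarith
  have hLB : L + 6 ≤ B := by nlinarith
  refine Runs.seq (runs_levelsCmd (L := L + 6) (by rw [← hr, ← hdm]; exact hdL) hLB)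
    fun τ₂ _ hA₂ h₂ => ?_
  have b6 := (hA₂.nat 6 (by decide)).trans a6
  have b7 := (hA₂.nat 7 (by decide)).trans a7
  have b0 := (hA₂.real 0 (by decide)).trans a0
  have b2 : τ₂.real 2 0 = r := by rw [hA₂.real 2 (by decide), hr]
  have b3 : τ₂.real 3 0 = dm := by rw [hA₂.real 3 (by decide), hdm]
  rw [← hr, ← hdm] at h₂
  have hpos' : ∀ M, ∀ i < s, 0 ≤ levelRadius s D U r dm M i := fun M i _ =>
    hrpos.le.trans (le_levelRadius hrpos _ _)
  have hnet : ∀ M, IsNet s D (levelRadius s D U r dm M) (levelNet s D U r dm M) := fun M =>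
    isNet_greedyNet hD (hpos' M)
  have hone : ∀ M, (∀ i < s, dm ≤ levelRadius s D U r dm M i) →
      (levelNet s D U r dm M).card ≤ 1 := by
    intro M hM
    refine card_net_le_one (hnet M) fun i hi j hj => ?_
    have := hM i hi
    have := hdmax i hi j hj
    have := hpos' M i hi
    linarith
  refine Runs.seq (runs_searchCmd (s := s) (L := L + 6) (by rw [b6, hs]) (by omega) h₂.1 hB
    (by rw [dst_eq b7]; exact hD) (by rw [b2]; exact hrpos) ?_ ?_) fun τ₃ _ hA₃ h₃ => ?_
  · rw [dst_eq b7, b0, b2, b3]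
    rw [card_net_eq (hnet 0)]
    · exact hks
    · intro i hi j hj hne
      have := (hsep i hi j hj hne).1
      simp only [levelRadius, level, pow_zero, mul_one]
      linarith
  · rw [dst_eq b7, b0, b2, b3]
    exact (hone _ fun i hi => le_levelRadius_of_mul_le hrpos h₂.2 hi).trans hk
  rw [dst_eq b7, b0, b2, b3] at h₃
  obtain ⟨h15, hhi, hlo, hle⟩ := h₃
  have c6 := (hA₃.nat 6 (by decide)).trans b6
  have c7 := (hA₃.nat 7 (by decide)).trans b7
  have c0 := (hA₃.real 0 (by decide)).trans b0
  have c2 := (congrFun (hA₃.real 2 (by decide)) 0).trans b2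
  have c3 := (congrFun (hA₃.real 3 (by decide)) 0).trans b3
  obtain ⟨M, hM⟩ : ∃ M, M = τ₃.nat 14 0 := ⟨_, rfl⟩
  rw [h15] at hhi hle
  rw [← hM] at h15 hhi hlo hle
  -- A net with more than `k ≥ 1` centers certifies that some ball can still grow, so there is a
  -- threshold shared by the two nets.
  have hex : ∃ i < s, ¬ dm ≤ levelRadius s D U r dm M i := by
    by_contra hn
    push Not at hn
    have := hone M hn
    change I.k < (levelNet s D U r dm M).card at hlo
    omega
  obtain ⟨hf0, hv₂, hv₁⟩ := validRadii_level hU hrpos hdmax M hex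
  set f := nextValue s D U r dm M
  refine Runs.setNat_seq (by decide) (by simp [h15]; omega) ?_
  refine Runs.seq (Runs.time (runs_refinedNetCmd (s := s) (M := M + 1) (f := f)
    (by simp [c6, hs]) (by rw [dst_eq (σ := σ) (by simp [c7])]; exact hD)
    (by simpa [c2] using hrpos) (by simp [h15]) ?_) (Nat.add_le_add_right (Nat.add_le_add_right
      (Nat.mul_le_mul_right _ (Nat.add_le_add_left hhi _)) _) _)) fun τ₄ _ hA₄ h₄ => ?_
  · rw [dst_eq (σ := σ) (by simp [c7])]
    simpa [c0, c2, c3] using hv₁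
  rw [dst_eq (σ := σ) (by simp [c7])] at h₄
  simp only [setNat_real, c0, c2, c3] at h₄
  obtain ⟨R₁, g₁, hR₁, hZ₁, hg₁, hm₁⟩ := h₄
  have d6 := hA₄.nat 6 (by decide)
  have d7 := hA₄.nat 7 (by decide)
  have d14 := hA₄.nat 14 (by decide)
  have d0 := (hA₄.real 0 (by decide)).trans c0
  have d2 := (congrFun (hA₄.real 2 (by decide)) 0).trans c2
  have d3 := (congrFun (hA₄.real 3 (by decide)) 0).trans c3
  simp [c6] at d6
  simp [c7] at d7
  simp at d14
  refine Runs.seq (runs_copyCmd (s := s) (by rw [d6, hs])) fun τ₅ _ hA₅ h₅ => ?_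
  have e6 := (hA₅.nat 6 (by decide)).trans d6
  have e7 := (hA₅.nat 7 (by decide)).trans d7
  have e14 := (hA₅.nat 14 (by decide)).trans d14
  have e0 := (hA₅.real 0 (by decide)).trans d0
  have e2 := (congrFun (hA₅.real 2 (by decide)) 0).trans d2
  have e3 := (congrFun (hA₅.real 3 (by decide)) 0).trans d3
  refine Runs.setNat_seq (by decide) (by simp [e14, ← hM]; omega) ?_
  refine Runs.seq (Runs.time (runs_refinedNetCmd (s := s) (M := M) (f := f)
    (by simp [e6, hs]) (by rw [dst_eq (σ := σ) (by simp [e7])]; exact hD)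
    (by simpa [e2] using hrpos) (by simp [e14, hM]) ?_) (Nat.add_le_add_right
      (Nat.add_le_add_right (Nat.mul_le_mul_right _ (Nat.add_le_add_left
        ((Nat.le_succ M).trans hhi) _)) _) _)) fun τ₆ _ hA₆ h₆ => ?_
  · rw [dst_eq (σ := σ) (by simp [e7])]
    simpa [e0, e2, e3] using hv₂
  rw [dst_eq (σ := σ) (by simp [e7])] at h₆
  simp only [setNat_real, e0, e2, e3] at h₆
  obtain ⟨R₂, g₂, hR₂, hZ₂, hg₂, hm₂⟩ := h₆
  have f6 := hA₆.nat 6 (by decide)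
  have f7 := hA₆.nat 7 (by decide)
  have f26 := hA₆.nat 26 (by decide)
  have f0 := (hA₆.real 0 (by decide)).trans e0
  simp [e6] at f6
  simp [e7] at f7
  simp at f26
  set Z₁ := levelNet s D U r dm (M + 1)
  set Z₂ := levelNet s D U r dm M
  have hS₁ : ∀ i ∈ Z₁.image g₁, i < s := by
    intro i hi
    obtain ⟨z, hz, rfl⟩ := Finset.mem_image.1 hi
    exact hg₁.lt z hz
  have hS₂ : ∀ i ∈ Z₂.image g₂, i < s := by
    intro i hi
    obtain ⟨z, hz, rfl⟩ := Finset.mem_image.1 hi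
    exact hg₂.lt z hz
  have hcard₂ : (Z₂.image g₂).card = Z₂.card := Finset.card_image_of_injOn
    (injOn_refinement hD (fun i hi => hrpos.le.trans (hR₂.ge i hi)) hZ₂ hg₂)
  have hne₁ : (Z₁.image g₁).Nonempty := by
    obtain ⟨z, hz, -⟩ := hZ₁.dom 0 (by omega)
    exact ⟨_, Finset.mem_image_of_mem _ hz⟩
  have hne₂ : (Z₂.image g₂).Nonempty := by
    obtain ⟨z, hz, -⟩ := hZ₂.dom 0 (by omega)
    exact ⟨_, Finset.mem_image_of_mem _ hz⟩
  refine Runs.seq (runs_centerValueCmd (s := s) (S₁ := Z₁.image g₁) (S₂ := Z₂.image g₂)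
    (by rw [f6, hs]) (fun i hi => by rw [f26, h₅ i hi, hm₁ i hi]) hm₂ hS₁) fun τ₇ _ hA₇ h₇ => ?_
  rw [dst_eq f7, f0] at h₇
  have g6 := (hA₇.nat 6 (by decide)).trans f6
  have g27 := hA₇.nat 27 (by decide)
  have hn₁ := nearest_spec (D := D) hS₁ hne₁
  have hn₂ := nearest_spec (D := D) hS₂ hne₂
  set n₁ := nearest s D (Z₁.image g₁)
  set n₂ := nearest s D (Z₂.image g₂)
  have hNS : (Z₁.image g₁).image n₂ ⊆ Z₂.image g₂ := by
    intro i hi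
    obtain ⟨j, -, rfl⟩ := Finset.mem_image.1 hi
    exact (hn₂ j).1
  have hNk : ((Z₁.image g₁).image n₂).card ≤ I.k :=
    Finset.card_image_le.trans (Finset.card_image_le.trans hle)
  have hk₂ : I.k ≤ (Z₂.image g₂).card := by
    rw [hcard₂]
    exact hlo.le
  refine Runs.post (runs_fillCmd (s := s) (S₂ := Z₂.image g₂) (N := (Z₁.image g₁).image n₂)
    (v := centerValue s D U n₁ n₂) (by rw [g6, hs]) (by rw [g27]; exact hm₂) hS₂
    (fun i hi => (h₇ i hi).2) (fun i hi => (h₇ i hi).1) hNS hk₂) fun τ₈ _ _ h₈ => ?_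
  obtain ⟨q1, q2, q3, q4, q5⟩ := fill_spec (v := centerValue s D U n₁ n₂) hS₂ hNS hNk hk₂ s
  refine ⟨_, h₈, fun i hi => hS₂ i (q2 hi), by omega, ?_⟩
  intro T τ h hT hTk hτ hh
  exact clustering_cost_le hD hU hrpos (fun i hi j hj hne => (hsep i hi j hj hne).1) hf0
    hR₁ hZ₁ hg₁ hR₂ hZ₂ hg₂ hle hlo (fun i _ => hn₁ i) (fun i _ => hn₂ i) q1 q2 (by omega)
    q5 hh hT hTk hτ

/-! ### Loading a chunk and writing out its centers -/

/-- Load the next chunk. -/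
def loadCmd : Cmd :=
  .seq (.ite (.leNat (.mul .inputK (.var 2)) (.sub (.var 0) (.var 4)))
      (.setNat 6 (.const 0) (.mul .inputK (.var 2)))
      (.setNat 6 (.const 0) (.sub (.var 0) (.var 4))))
    (.for 10 6 (.seq (.setNat 7 (.var 10) (.get 1 (.add (.var 4) (.var 10))))
      (.setReal 0 (.var 10) (.get 1 (.add (.var 4) (.var 10))))))

theorem runs_loadCmd (hs : s = min (I.k * σ.nat 2 0) (σ.nat 0 0 - σ.nat 4 0)) :
    Runs I B loadCmd σ (s * 4 + 4) fun τ => τ.nat 6 0 = s ∧ ∀ i < s,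
      τ.nat 7 i = σ.nat 1 (σ.nat 4 0 + i) ∧ τ.real 0 i = σ.real 1 (σ.nat 4 0 + i) := by
  refine Runs.good fun hσ => ?_
  have hN := hσ.2.2 0 0
  refine Runs.time (T₁ := 2 + (s * (2 + 2) + 2)) ?_ (by omega)
  refine Runs.seq (T₁ := 2) (Q₁ := fun τ => τ = σ.setNat 6 0 s) (Runs.ite (by decide) (fun hc => ?_)
    fun hc => ?_) fun τ _ _ hτ => ?_
  · simp only [BExpr.holds, NExpr.eval] at hc
    rw [min_eq_left hc] at hs
    exact Runs.setNat (by decide) (by simp only [NExpr.eval]; omega) (by simp [hs])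
  · simp only [BExpr.holds, NExpr.eval] at hc
    rw [min_eq_right (by omega)] at hs
    exact Runs.setNat (by decide) (by simp only [NExpr.eval]; omega) (by simp [hs])
  · subst hτ
    refine Runs.post (Runs.for (s := s) (T := 2) (Inv := fun m τ => ∀ i < m,
      τ.nat 7 i = σ.nat 1 (σ.nat 4 0 + i) ∧ τ.real 0 i = σ.real 1 (σ.nat 4 0 + i))
      (by simp) (by decide) (by simp) fun i τ hi hτ hA hiv hI => ?_) fun τ _ hA h => ⟨?_, h⟩
    · have e1 := hA.nat 1 (by decide)
      have e4 := hA.nat 4 (by decide)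
      have r1 := hA.real 1 (by decide)
      simp at e1 e4 r1
      refine Runs.setNat_seq (by decide) (hτ.2.2 _ _) (Runs.setReal (by decide) fun j hj => ?_)
      simp [hiv, e1, e4, r1]
      rcases Nat.lt_succ_iff_lt_or_eq.1 hj with hj' | rfl
      · simpa [hj'.ne] using hI j hj'
      · simp
    · rw [hA.nat 6 (by decide)]
      simp

/-- Sum up the weights of the points that have the same nearest center. -/
def aggregateCmd : Cmd :=
  .seq (.for 10 6 (.setReal 11 (.var 10) (.ofNat (.const 0))))
    (.for 10 6 (.setReal 11 (.get 28 (.var 10))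
      (.add (.get 11 (.get 28 (.var 10))) (.get 0 (.var 10)))))

theorem runs_aggregateCmd (hs : σ.nat 6 0 = s) :
    Runs I B aggregateCmd σ (s * 6 + 4) fun τ => ∀ j < s,
      τ.real 11 j = ∑ i ∈ Finset.range s with σ.nat 28 i = j, σ.real 0 i := by
  refine Runs.time (T₁ := (s * (1 + 2) + 2) + (s * (1 + 2) + 2)) ?_ (by omega)
  refine Runs.seq (Runs.for (s := s) (T := 1) (Inv := fun m τ => ∀ i < m, τ.real 11 i = 0)
    hs (by decide) (by simp) fun i τ hi hτ hA hiv hI => Runs.setReal (by decide) fun j hj => ?_)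
    fun τ _ hA hI => ?_
  · simp [hiv]
    rcases Nat.lt_succ_iff_lt_or_eq.1 hj with hj' | rfl
    · simpa [hj'.ne] using hI j hj'
    · simp
  · have e6 := hA.nat 6 (by decide)
    have e28 := hA.nat 28 (by decide)
    have r0 := hA.real 0 (by decide)
    refine Runs.for (s := s) (Inv := fun m τ => ∀ j < s, τ.real 11 j =
      ∑ i ∈ Finset.range m with σ.nat 28 i = j, σ.real 0 i) (by rw [e6, hs]) (by decide)
      (fun j hj => by simpa using hI j hj)
      fun i ρ hi hρ hAρ hiv hI' => Runs.setReal (by decide) fun j hj => ?_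
    have k28 := (hAρ.nat 28 (by decide)).trans e28
    have k0 := (hAρ.real 0 (by decide)).trans r0
    rw [Finset.sum_filter, Finset.sum_range_succ, ← Finset.sum_filter]
    simp [hiv, k28, k0]
    by_cases h : j = σ.nat 28 i
    · rw [if_pos h, if_pos h.symm, ← h, hI' j hj]
    · rw [if_neg h, if_neg (Ne.symm h), hI' j hj, add_zero]

/-- The number of elements of `F` below `i`. -/
def rank (F : Finset ℕ) (i : ℕ) : ℕ := (F.filter (· < i)).card

theorem rank_succ (F : Finset ℕ) (i : ℕ) :
    rank F (i + 1) = if i ∈ F then rank F i + 1 else rank F i := by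
  unfold rank
  rw [filter_lt_succ]
  split_ifs
  · rw [Finset.card_insert_of_notMem (by simp)]
  · rfl

theorem rank_lt_rank {F : Finset ℕ} {i j : ℕ} (hi : i ∈ F) (h : i < j) : rank F i < rank F j := by
  have h1 : rank F i + 1 = rank F (i + 1) := by rw [rank_succ, if_pos hi]
  have h2 : rank F (i + 1) ≤ rank F j := Finset.card_le_card fun z hz =>
    Finset.mem_filter.2 ⟨(Finset.mem_filter.1 hz).1, (Finset.mem_filter.1 hz).2.trans_le h⟩
  omega

theorem rank_lt_card {F : Finset ℕ} {i : ℕ} (hi : i ∈ F) : rank F i < F.card := by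
  have h1 := rank_lt_rank hi (Nat.lt_succ_self i)
  have h2 : rank F (i + 1) ≤ F.card := Finset.card_le_card (Finset.filter_subset _ _)
  exact h1.trans_le h2

theorem rank_inj {F : Finset ℕ} {i j : ℕ} (hi : i ∈ F) (hj : j ∈ F) (h : rank F i = rank F j) :
    i = j := by
  rcases lt_trichotomy i j with h' | h' | h'
  · exact absurd h (rank_lt_rank hi h').ne
  · exact h'
  · exact absurd h (rank_lt_rank hj h').ne'

theorem exists_rank_eq {F : Finset ℕ} {l : ℕ} (hl : l < F.card) : ∃ i ∈ F, rank F i = l := by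
  have h : F.image (rank F) = Finset.range F.card := by
    refine Finset.eq_of_subset_of_card_le ?_ ?_
    · intro x hx
      obtain ⟨i, hi, rfl⟩ := Finset.mem_image.1 hx
      exact Finset.mem_range.2 (rank_lt_card hi)
    · rw [Finset.card_range, Finset.card_image_of_injOn fun i hi j hj h => rank_inj hi hj h]
  have hl' := Finset.mem_range.2 hl
  rw [← h] at hl'
  simpa using hl'

/-- Append the selected centers, with their weights, to the output. -/
def appendCmd : Cmd :=
  .for 10 6 (.ite (.leNat (.const 1) (.get 8 (.var 10)))
    (.seq (.setNat 1 (.var 5) (.get 7 (.var 10)))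
      (.seq (.setReal 1 (.var 5) (.get 11 (.var 10)))
        (.setNat 5 (.const 0) (.add (.var 5) (.const 1))))) .skip)

theorem runs_appendCmd {F : Finset ℕ} (hs : σ.nat 6 0 = s) (hF : ∀ i ∈ F, i < s)
    (h8 : ∀ i < s, σ.nat 8 i = ind F i) (hB : σ.nat 5 0 + s ≤ B) :
    Runs I B appendCmd σ (s * 6 + 2) fun τ => τ.nat 5 0 = σ.nat 5 0 + F.card ∧
      (∀ i ∈ F, τ.nat 1 (σ.nat 5 0 + rank F i) = σ.nat 7 i ∧
        τ.real 1 (σ.nat 5 0 + rank F i) = σ.real 11 i) ∧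
      ∀ j, j < σ.nat 5 0 ∨ σ.nat 5 0 + F.card ≤ j →
        τ.nat 1 j = σ.nat 1 j ∧ τ.real 1 j = σ.real 1 j := by
  have hrF : rank F s = F.card := by
    unfold rank
    rw [Finset.filter_true_of_mem hF]
  refine Runs.post (Runs.for (s := s) (T := 4) (Inv := fun m τ =>
      τ.nat 5 0 = σ.nat 5 0 + rank F m ∧
      (∀ i ∈ F, i < m → τ.nat 1 (σ.nat 5 0 + rank F i) = σ.nat 7 i ∧
        τ.real 1 (σ.nat 5 0 + rank F i) = σ.real 11 i) ∧
      ∀ j, j < σ.nat 5 0 ∨ σ.nat 5 0 + F.card ≤ j →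
        τ.nat 1 j = σ.nat 1 j ∧ τ.real 1 j = σ.real 1 j)
    hs (by decide) (by simp [rank]) ?_) fun τ _ _ h => ?_
  · rintro m τ hm hτ hA hmv ⟨h1, h2, h3⟩
    have e7 := hA.nat 7 (by decide)
    have e8 := hA.nat 8 (by decide)
    have r11 := hA.real 11 (by decide)
    refine Runs.ite (by decide) (fun hc => ?_) fun hc => Runs.time (Runs.skip ?_) (by omega)
    · simp only [BExpr.holds, NExpr.eval, hmv, e8, h8 m hm, one_le_ind] at hc
      have hlt := rank_lt_card hc
      have hcs := card_le_of_lt hF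
      refine Runs.setNat_seq (by decide) (hτ.2.2 _ _) (Runs.setReal_seq (by decide)
        (Runs.setNat (by decide) (by simp [h1]; omega) ⟨?_, ?_, ?_⟩))
      · rw [rank_succ, if_pos hc]
        simp [h1]
        omega
      · intro i hi him
        rcases Nat.lt_succ_iff_lt_or_eq.1 him with him' | rfl
        · have := (rank_lt_rank hi him').ne
          simp [h1, this, h2 i hi him']
        · simp [h1, hmv, e7, r11]
      · intro j hj
        have : j ≠ σ.nat 5 0 + rank F m := by omega
        simp [h1, this, h3 j hj]
    · simp only [BExpr.holds, NExpr.eval, hmv, e8, h8 m hm, one_le_ind] at hc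
      rw [rank_succ, if_neg hc]
      refine ⟨by simpa using h1, fun i hi him => ?_, by simpa using h3⟩
      have : i ≠ m := fun h => hc (h ▸ hi)
      simpa using h2 i hi (by omega)
  · rw [hrF] at h
    exact ⟨h.1, fun i hi => h.2.1 i hi (hF i hi), h.2.2⟩

/-- The optimal cost grows by a factor of at most four if centers outside of the chunk are not
allowed. -/
theorem IsApprox.le {n k : ℕ} {C : ℝ} {d : ℕ → ℕ → ℝ} {U : ℕ → ℝ} {X θ : ℕ → ℕ} {F : Finset ℕ}
    (hF : IsApprox s (fun i j => d (X i) (X j)) U k C F) (hd : MetricOn n d) (hs : 0 < s)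
    (hX : ∀ i < s, X i < n) (hU : ∀ i < s, 0 ≤ U i) (hC : 0 ≤ C) (hFs : ∀ i ∈ F, i < s)
    (hFne : F.Nonempty) (hθ : ∀ i < s, θ i < n) (hθk : ((Finset.range s).image θ).card ≤ k) :
    ∑ i ∈ Finset.range s, U i * d (X i) (X (nearest s (fun i j => d (X i) (X j)) F i)) ^ 2 ≤
      4 * C * ∑ i ∈ Finset.range s, U i * d (X i) (θ i) ^ 2 := by
  obtain ⟨c, hc⟩ : ∃ c : ℕ → ℕ, ∀ v, c v = argmin s (fun _ => True) fun i => d v (X i) :=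
    ⟨_, fun _ => rfl⟩
  have hcs : ∀ v, c v < s ∧ ∀ i < s, d v (X (c v)) ≤ d v (X i) := by
    intro v
    rw [hc]
    obtain ⟨h1, -, h3⟩ := argmin_spec (s := s) (p := fun _ => True) (g := fun i => d v (X i))
      ⟨0, hs, trivial⟩
    exact ⟨h1, fun i hi => h3 i hi trivial⟩
  -- Every center moves to the nearest point of the chunk, which at most doubles the distances.
  set T := ((Finset.range s).image θ).image c with hT
  have hTs : ∀ t ∈ T, t < s := by
    intro t ht
    obtain ⟨v, -, rfl⟩ := Finset.mem_image.1 ht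
    exact (hcs v).1
  have hTi : ∀ i < s, c (θ i) ∈ T := fun i hi =>
    Finset.mem_image_of_mem _ (Finset.mem_image_of_mem _ (Finset.mem_range.2 hi))
  have hτ := nearest_spec (D := fun i j => d (X i) (X j)) hTs ⟨_, hTi 0 hs⟩
  have hn := nearest_spec (D := fun i j => d (X i) (X j)) hFs hFne
  refine (hF T (nearest s (fun i j => d (X i) (X j)) T) _ hTs (Finset.card_image_le.trans hθk)
    (fun i _ => hτ i) fun i hi => ⟨hd.nonneg _ (hX i hi) _ (hX _ (hFs _ (hn i).1)),
      (hn i).2⟩).trans ?_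
  rw [show 4 * C * ∑ i ∈ Finset.range s, U i * d (X i) (θ i) ^ 2 =
    C * (4 * ∑ i ∈ Finset.range s, U i * d (X i) (θ i) ^ 2) by ring]
  refine mul_le_mul_of_nonneg_left ?_ hC
  rw [Finset.mul_sum]
  refine Finset.sum_le_sum fun i hi => ?_
  have hi := Finset.mem_range.1 hi
  have h1 := (hτ i).2 _ (hTi i hi)
  have h2 := hd.tri _ (hX i hi) _ (hθ i hi) _ (hX _ (hcs (θ i)).1)
  have h3 := (hcs (θ i)).2 i hi
  rw [hd.symm _ (hθ i hi) _ (hX i hi)] at h3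
  have h4 : d (X i) (X (nearest s (fun i j => d (X i) (X j)) T i)) ≤ 2 * d (X i) (θ i) := by
    linarith
  have h5 := pow_le_pow_left₀ (hd.nonneg _ (hX i hi) _ (hX _ (hTs _ (hτ i).1))) h4 2
  nlinarith [mul_le_mul_of_nonneg_left h5 (hU i hi)]

/-- The points of the input form a metric space, whose aspect ratio is at most `2 ^ L`. -/
structure Input.IsMetric (I : Input) (L : ℕ) : Prop where
  metric : MetricOn I.n I.dist
  pos : ∀ i < I.n, ∀ j < I.n, i ≠ j → 0 < I.dist i j
  ratio : ∀ i < I.n, ∀ j < I.n, ∀ i' < I.n, ∀ j' < I.n, i' ≠ j' →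
    I.dist i j ≤ 2 ^ L * I.dist i' j'
  k_pos : 1 ≤ I.k

/-- Select centers for the loaded chunk. -/
def selectCmd : Cmd :=
  .ite (.leNat (.var 6) .inputK) (.for 10 6 (.setNat 8 (.var 10) (.const 1))) clusterCmd

theorem runs_selectCmd {L : ℕ} (hI : I.IsMetric L) (hs : σ.nat 6 0 = s) (hs1 : 1 ≤ s)
    (hB : s * (L + 6) ≤ B) (hX : ∀ i < s, σ.nat 7 i < I.n)
    (hinj : ∀ i < s, ∀ j < s, σ.nat 7 i = σ.nat 7 j → i = j) (hU : ∀ i < s, 0 ≤ σ.real 0 i) :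
    Runs I B selectCmd σ (1000 * s ^ 2 * (L + 7) * (B.size + 1) + 1) fun τ => ∃ F : Finset ℕ,
      (∀ i < s, τ.nat 8 i = ind F i) ∧ (∀ i ∈ F, i < s) ∧ F.Nonempty ∧ F.card ≤ I.k ∧
      IsApprox s (dst I σ) (σ.real 0) I.k 399675 F := by
  have hD : MetricOn s (dst I σ) := ⟨fun i hi => hI.metric.self _ (hX i hi),
    fun i hi j hj => hI.metric.symm _ (hX i hi) _ (hX j hj),
    fun i hi j hj l hl => hI.metric.tri _ (hX i hi) _ (hX j hj) _ (hX l hl),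
    fun i hi j hj => hI.metric.nonneg _ (hX i hi) _ (hX j hj)⟩
  refine Runs.good fun hσ => ?_
  refine Runs.ite (by decide) (fun hc => ?_) fun hc => ?_
  · simp only [BExpr.holds, NExpr.eval, hs] at hc
    have hB1 : 1 ≤ B := hI.k_pos.trans hσ.2.1
    refine Runs.mono (Runs.for (s := s) (T := 1) (Inv := fun m τ => ∀ i < m, τ.nat 8 i = 1)
      hs (by decide) (by simp) fun i τ hi hτ hA hiv h => Runs.setNat (by decide)
        (by simpa using hB1) fun j hj => ?_) ?_ fun τ _ _ h => ?_
    · simp [hiv]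
      rcases Nat.lt_succ_iff_lt_or_eq.1 hj with hj' | rfl
      · simpa [hj'.ne] using h j hj'
      · simp
    · have h6 : s * 1 ≤ s * (L + 7) := Nat.mul_le_mul_left _ (by omega)
      have h7 : s * (L + 7) ≤ s ^ 2 * (L + 7) := Nat.mul_le_mul_right _ (by nlinarith)
      have h8 : s ^ 2 * (L + 7) * 1 ≤ s ^ 2 * (L + 7) * (B.size + 1) :=
        Nat.mul_le_mul_left _ (by omega)
      nlinarith
    · refine ⟨Finset.range s, fun i hi => ?_, fun i hi => Finset.mem_range.1 hi,
        ⟨0, Finset.mem_range.2 hs1⟩, by simpa using hc, ?_⟩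
      · rw [h i hi, ind, if_pos (Finset.mem_range.2 hi)]
      · intro T θ h _ _ _ hh
        have h0 : ∑ i ∈ Finset.range s, σ.real 0 i * h i ^ 2 = 0 := by
          refine Finset.sum_eq_zero fun i hi => ?_
          have his := Finset.mem_range.1 hi
          have h1 := (hh i his).2 i hi
          rw [hD.self i his] at h1
          rw [le_antisymm h1 (hh i his).1]
          ring
        rw [h0]
        exact mul_nonneg (by norm_num) (Finset.sum_nonneg fun i hi =>
          mul_nonneg (hU i (Finset.mem_range.1 hi)) (sq_nonneg _))
  · simp only [BExpr.holds, NExpr.eval, hs, not_le] at hc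
    refine Runs.post (runs_clusterCmd hs hI.k_pos hc hB hD hU
      (fun i hi j hj hne => hI.pos _ (hX i hi) _ (hX j hj) fun h => hne (hinj i hi j hj h))
      fun i hi j hj i' hi' j' hj' hne => hI.ratio _ (hX i hi) _ (hX j hj) _ (hX i' hi') _
        (hX j' hj') fun h => hne (hinj i' hi' j' hj' h)) fun τ _ _ h => ?_
    obtain ⟨F, h1, h2, h3, h4⟩ := h
    exact ⟨F, h1, h2, Finset.card_pos.1 (h3.symm ▸ hI.k_pos), h3.le, h4⟩

/-! ### Reductions to weighted centers -/

/-- Replace a chunk by at most `k` weighted centers. -/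
def chunkCmd : Cmd :=
  .seq loadCmd (.seq selectCmd (.seq (nearCmd 8) (.seq aggregateCmd (.seq appendCmd
    (.setNat 4 (.const 0) (.add (.var 4) (.var 6)))))))

/-- The points `Y' l` with the weights `W' l`, where `l < m`, are selected from the points `Y i` with
the weights `W i`, where `i < s`, and `Y i` is moved to `Y' (ρ i)`; this costs at most `C` times as
much as any solution to `k`-means. -/
structure IsReduction (I : Input) (C : ℝ) (s m : ℕ) (Y Y' : ℕ → ℕ) (W W' : ℕ → ℝ) (f ρ : ℕ → ℕ) :
    Prop where
  lt : ∀ l < m, f l < s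
  eq : ∀ l < m, Y' l = Y (f l)
  inj : ∀ l < m, ∀ l' < m, f l = f l' → l = l'
  weight : ∀ l < m, W' l = ∑ i ∈ Finset.range s with ρ i = l, W i
  assign : ∀ i < s, ρ i < m
  cost : ∀ θ : ℕ → ℕ, (∀ i < s, θ i < I.n) → ((Finset.range s).image θ).card ≤ I.k →
    ∑ i ∈ Finset.range s, W i * I.dist (Y i) (Y (f (ρ i))) ^ 2 ≤
      C * ∑ i ∈ Finset.range s, W i * I.dist (Y i) (θ i) ^ 2

/-- The constant is `4 * 399675`, since the competing centers may lie outside of the chunk. -/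
theorem runs_chunkCmd {L : ℕ} (hI : I.IsMetric L)
    (hs : s = min (I.k * σ.nat 2 0) (σ.nat 0 0 - σ.nat 4 0)) (hs1 : 1 ≤ s)
    (hB : s * (L + 6) ≤ B) (hout : σ.nat 5 0 ≤ σ.nat 4 0)
    (hY : ∀ j, σ.nat 4 0 ≤ j → j < σ.nat 0 0 → σ.nat 1 j < I.n)
    (hinj : ∀ i j, σ.nat 4 0 ≤ i → i < σ.nat 0 0 → σ.nat 4 0 ≤ j → j < σ.nat 0 0 →
      σ.nat 1 i = σ.nat 1 j → i = j)
    (hW : ∀ j, σ.nat 4 0 ≤ j → j < σ.nat 0 0 → 0 ≤ σ.real 1 j) :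
    Runs I B chunkCmd σ (1100 * s ^ 2 * (L + 7) * (B.size + 1)) fun τ =>
      τ.nat 4 0 = σ.nat 4 0 + s ∧ ∃ m f ρ, 1 ≤ m ∧ m ≤ I.k ∧ m ≤ s ∧
        τ.nat 5 0 = σ.nat 5 0 + m ∧ IsReduction I 1598700 s m (fun i => σ.nat 1 (σ.nat 4 0 + i))
          (fun l => τ.nat 1 (σ.nat 5 0 + l)) (fun i => σ.real 1 (σ.nat 4 0 + i))
          (fun l => τ.real 1 (σ.nat 5 0 + l)) f ρ ∧
        ∀ j, j < σ.nat 5 0 ∨ σ.nat 5 0 + m ≤ j →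
          τ.nat 1 j = σ.nat 1 j ∧ τ.real 1 j = σ.real 1 j := by
  refine Runs.good fun hσ => ?_
  have hNB := hσ.2.2 0 0
  have hsN : σ.nat 4 0 + s ≤ σ.nat 0 0 := by omega
  refine Runs.time (T₁ := (s * 4 + 4) + ((1000 * s ^ 2 * (L + 7) * (B.size + 1) + 1) +
    ((s * (5 * s + 6) + 2) + ((s * 6 + 4) + ((s * 6 + 2) + 1))))) ?_ (by
      have h5 : s * 1 ≤ s * s := Nat.mul_le_mul_left _ hs1
      have h6 : s ^ 2 * 7 ≤ s ^ 2 * (L + 7) := Nat.mul_le_mul_left _ (by omega)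
      have h8 : s ^ 2 * (L + 7) * 1 ≤ s ^ 2 * (L + 7) * (B.size + 1) :=
        Nat.mul_le_mul_left _ (by omega)
      nlinarith)
  refine Runs.seq (runs_loadCmd hs) fun τ₁ _ hA₁ h₁ => ?_
  obtain ⟨a6, h₁⟩ := h₁
  have a1 := hA₁.nat 1 (by decide)
  have a4 := hA₁.nat 4 (by decide)
  have a5 := hA₁.nat 5 (by decide)
  have r1 := hA₁.real 1 (by decide)
  set a := σ.nat 4 0 with ha
  set o := σ.nat 5 0 with ho
  have hX : ∀ i < s, τ₁.nat 7 i < I.n := fun i hi => by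
    rw [(h₁ i hi).1]
    exact hY _ (by omega) (by omega)
  have hU : ∀ i < s, 0 ≤ τ₁.real 0 i := fun i hi => by
    rw [(h₁ i hi).2]
    exact hW _ (by omega) (by omega)
  refine Runs.seq (runs_selectCmd hI a6 hs1 hB hX (fun i hi j hj h => ?_) hU) fun τ₂ _ hA₂ h₂ => ?_
  · rw [(h₁ i hi).1, (h₁ j hj).1] at h
    have := hinj _ _ (by omega) (by omega) (by omega) (by omega) h
    omega
  obtain ⟨F, h8, hFs, hFne, hFk, happ⟩ := h₂
  have b1 := (hA₂.nat 1 (by decide)).trans a1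
  have b4 := (hA₂.nat 4 (by decide)).trans a4
  have b5 := (hA₂.nat 5 (by decide)).trans a5
  have b6 := hA₂.nat 6 (by decide)
  have b7 := hA₂.nat 7 (by decide)
  have b0 := hA₂.real 0 (by decide)
  have s1 := (hA₂.real 1 (by decide)).trans r1
  refine Runs.seq (runs_nearCmd (s := s) (S := F) (by decide) (by rw [b6, a6]) h8)
    fun τ₃ _ hA₃ h₃ => ?_
  rw [dst_eq b7] at h₃
  have c1 := (hA₃.nat 1 (by decide)).trans b1
  have c4 := (hA₃.nat 4 (by decide)).trans b4
  have c5 := (hA₃.nat 5 (by decide)).trans b5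
  have c6 := (hA₃.nat 6 (by decide)).trans b6
  have c7 := (hA₃.nat 7 (by decide)).trans b7
  have c8 := hA₃.nat 8 (by decide)
  have c0 := (hA₃.real 0 (by decide)).trans b0
  have t1 := (hA₃.real 1 (by decide)).trans s1
  refine Runs.seq (runs_aggregateCmd (s := s) (by rw [c6, a6])) fun τ₄ _ hA₄ h₄ => ?_
  have d1 := (hA₄.nat 1 (by decide)).trans c1
  have d4 := (hA₄.nat 4 (by decide)).trans c4
  have d5 := (hA₄.nat 5 (by decide)).trans c5
  have d6 := (hA₄.nat 6 (by decide)).trans c6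
  have d7 := (hA₄.nat 7 (by decide)).trans c7
  have d8 := (hA₄.nat 8 (by decide)).trans c8
  have u1 := (hA₄.real 1 (by decide)).trans t1
  refine Runs.seq (runs_appendCmd (s := s) (F := F) (by rw [d6, a6]) hFs (by rw [d8]; exact h8)
    (by rw [d5]; omega)) fun τ₅ _ hA₅ h₅ => ?_
  have e4 := (hA₅.nat 4 (by decide)).trans d4
  have e6 := (hA₅.nat 6 (by decide)).trans d6
  refine Runs.setNat (by decide) (by simp [e4, e6, a6]; omega) ?_
  rw [d5, d7, d1, u1, ← ho] at h₅
  obtain ⟨q1, q2, q3⟩ := h₅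
  have hn := nearest_spec (D := dst I τ₁) hFs hFne
  set n := nearest s (dst I τ₁) F with hndef
  -- The centers are written in increasing order, so position and element of `F` are exchanged by
  -- `rank` and its inverse `f`.
  have hf : ∀ l, ∃ i, l < F.card → i ∈ F ∧ rank F i = l := by
    intro l
    by_cases h : l < F.card
    · obtain ⟨i, hi, hr⟩ := exists_rank_eq h
      exact ⟨i, fun _ => ⟨hi, hr⟩⟩
    · exact ⟨0, fun h' => absurd h' h⟩
  choose f hf using hf
  have hfn : ∀ i, f (rank F (n i)) = n i := fun i => by
    have := hf (rank F (n i)) (rank_lt_card (hn i).1)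
    exact rank_inj this.1 (hn i).1 this.2
  refine ⟨by simp [e4, e6, a6, ha], F.card, f, fun i => rank F (n i), Finset.card_pos.2 hFne, hFk,
    card_le_of_lt hFs, by simpa using q1, ?_, by simpa using q3⟩
  refine ⟨fun l hl => hFs _ (hf l hl).1, fun l hl => ?_, fun l hl l' hl' h => ?_, fun l hl => ?_,
    fun i hi => rank_lt_card (hn i).1, fun θ hθ hθk => ?_⟩
  · have := (q2 _ (hf l hl).1).1
    rw [(hf l hl).2] at this
    simp [this, (h₁ _ (hFs _ (hf l hl).1)).1]
  · rw [← (hf l hl).2, ← (hf l' hl').2, h]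
  · have := (q2 _ (hf l hl).1).2
    rw [(hf l hl).2] at this
    simp only [setNat_real, this]
    rw [h₄ _ (hFs _ (hf l hl).1), c0, Finset.sum_filter, Finset.sum_filter]
    refine Finset.sum_congr rfl fun i hi => ?_
    have hi := Finset.mem_range.1 hi
    have hiff : τ₃.nat 28 i = f l ↔ rank F (n i) = l := by
      rw [h₃ i hi]
      constructor
      · intro h
        rw [h, (hf l hl).2]
      · intro h
        rw [← h, hfn]
    simp only [hiff, (h₁ i hi).2]
  · have := IsApprox.le (X := τ₁.nat 7) (d := I.dist) happ hI.metric (by omega) hX hU (by norm_num) hFs hFne hθ hθk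
    norm_num at this
    refine le_trans (le_of_eq ?_) (this.trans (le_of_eq ?_))
    · refine Finset.sum_congr rfl fun i hi => ?_
      have hi := Finset.mem_range.1 hi
      change _ = τ₁.real 0 i * I.dist (τ₁.nat 7 i) (τ₁.nat 7 (n i)) ^ 2
      rw [hfn, (h₁ i hi).1, (h₁ i hi).2, (h₁ _ (hFs _ (hn i).1)).1]
    · congr 1
      refine Finset.sum_congr rfl fun i hi => ?_
      have hi := Finset.mem_range.1 hi
      rw [(h₁ i hi).1, (h₁ i hi).2]

/-- Both parts compare themselves with the same `θ`, whose restriction to either part uses at most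
`k` centers. Hence the constant does not grow with the number of chunks. -/
theorem IsReduction.append {C : ℝ} {a o s m : ℕ} {Y₀ Y Y' : ℕ → ℕ} {W₀ W W' : ℕ → ℝ}
    {f ρ f' ρ' : ℕ → ℕ} (h : IsReduction I C a o Y₀ Y W₀ W f ρ)
    (h' : IsReduction I C s m (fun i => Y₀ (a + i)) (fun l => Y' (o + l)) (fun i => W₀ (a + i))
      (fun l => W' (o + l)) f' ρ')
    (hY : ∀ j < o, Y' j = Y j ∧ W' j = W j) :
    ∃ f'' ρ'', IsReduction I C (a + s) (o + m) Y₀ Y' W₀ W' f'' ρ'' := by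
  refine ⟨fun l => if l < o then f l else a + f' (l - o),
    fun j => if j < a then ρ j else o + ρ' (j - a), ?_, ?_, ?_, ?_, ?_, ?_⟩
  · intro l hl
    split_ifs with h1
    · have := h.lt l h1
      omega
    · have := h'.lt (l - o) (by omega)
      omega
  · intro l hl
    split_ifs with h1
    · rw [(hY l h1).1, h.eq l h1]
    · have := h'.eq (l - o) (by omega)
      rwa [show o + (l - o) = l by omega] at this
  · intro l hl l' hl'
    split_ifs with h1 h2 h2
    · exact h.inj l h1 l' h2
    · have := h.lt l h1
      omega
    · have := h.lt l' h2
      omega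
    · have := h'.inj (l - o) (by omega) (l' - o) (by omega)
      omega
  · intro l hl
    rw [Finset.sum_filter, Finset.sum_range_add]
    by_cases h1 : l < o
    · rw [(hY l h1).2, h.weight l h1, Finset.sum_filter]
      rw [Finset.sum_eq_zero (s := Finset.range s), add_zero]
      · refine Finset.sum_congr rfl fun i hi => ?_
        rw [if_pos (Finset.mem_range.1 hi)]
      · intro i hi
        rw [if_neg (by omega : ¬ a + i < a), if_neg (by omega)]
    · have := h'.weight (l - o) (by omega)
      rw [show o + (l - o) = l by omega] at this
      rw [this, Finset.sum_filter, Finset.sum_eq_zero (s := Finset.range a), zero_add]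
      · refine Finset.sum_congr rfl fun i hi => ?_
        rw [if_neg (by omega : ¬ a + i < a), Nat.add_sub_cancel_left]
        congr 1
        exact propext (by omega)
      · intro i hi
        have := h.assign i (Finset.mem_range.1 hi)
        rw [if_pos (Finset.mem_range.1 hi), if_neg (by omega)]
  · intro j hj
    split_ifs with h1
    · have := h.assign j h1
      omega
    · have := h'.assign (j - a) (by omega)
      omega
  · intro θ hθ hk
    rw [Finset.sum_range_add, Finset.sum_range_add, mul_add]
    refine add_le_add ?_ ?_
    · refine le_trans (le_of_eq ?_) (h.cost θ (fun i hi => hθ i (by omega))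
        (le_trans (Finset.card_le_card ?_) hk))
      · refine Finset.sum_congr rfl fun i hi => ?_
        have hi := Finset.mem_range.1 hi
        rw [if_pos hi, if_pos (h.assign i hi)]
      · exact Finset.image_subset_image (by simp)
    · refine le_trans (le_of_eq ?_) (h'.cost (fun i => θ (a + i)) (fun i hi => hθ _ (by omega))
        (le_trans (Finset.card_le_card ?_) hk))
      · refine Finset.sum_congr rfl fun i hi => ?_
        rw [if_neg (by omega : ¬ a + i < a), if_neg (by omega), Nat.add_sub_cancel_left,
          Nat.add_sub_cancel_left]
      · intro x hx
        obtain ⟨i, hi, rfl⟩ := Finset.mem_image.1 hx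
        have hi := Finset.mem_range.1 hi
        exact Finset.mem_image_of_mem _ (Finset.mem_range.2 (by omega))

theorem IsReduction.sum_eq {C : ℝ} {n m : ℕ} {Y₀ Y : ℕ → ℕ} {W₀ W : ℕ → ℝ} {f ρ : ℕ → ℕ}
    (h : IsReduction I C n m Y₀ Y W₀ W f ρ) (g : ℕ → ℝ) :
    ∑ l ∈ Finset.range m, W l * g l = ∑ i ∈ Finset.range n, W₀ i * g (ρ i) := by
  rw [← Finset.sum_fiberwise_of_maps_to (s := Finset.range n) (t := Finset.range m) (g := ρ)
    fun i hi => Finset.mem_range.2 (h.assign i (Finset.mem_range.1 hi))]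
  refine Finset.sum_congr rfl fun l hl => ?_
  rw [h.weight l (Finset.mem_range.1 hl), Finset.sum_mul]
  refine Finset.sum_congr rfl fun i hi => ?_
  rw [(Finset.mem_filter.1 hi).2]

/-- Reductions can be composed. -/
theorem IsReduction.trans {C C' : ℝ} {n m l : ℕ} {Y₀ Y Y' : ℕ → ℕ} {W₀ W W' : ℕ → ℝ}
    {f ρ f' ρ' : ℕ → ℕ} (h : IsReduction I C n m Y₀ Y W₀ W f ρ)
    (h' : IsReduction I C' m l Y Y' W W' f' ρ') (hI : MetricOn I.n I.dist)
    (hY : ∀ i < n, Y₀ i < I.n) (hW : ∀ i < n, 0 ≤ W₀ i) (hC : 0 ≤ C') :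
    IsReduction I (2 * C + C' * (4 * C + 4)) n l Y₀ Y' W₀ W' (f ∘ f') (ρ' ∘ ρ) := by
  refine ⟨fun j hj => h.lt _ (h'.lt j hj), fun j hj => by rw [h'.eq j hj, h.eq _ (h'.lt j hj)]; rfl,
    fun i hi j hj hij => h'.inj i hi j hj (h.inj _ (h'.lt i hi) _ (h'.lt j hj) hij), fun j hj => ?_,
    fun i hi => h'.assign _ (h.assign i hi), fun θ hθ hk => ?_⟩
  · rw [h'.weight j hj, Finset.sum_filter, Finset.sum_filter]
    have := h.sum_eq fun i => if ρ' i = j then 1 else 0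
    simpa using this
  · rcases Nat.eq_zero_or_pos n with rfl | hn
    · simp
    set T := (Finset.range n).image θ with hT
    have hθT : ∀ i < n, θ i ∈ T := fun i hi => Finset.mem_image_of_mem _ (Finset.mem_range.2 hi)
    have hTn : ∀ t ∈ T, t < I.n := by
      intro t ht
      obtain ⟨i, hi, rfl⟩ := Finset.mem_image.1 ht
      exact hθ i (Finset.mem_range.1 hi)
    -- `θ` may send points that were merged to different centers. The merged point is served by the
    -- nearest of all values of `θ` instead.
    have hc := nearest_spec (D := I.dist) hTn ⟨_, hθT 0 hn⟩
    set c := nearest I.n I.dist T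
    have hYm : ∀ l < m, Y l < I.n := fun l hl => by
      rw [h.eq l hl]
      exact hY _ (h.lt l hl)
    have h1 := h.cost θ hθ hk
    have h2 := h'.cost (fun l => c (Y l)) (fun l _ => hTn _ (hc _).1) (le_trans
      (Finset.card_le_card fun x hx => by
        obtain ⟨l, -, rfl⟩ := Finset.mem_image.1 hx
        exact (hc _).1) hk)
    rw [h.sum_eq fun l => I.dist (Y l) (Y (f' (ρ' l))) ^ 2,
      h.sum_eq fun l => I.dist (Y l) (c (Y l)) ^ 2] at h2
    have hp : ∀ i < n, I.dist (Y (ρ i)) (c (Y (ρ i))) ^ 2 ≤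
        2 * I.dist (Y₀ i) (Y₀ (f (ρ i))) ^ 2 + 2 * I.dist (Y₀ i) (θ i) ^ 2 := by
      intro i hi
      have hρ := hYm _ (h.assign i hi)
      have e := h.eq _ (h.assign i hi)
      have k1 := (hc (Y (ρ i))).2 _ (hθT i hi)
      have k2 := hI.tri _ hρ _ (hY i hi) _ (hθ i hi)
      rw [hI.symm _ hρ _ (hY i hi)] at k2
      have k3 := pow_le_pow_left₀ (hI.nonneg _ hρ _ (hTn _ (hc (Y (ρ i))).1)) (k1.trans k2) 2
      rw [← e]
      nlinarith [sq_nonneg (I.dist (Y₀ i) (Y (ρ i)) - I.dist (Y₀ i) (θ i))]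
    have hq : ∀ i < n, I.dist (Y₀ i) (Y₀ ((f ∘ f') ((ρ' ∘ ρ) i))) ^ 2 ≤
        2 * I.dist (Y₀ i) (Y₀ (f (ρ i))) ^ 2 +
          2 * I.dist (Y (ρ i)) (Y (f' (ρ' (ρ i)))) ^ 2 := by
      intro i hi
      have hρ := h.assign i hi
      have hf := h'.lt _ (h'.assign _ hρ)
      have k2 := hI.tri _ (hY i hi) _ (hYm _ hρ) _ (hYm _ hf)
      have k3 := pow_le_pow_left₀ (hI.nonneg _ (hY i hi) _ (hYm _ hf)) k2 2
      simp only [Function.comp]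
      rw [← h.eq _ hρ, ← h.eq _ hf]
      nlinarith [sq_nonneg (I.dist (Y₀ i) (Y (ρ i)) - I.dist (Y (ρ i)) (Y (f' (ρ' (ρ i)))))]
    -- Twice the first reduction contributes `2 * C`. Twice the second contributes `2 * C'` times
    -- the cost of serving the merged points, which is at most `2 * C + 2` times that of `θ`.
    have s1 := Finset.sum_le_sum fun i (hi : i ∈ Finset.range n) =>
      mul_le_mul_of_nonneg_left (hp i (Finset.mem_range.1 hi)) (hW i (Finset.mem_range.1 hi))
    have s2 := Finset.sum_le_sum fun i (hi : i ∈ Finset.range n) =>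
      mul_le_mul_of_nonneg_left (hq i (Finset.mem_range.1 hi)) (hW i (Finset.mem_range.1 hi))
    simp only [mul_add, mul_left_comm _ (2 : ℝ), Finset.sum_add_distrib, ← Finset.mul_sum] at s1 s2
    have s3 := mul_le_mul_of_nonneg_left s1 hC
    have s4 := mul_le_mul_of_nonneg_left h1 hC
    nlinarith

/-! ### One stage and the loop over all stages -/

/-- Replace the points by fewer weighted points, chunk by chunk. -/
def stageCmd : Cmd :=
  .seq (.setNat 4 (.const 0) (.const 0)) (.seq (.setNat 5 (.const 0) (.const 0))
    (.seq (.while (.not (.leNat (.var 0) (.var 4))) chunkCmd)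
      (.seq (.setNat 0 (.const 0) (.var 5))
        (.setNat 2 (.const 0) (.mul (.var 2) (.var 2))))))

theorem IsReduction.refl_zero (I : Input) (C : ℝ) (Y : ℕ → ℕ) (W : ℕ → ℝ) :
    IsReduction I C 0 0 Y Y W W id id :=
  ⟨by simp, by simp, by simp, by simp, by simp, by simp⟩

/-- A chunk of `s ≤ k * q` points costs about `s ^ 2 ≤ s * (k * q)`, so each point is charged `G`.
All chunks but the last are full, which bounds their number `c`. The output overwrites the input;
its end never passes the start of the next chunk, and the cells from there on are unchanged. -/
theorem runs_stageCmd {L N q : ℕ} (hI : I.IsMetric L) (hN : σ.nat 0 0 = N) (hq : σ.nat 2 0 = q)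
    (hq1 : 1 ≤ q) (hB : N * (L + 6) ≤ B) (hqB : q * q ≤ B) (hY : ∀ j < N, σ.nat 1 j < I.n)
    (hinj : ∀ i < N, ∀ j < N, σ.nat 1 i = σ.nat 1 j → i = j) (hW : ∀ j < N, 0 ≤ σ.real 1 j) :
    Runs I B stageCmd σ (N * (1100 * (I.k * q) * (L + 7) * (B.size + 1) + 1) + 5) fun τ =>
      τ.nat 2 0 = q * q ∧ ∃ c f ρ, τ.nat 0 0 ≤ I.k * c ∧ c * (I.k * q) < N + I.k * q ∧
        IsReduction I 1598700 N (τ.nat 0 0) (σ.nat 1) (τ.nat 1) (σ.real 1) (τ.real 1) f ρ := by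
  have hkq : 1 ≤ I.k * q := Nat.mul_pos hI.k_pos hq1
  set G := 1100 * (I.k * q) * (L + 7) * (B.size + 1) with hG
  refine Runs.time (T₁ := N * (G + 1) + 1 + 2 + 1 + 1) ?_ (by omega)
  refine Runs.setNat_seq (by decide) (by simp) (Runs.setNat_seq (by decide) (by simp) ?_)
  simp only [NExpr.eval]
  set σ₀ := (σ.setNat 4 0 0).setNat 5 0 0 with hσ₀
  refine Runs.seq (T₂ := 2) (Q₁ := fun τ => ∃ c f ρ, τ.nat 5 0 ≤ I.k * c ∧
    c * (I.k * q) < N + I.k * q ∧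
    IsReduction I 1598700 N (τ.nat 5 0) (σ.nat 1) (τ.nat 1) (σ.real 1) (τ.real 1) f ρ)
    (Runs.post (Runs.while (Inv := fun r τ => τ.nat 5 0 ≤ τ.nat 4 0 ∧ τ.nat 4 0 ≤ N ∧
      r = (N - τ.nat 4 0) * (G + 1) ∧
      (∀ j, τ.nat 5 0 ≤ j → τ.nat 1 j = σ.nat 1 j ∧ τ.real 1 j = σ.real 1 j) ∧
      ∃ c f ρ, τ.nat 5 0 ≤ I.k * c ∧
        (τ.nat 4 0 = c * (I.k * q) ∨ τ.nat 4 0 = N ∧ c * (I.k * q) < N + I.k * q) ∧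
        IsReduction I 1598700 (τ.nat 4 0) (τ.nat 5 0) (σ.nat 1) (τ.nat 1) (σ.real 1) (τ.real 1)
          f ρ) (by decide) ?_ ?_) ?_) ?_
  · rintro r τ hτ hA ⟨hoa, haN, rfl, hun, c, f, ρ, hc, hac, hred⟩ hb
    have e0 : τ.nat 0 0 = N := by
      rw [hA.nat 0 (by decide)]
      simpa [hσ₀] using hN
    have e2 : τ.nat 2 0 = q := by
      rw [hA.nat 2 (by decide)]
      simpa [hσ₀] using hq
    simp only [BExpr.holds, NExpr.eval, e0, not_le] at hb
    have hac' : τ.nat 4 0 = c * (I.k * q) := by omega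
    set a := τ.nat 4 0 with ha
    set o := τ.nat 5 0 with ho
    obtain ⟨s, hs⟩ : ∃ s, s = min (I.k * q) (N - a) := ⟨_, rfl⟩
    have hsG : 1100 * s ^ 2 * (L + 7) * (B.size + 1) ≤ s * G := by
      have h1 : s * s ≤ s * (I.k * q) := Nat.mul_le_mul_left _ (by omega)
      calc 1100 * s ^ 2 * (L + 7) * (B.size + 1)
          = s * s * (1100 * ((L + 7) * (B.size + 1))) := by ring
        _ ≤ s * (I.k * q) * (1100 * ((L + 7) * (B.size + 1))) := Nat.mul_le_mul_right _ h1
        _ = s * G := by rw [hG]; ring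
    refine ⟨_, Runs.post (runs_chunkCmd (s := s) hI (by rw [e0, e2, ← ha, hs]) (by omega)
      (le_trans (Nat.mul_le_mul_right _ (by omega)) hB) hoa
      (fun j hj hjN => by
        rw [(hun j (hoa.trans hj)).1]
        exact hY j (by omega))
      (fun i j hi hiN hj hjN h => by
        rw [(hun j (hoa.trans hj)).1, (hun i (hoa.trans hi)).1] at h
        exact hinj i (by omega) j (by omega) h)
      fun j hj hjN => by
        rw [(hun j (hoa.trans hj)).2]
        exact hW j (by omega)) fun τ' _ hA' h' => ?_⟩
    obtain ⟨h4, m, f', ρ', hm1, hmk, hms, h5, hred', hun'⟩ := h'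
    rw [← ha, ← ho] at hred'
    rw [← ha] at h4
    rw [← ho] at h5 hun'
    have e1 : (fun i => τ.nat 1 (a + i)) = fun i => σ.nat 1 (a + i) :=
      funext fun i => (hun _ (by omega)).1
    have e1' : (fun i => τ.real 1 (a + i)) = fun i => σ.real 1 (a + i) :=
      funext fun i => (hun _ (by omega)).2
    rw [e1, e1'] at hred'
    obtain ⟨f'', ρ'', hred''⟩ := hred.append hred' fun j hj => hun' j (Or.inl hj)
    refine ⟨(N - (a + s)) * (G + 1), ?_, by omega, by omega, by rw [h4], ?_, c + 1, f'', ρ'', ?_, ?_,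
      ?_⟩
    · obtain ⟨d, hd⟩ := Nat.exists_eq_add_of_le (show a + s ≤ N by omega)
      rw [hd, show a + s + d - (a + s) = d by omega, show a + s + d - a = d + s by omega]
      have hs1 : 1 ≤ s := by omega
      nlinarith
    · intro j hj
      rw [(hun' j (by omega)).1, (hun' j (by omega)).2]
      exact hun j (by omega)
    · rw [mul_add]
      omega
    · rw [add_mul, h4]
      omega
    · rw [h4, h5]
      exact hred''
  · refine ⟨by simp [hσ₀], by simp [hσ₀], by simp [hσ₀], by simp [hσ₀], 0, id, id, ?_⟩
    simp [hσ₀]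
    exact IsReduction.refl_zero _ _ _ _
  · rintro τ hτ hA ⟨hb, r, -, haN, -, -, c, f, ρ, hc, hac, hred⟩
    have e0 : τ.nat 0 0 = N := by
      rw [hA.nat 0 (by decide)]
      simpa [hσ₀] using hN
    simp only [BExpr.holds, NExpr.eval, e0, not_not] at hb
    have e4 : τ.nat 4 0 = N := le_antisymm haN hb
    rw [e4] at hred
    exact ⟨c, f, ρ, hc, by omega, hred⟩
  · rintro τ hτ hA ⟨c, f, ρ, hc, hcN, hred⟩
    have e2 : τ.nat 2 0 = q := by
      rw [hA.nat 2 (by decide)]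
      simpa [hσ₀] using hq
    refine Runs.setNat_seq (by decide) (hτ.2.2 _ _) (Runs.setNat (by decide) ?_ ?_)
    · simpa [e2] using hqB
    · refine ⟨by simp [e2], c, f, ρ, ?_⟩
      simpa using ⟨hc, hcN, hred⟩

theorem IsReduction.mono {C C' : ℝ} {n m : ℕ} {Y₀ Y : ℕ → ℕ} {W₀ W : ℕ → ℝ} {f ρ : ℕ → ℕ}
    (h : IsReduction I C n m Y₀ Y W₀ W f ρ) (hW : ∀ i < n, 0 ≤ W₀ i) (hC : C ≤ C') :
    IsReduction I C' n m Y₀ Y W₀ W f ρ :=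
  ⟨h.lt, h.eq, h.inj, h.weight, h.assign, fun θ hθ hk => (h.cost θ hθ hk).trans
    (mul_le_mul_of_nonneg_right hC (Finset.sum_nonneg fun i hi =>
      mul_nonneg (hW i (Finset.mem_range.1 hi)) (sq_nonneg _)))⟩

theorem IsReduction.card_le {C : ℝ} {n m : ℕ} {Y₀ Y : ℕ → ℕ} {W₀ W : ℕ → ℝ} {f ρ : ℕ → ℕ}
    (h : IsReduction I C n m Y₀ Y W₀ W f ρ) : m ≤ n := by
  simpa using Finset.card_le_card_of_injOn (s := Finset.range m) (t := Finset.range n) f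
    (fun i hi => Finset.mem_coe.2 (Finset.mem_range.2 (h.lt i (Finset.mem_range.1 hi))))
    fun i hi j hj => h.inj i (Finset.mem_range.1 hi) j (Finset.mem_range.1 hj)

/-- The integer part of `δ` is the initial value of the cell `2`. -/
def initCmd : Cmd :=
  .seq (.setNat 0 (.const 0) .inputN) (.seq (.setNat 2 (.const 0) (.const 1))
    (.seq (.for 10 0 (.seq (.setNat 1 (.var 10) (.var 10))
        (.setReal 1 (.var 10) (.weight (.var 10)))))
      (.for 10 0 (.ite (.leReal (.ofNat (.add (.var 2) (.const 1))) .inputDelta)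
        (.setNat 2 (.const 0) (.add (.var 2) (.const 1))) .skip))))

/-- Reals cannot be rounded, so the integer part of `δ` is found by counting; `δ ≤ n` makes `n`
rounds enough. -/
theorem runs_initCmd (h1 : 1 ≤ I.δ) (hn : I.δ ≤ I.n) :
    Runs I B initCmd σ (I.n * 8 + 6) fun τ => τ.nat 0 0 = I.n ∧
      (∀ i < I.n, τ.nat 1 i = i ∧ τ.real 1 i = I.weight i) ∧ 1 ≤ τ.nat 2 0 ∧
      (τ.nat 2 0 : ℝ) ≤ I.δ ∧ I.δ < τ.nat 2 0 + 1 := by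
  refine Runs.good fun hσ => ?_
  have hnB : (I.n : ℝ) ≤ B := Nat.cast_le.2 hσ.1
  refine Runs.time (T₁ := (I.n * (2 + 2) + 2) + (I.n * (2 + 2) + 2) + 1 + 1) ?_ (by omega)
  refine Runs.setNat_seq (by decide) hσ.1 (Runs.setNat_seq (by decide) ?_ ?_)
  · simp only [NExpr.eval]
    have : (1 : ℝ) ≤ B := h1.trans (hn.trans hnB)
    exact_mod_cast this
  simp only [NExpr.eval]
  refine Runs.seq (Runs.for (s := I.n) (T := 2) (Inv := fun m τ => ∀ i < m,
    τ.nat 1 i = i ∧ τ.real 1 i = I.weight i) (by simp) (by decide) (by simp)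
    fun i τ hi hτ hA hiv hI => Runs.setNat_seq (by decide) (hτ.2.2 _ _)
      (Runs.setReal (by decide) fun j hj => ?_)) fun τ _ hA hI => ?_
  · simp [hiv]
    rcases Nat.lt_succ_iff_lt_or_eq.1 hj with hj' | rfl
    · simpa [hj'.ne] using hI j hj'
    · simp
  have e0 : τ.nat 0 0 = I.n := by rw [hA.nat 0 (by decide)]; simp
  have e2 : τ.nat 2 0 = 1 := by rw [hA.nat 2 (by decide)]; simp
  refine Runs.post (Runs.for (s := I.n) (T := 2) (Inv := fun m τ => 1 ≤ τ.nat 2 0 ∧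
    (τ.nat 2 0 : ℝ) ≤ I.δ ∧ (τ.nat 2 0 = m + 1 ∨ I.δ < τ.nat 2 0 + 1)) e0 (by decide) ?_ ?_) ?_
  · simp [e2, h1]
  · rintro i ρ hi hρ hAρ hiv ⟨q1, q2, q3⟩
    refine Runs.ite (by decide) (fun hc => ?_) fun hc => Runs.skip ?_
    · simp only [BExpr.holds, NExpr.eval, RExpr.eval] at hc
      refine Runs.setNat (by decide) ?_ ?_
      · simp only [NExpr.eval]
        exact Nat.cast_le.1 (hc.trans (hn.trans hnB))
      · rcases q3 with q3 | q3
        · simp only [q3] at hc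
          simp [q3]
          push_cast at hc
          linarith
        · push_cast at hc
          linarith
    · simp only [BExpr.holds, NExpr.eval, RExpr.eval, not_le] at hc
      push_cast at hc
      simpa using ⟨q1, q2, Or.inr hc⟩
  · rintro ρ - hAρ ⟨q1, q2, q3⟩
    refine ⟨by rw [hAρ.nat 0 (by decide), e0], fun i hi => ?_, q1, q2, ?_⟩
    · rw [hAρ.nat 1 (by decide), hAρ.real 1 (by decide)]
      exact hI i hi
    · rcases q3 with q3 | q3
      · rw [q3] at q2
        push_cast at q2
        linarith
      · exact q3

/-- The algorithm. -/
def kMeansCmd : Cmd :=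
  .seq initCmd (.while (.not (.leNat (.var 0) .inputK)) stageCmd)

-- Stage `i` uses the chunk factor `q ^ 2 ^ i` and costs at most `2 ^ i * G`, so `(2 ^ (M + 1) - 2 ^
-- i) * G` bounds the remaining time. An unfinished stage `i > 0` implies `k * q ^ 2 ^ (i - 1) < n`.
-- This excludes `i = M + 1`, and it bounds the chunk factor by `n ^ 2`.
set_option maxHeartbeats 400000 in
theorem runs_kMeansCmd {L q M : ℕ} (hI : I.IsMetric L) (hn : 1 ≤ I.n)
    (hw : ∀ i < I.n, 0 ≤ I.weight i) (h1 : 1 ≤ I.δ) (hδ : I.δ ≤ I.n) (hq : (q : ℝ) ≤ I.δ)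
    (hq' : I.δ < q + 1) (hM : I.n ≤ I.k * q ^ 2 ^ M) (hB : I.n ^ 4 * (L + 6) ≤ B) :
    Runs I B kMeansCmd σ (2 ^ (M + 1) * (1200 * (I.n * I.k * q) * (L + 7) * (B.size + 1)))
      fun τ => 1 ≤ τ.nat 0 0 ∧ τ.nat 0 0 ≤ I.k ∧ ∃ f ρ,
        IsReduction I (2 ^ (24 * (M + 1))) I.n (τ.nat 0 0) id (τ.nat 1) I.weight (τ.real 1) f ρ := by
  have hqn : q ≤ I.n := by exact_mod_cast hq.trans hδ
  have hq1 : 1 ≤ q := by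
    by_contra h
    obtain rfl : q = 0 := by omega
    simp at hq'
    linarith
  set G := 1107 * (I.n * I.k * q) * (L + 7) * (B.size + 1) with hG
  have hnG : I.n ≤ (I.n * I.k * q) * (L + 7) * (B.size + 1) := by
    have h1 : 1 ≤ I.k * q * (L + 7) * (B.size + 1) :=
      Nat.mul_pos (Nat.mul_pos (Nat.mul_pos hI.k_pos hq1) (by omega)) (by omega)
    nlinarith
  refine Runs.time (T₁ := (I.n * 8 + 6) + (2 ^ (M + 1) * G + 1)) ?_ (by
    have : 1 ≤ 2 ^ (M + 1) := Nat.one_le_two_pow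
    calc (I.n * 8 + 6) + (2 ^ (M + 1) * G + 1) ≤ 1 * (15 * I.n) + 2 ^ (M + 1) * G := by omega
      _ ≤ 2 ^ (M + 1) * (15 * (I.n * I.k * q * (L + 7) * (B.size + 1))) + 2 ^ (M + 1) * G := by
        gcongr
      _ ≤ _ := by rw [hG, ← mul_add]; gcongr; nlinarith)
  refine Runs.seq (runs_initCmd h1 hδ) fun σ₁ _ _ ⟨a0, a1, a2, a3, a4⟩ => ?_
  have a2' : σ₁.nat 2 0 = q := by
    have h1 : σ₁.nat 2 0 < q + 1 := by exact_mod_cast a3.trans_lt hq'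
    have h2 : q < σ₁.nat 2 0 + 1 := by exact_mod_cast hq.trans_lt a4
    omega
  refine Runs.post (Runs.while (i := 2 ^ (M + 1) * G) (Inv := fun r τ => ∃ i, i ≤ M + 1 ∧
    (2 ^ (M + 1) - 2 ^ i) * G ≤ r ∧ τ.nat 2 0 = q ^ 2 ^ i ∧
    (τ.nat 0 0 ≤ I.k ∨ τ.nat 0 0 * q ^ 2 ^ i ≤ 2 ^ i * (I.n * q) ∧
      (i = 0 ∨ I.k * q ^ 2 ^ (i - 1) < I.n)) ∧
    ∃ f ρ, IsReduction I (2 ^ (24 * i)) I.n (τ.nat 0 0) id (τ.nat 1) I.weight (τ.real 1) f ρ)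
    (by decide) ?_ ?_) ?_
  · rintro r τ hτ hA ⟨i, hiM, hr, e2, hsize, f, ρ, hred⟩ hb
    simp only [BExpr.holds, NExpr.eval, not_le] at hb
    obtain ⟨hsize, hi⟩ := hsize.resolve_left (by omega)
    have hiM' : i ≤ M := by
      rcases hi with hi | hi
      · omega
      · by_contra h
        obtain rfl : i = M + 1 := by omega
        simp at hi
        omega
    set Q := q ^ 2 ^ i with hQ
    set N := τ.nat 0 0 with hN
    have hQ1 : 1 ≤ Q := Nat.pow_pos hq1
    have hQn : Q ≤ I.n ^ 2 := by
      rcases hi with rfl | hi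
      · simp only [hQ, pow_zero, pow_one]
        nlinarith
      · rcases Nat.eq_zero_or_pos i with rfl | hi0
        · simp only [hQ, pow_zero, pow_one]
          nlinarith
        · obtain ⟨j, rfl⟩ : ∃ j, i = j + 1 := ⟨i - 1, by omega⟩
          simp only [Nat.add_sub_cancel] at hi
          rw [hQ, pow_succ, pow_mul]
          have := hI.k_pos
          exact Nat.pow_le_pow_left (by nlinarith) 2
    have hNn : N ≤ I.n := hred.card_le
    have hn4 : I.n ≤ I.n ^ 4 := Nat.le_self_pow (by norm_num) _
    have hst := runs_stageCmd (σ := τ) (B := B) (L := L) (N := N) (q := Q) hI rfl e2 hQ1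
      (le_trans (Nat.mul_le_mul_right _ (hNn.trans hn4)) hB)
      (le_trans (by
        calc Q * Q ≤ I.n ^ 2 * I.n ^ 2 := Nat.mul_le_mul hQn hQn
          _ = I.n ^ 4 * 1 := by ring
          _ ≤ I.n ^ 4 * (L + 6) := Nat.mul_le_mul_left _ (by omega)) hB)
      (fun j hj => by rw [hred.eq j hj]; exact hred.lt j hj)
      (fun i hi j hj h => hred.inj i hi j hj (by rwa [hred.eq i hi, hred.eq j hj] at h))
      (fun j hj => by
        rw [hred.weight j hj]
        exact Finset.sum_nonneg fun i hi =>
          hw i (Finset.mem_range.1 (Finset.mem_filter.1 hi).1))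
    refine ⟨_, Runs.post hst fun τ' _ _ h' => ?_⟩
    obtain ⟨e2', c, f', ρ', hc, hcN, hred'⟩ := h'
    refine ⟨(2 ^ (M + 1) - 2 ^ (i + 1)) * G, ?_, i + 1, by omega, le_rfl, ?_, ?_, f ∘ f', ρ' ∘ ρ,
      (hred.trans hred' hI.metric (fun i hi => hi) hw (by norm_num)).mono hw ?_⟩
    · refine le_trans ?_ hr
      obtain ⟨d, hd⟩ := Nat.exists_eq_add_of_le (Nat.pow_le_pow_right (n := 2) (by norm_num)
        (show i + 1 ≤ M + 1 by omega))
      have hd' : 2 ^ (M + 1) - 2 ^ i = d + 2 ^ i := by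
        rw [pow_succ 2 i] at hd
        omega
      rw [hd', hd, Nat.add_sub_cancel_left, add_mul, add_assoc]
      gcongr
      have hN1 : 1 ≤ N := by omega
      obtain ⟨P, hP⟩ : ∃ P, P = I.k * ((L + 7) * (B.size + 1)) := ⟨_, rfl⟩
      have hP1 : 1 ≤ P := hP ▸ Nat.mul_pos hI.k_pos (Nat.mul_pos (by omega) (by omega))
      have h3 : N * 1 ≤ N * (Q * P) := Nat.mul_le_mul_left _ (Nat.mul_pos hQ1 hP1)
      have h4 := Nat.mul_le_mul_right (1107 * P) hsize
      calc N * (1100 * (I.k * Q) * (L + 7) * (B.size + 1) + 1) + 5 + 1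
          = 1100 * (N * (Q * P)) + N + 6 := by rw [hP]; ring
        _ ≤ 1107 * (N * (Q * P)) := by omega
        _ = N * Q * (1107 * P) := by ring
        _ ≤ 2 ^ i * (I.n * q) * (1107 * P) := h4
        _ = 2 ^ i * G := by rw [hG, hP]; ring
    · rw [e2', pow_succ 2 i, pow_mul, ← hQ, sq]
    -- With more than one chunk there are at most `2 * N / (k * Q)` of them, so the new number of
    -- points times `Q ^ 2` is at most `2 * N * Q`. A single chunk leaves at most `k` points, and
    -- the loop ends.
    · rcases Nat.lt_or_ge (I.k * Q) N with h | h
      · right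
        refine ⟨?_, Or.inr (h.trans_le hNn)⟩
        rw [pow_succ 2 i, pow_mul, ← hQ]
        calc τ'.nat 0 0 * Q ^ 2 ≤ I.k * c * Q ^ 2 := Nat.mul_le_mul_right _ hc
          _ = c * (I.k * Q) * Q := by ring
          _ ≤ 2 * N * Q := Nat.mul_le_mul_right _ (by omega)
          _ ≤ 2 ^ i * 2 * (I.n * q) := by nlinarith
      · left
        have : c < 2 := by
          by_contra hc2
          have := Nat.mul_le_mul_right (I.k * Q) (show 2 ≤ c by omega)
          omega
        exact hc.trans (by nlinarith)
    -- The composed ratio is at most `2 ^ (24 * i) * (2 + 8 * 1598700)`, and the last factor is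
    -- below `2 ^ 24`.
    · have : (1 : ℝ) ≤ 2 ^ (24 * i) := one_le_pow₀ (by norm_num)
      rw [mul_add 24 i 1, pow_add]
      norm_num
      linarith
  · refine ⟨0, by omega, Nat.mul_le_mul_right _ (Nat.sub_le _ _), by simpa using a2',
      Or.inr ⟨by simp [a0], Or.inl rfl⟩, id, id, ?_⟩
    rw [a0]
    refine ⟨fun l hl => hl, fun l hl => (a1 l hl).1, fun l _ l' _ h => h, fun l hl => ?_,
      fun i hi => hi, fun θ hθ _ => ?_⟩
    · rw [(a1 l hl).2, Finset.sum_filter]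
      simp [hl]
    · rw [Finset.sum_eq_zero fun i hi => by
        simp [hI.metric.self i (Finset.mem_range.1 hi)]]
      exact mul_nonneg (by positivity) (Finset.sum_nonneg fun i hi =>
        mul_nonneg (hw i (Finset.mem_range.1 hi)) (sq_nonneg _))
  · rintro τ - - ⟨hb, r, i, hi, -, -, -, f, ρ, hred⟩
    simp only [BExpr.holds, NExpr.eval, not_not] at hb
    have := hred.assign 0 hn
    exact ⟨by omega, hb, f, ρ, hred.mono hw (pow_le_pow_right₀ (by norm_num) (by omega))⟩

end RealRAM

open RealRAM

/-! ### From index sets back to the metric space -/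

section KMeans

variable {V : Type*} [MetricSpace V]

theorem kMeansInput_isMetric [Fintype V] {n k L : ℕ} (e : Fin n ≃ V) (w : V → ℝ≥0) (δ : ℝ)
    (hk : 1 ≤ k) (hL : aspectRatio V ≤ 2 ^ L) : (kMeansInput e w k δ).IsMetric L := by
  have hd : ∀ i j (hi : i < n) (hj : j < n),
      (kMeansInput e w k δ).dist i j = dist (e ⟨i, hi⟩) (e ⟨j, hj⟩) := fun i j hi hj =>
    dif_pos ⟨hi, hj⟩
  have hpos : ∀ i j (hi : i < n) (hj : j < n), i ≠ j → 0 < dist (e ⟨i, hi⟩) (e ⟨j, hj⟩) :=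
    fun i j hi hj hne => dist_pos.2 fun h => hne (by simpa using h)
  refine ⟨⟨fun i hi => ?_, fun i hi j hj => ?_, fun i hi j hj l hl => ?_, fun i hi j hj => ?_⟩,
    fun i hi j hj hne => ?_, fun i hi j hj i' hi' j' hj' hne => ?_, hk⟩
  · rw [hd i i hi hi, dist_self]
  · rw [hd i j hi hj, hd j i hj hi, dist_comm]
  · rw [hd i j hi hj, hd i l hi hl, hd j l hj hl]
    exact dist_triangle _ _ _
  · rw [hd i j hi hj]
    exact dist_nonneg
  · rw [hd i j hi hj]
    exact hpos i j hi hj hne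
  · rw [hd i j hi hj, hd i' j' hi' hj']
    have hp := hpos i' j' hi' hj' hne
    have h1 : (Set.univ : Set V).infsep ≤ dist (e ⟨i', hi'⟩) (e ⟨j', hj'⟩) :=
      Set.infsep_le_dist_of_mem (Set.mem_univ _) (Set.mem_univ _) (dist_pos.1 hp)
    have h2 : dist (e ⟨i, hi⟩) (e ⟨j, hj⟩) ≤ Metric.diam (Set.univ : Set V) :=
      Metric.dist_le_diam_of_mem (Set.finite_univ.isBounded) (Set.mem_univ _) (Set.mem_univ _)
    have h3 : 0 < (Set.univ : Set V).infsep := Set.infsep_pos.2 ⟨Set.finite_univ.einfsep_pos,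
      Set.einfsep_lt_top_iff.2 ⟨_, Set.mem_univ _, _, Set.mem_univ _, dist_pos.1 hp⟩⟩
    rw [aspectRatio, div_le_iff₀ h3] at hL
    exact h2.trans (hL.trans (mul_le_mul_of_nonneg_left h1 (by positivity)))

theorem one_le_aspectRatio [Finite V] [Nontrivial V] : 1 ≤ aspectRatio V := by
  obtain ⟨x, y, hxy⟩ := exists_pair_ne V
  have h1 : (Set.univ : Set V).infsep ≤ dist x y :=
    Set.infsep_le_dist_of_mem (Set.mem_univ _) (Set.mem_univ _) hxy
  have h2 : dist x y ≤ Metric.diam (Set.univ : Set V) :=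
    Metric.dist_le_diam_of_mem (Set.finite_univ.isBounded) (Set.mem_univ _) (Set.mem_univ _)
  have h3 : 0 < (Set.univ : Set V).infsep := Set.infsep_pos.2 ⟨Set.finite_univ.einfsep_pos,
    Set.einfsep_lt_top_iff.2 ⟨_, Set.mem_univ _, _, Set.mem_univ _, hxy⟩⟩
  rw [aspectRatio, one_le_div h3]
  exact h1.trans h2

/-- The centers of a reduction of the whole input to at most `k` points are an approximate
solution. -/
theorem exists_isApproxKMeans [Fintype V] {n k : ℕ} {C : ℝ} (e : Fin n ≃ V) (w : V → ℝ≥0) (δ : ℝ)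
    {σ : State} {W : ℕ → ℝ} {f ρ : ℕ → ℕ} (hm : 1 ≤ σ.nat 0 0) (hmk : σ.nat 0 0 ≤ k)
    (h : IsReduction (kMeansInput e w k δ) C n (σ.nat 0 0) id (σ.nat 1)
      (kMeansInput e w k δ).weight W f ρ) :
    ∃ S, OutputsSet e σ S ∧ IsApproxKMeans w k C S := by
  classical
  have hY : ∀ l < σ.nat 0 0, σ.nat 1 l < n := fun l hl => by
    rw [h.eq l hl]
    exact h.lt l hl
  obtain ⟨p, hp⟩ : ∃ p : ℕ → V, ∀ i (hi : i < n), p i = e ⟨i, hi⟩ :=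
    ⟨fun i => if hi : i < n then e ⟨i, hi⟩ else e ⟨_, hY 0 hm⟩, fun i hi => dif_pos hi⟩
  have hd : ∀ i j, i < n → j < n → (kMeansInput e w k δ).dist i j = dist (p i) (p j) :=
    fun i j hi hj => by
      rw [hp i hi, hp j hj]
      exact dif_pos ⟨hi, hj⟩
  have hw : ∀ i, i < n → (kMeansInput e w k δ).weight i = w (p i) := fun i hi => by
    rw [hp i hi]
    exact dif_pos hi
  have hsum : ∀ g : V → ℝ, ∑ x, g x = ∑ i ∈ Finset.range n, g (p i) := fun g => by
    rw [Finset.sum_range, ← e.sum_comp]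
    exact Finset.sum_congr rfl fun i _ => by rw [hp i i.2]
  have hpe : ∀ v, p (e.symm v) = v := fun v => by rw [hp _ (e.symm v).2]; simp
  refine ⟨(Finset.range (σ.nat 0 0)).image fun l => p (σ.nat 1 l), ⟨hY, fun v => ?_⟩, ?_, ?_, ?_⟩
  · simp only [Finset.mem_image, Finset.mem_range]
    refine exists_congr fun l => and_congr_right fun hl => ⟨?_, fun h => by rw [h, hpe]⟩
    rintro rfl
    rw [hp _ (hY l hl)]
    simp
  · exact ⟨_, Finset.mem_image_of_mem _ (Finset.mem_range.2 hm)⟩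
  · exact Finset.card_image_le.trans (by simpa using hmk)
  · intro T hT hTk
    choose t htT ht using fun x : V =>
      T.finite_toSet.isCompact.exists_infDist_eq_dist (Finset.coe_nonempty.2 hT) x
    have hθ := h.cost (fun i => e.symm (t (p i))) (fun i _ => (e.symm _).2)
      (le_trans ?_ hTk)
    · unfold kMeansCost
      rw [hsum, hsum]
      refine le_trans (Finset.sum_le_sum fun i hi => ?_) (hθ.trans (le_of_eq ?_))
      · have hi := Finset.mem_range.1 hi
        have hρ := h.assign i hi
        rw [hw i hi, ← h.eq _ hρ, id, hd _ _ hi (hY _ hρ)]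
        refine mul_le_mul_of_nonneg_left (pow_le_pow_left₀ Metric.infDist_nonneg
          (Metric.infDist_le_dist_of_mem ?_) 2) (NNReal.coe_nonneg _)
        exact Finset.mem_coe.2 (Finset.mem_image.2 ⟨_, Finset.mem_range.2 hρ, rfl⟩)
      · congr 1
        refine Finset.sum_congr rfl fun i hi => ?_
        have hi := Finset.mem_range.1 hi
        rw [hw i hi, id, hd _ _ hi (e.symm _).2, hpe, ht]
    · refine le_trans (Finset.card_le_card fun x hx => ?_)
        (Finset.card_image_le (s := T) (f := fun v => (e.symm v : ℕ)))
      obtain ⟨i, -, rfl⟩ := Finset.mem_image.1 hx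
      exact Finset.mem_image_of_mem _ (Finset.mem_coe.1 (htT _))

end KMeans

/-! ### The number of stages and the final constants -/

/-- The number of stages is logarithmic in `log (n / k) / log q`. -/
theorem exists_stages {n k q : ℕ} (hk : 1 ≤ k) (hq : 2 ≤ q) (h : k * q ≤ n) :
    ∃ M, n ≤ k * q ^ 2 ^ M ∧
      (2 : ℝ) ^ (M + 1) ≤ 4 * (Real.log ((n : ℝ) / k) / Real.log q) := by
  classical
  have hk0 : (0 : ℝ) < k := by exact_mod_cast hk
  have hq0 : (0 : ℝ) < q := by exact_mod_cast (by omega : 0 < q)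
  have hlq : 0 < Real.log q := Real.log_pos (by exact_mod_cast (by omega : 1 < q))
  have hex : ∃ M, n ≤ k * q ^ 2 ^ M := by
    refine ⟨n, ?_⟩
    have h1 : n < 2 ^ n := Nat.lt_two_pow_self
    have h2 : 2 ^ n < 2 ^ 2 ^ n := Nat.pow_lt_pow_right (by norm_num) Nat.lt_two_pow_self
    have h3 : 2 ^ 2 ^ n ≤ q ^ 2 ^ n := Nat.pow_le_pow_left hq _
    nlinarith
  have key : ∀ j, k * q ^ 2 ^ j ≤ n → (2 : ℝ) ^ j ≤ Real.log ((n : ℝ) / k) / Real.log q := by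
    intro j hj
    have hj' : (k : ℝ) * (q : ℝ) ^ 2 ^ j ≤ n := by exact_mod_cast hj
    rw [le_div_iff₀ hlq]
    have := Real.log_le_log (by positivity)
      ((le_div_iff₀ hk0).2 (by linarith) : (q : ℝ) ^ 2 ^ j ≤ n / k)
    rw [Real.log_pow] at this
    exact_mod_cast this
  refine ⟨Nat.find hex, Nat.find_spec hex, ?_⟩
  -- Minimality gives `k * q ^ 2 ^ (M - 1) < n` for `M > 0`, and `2 ^ (M + 1)` is four times `2 ^ (M
  -- - 1)`. For `M = 0` the hypothesis `k * q ≤ n` is used.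
  rcases hM : Nat.find hex with _ | j
  · have := key 0 (by simpa using h)
    norm_num at this ⊢
    linarith
  · have := key j (not_le.1 (Nat.find_min hex (by omega : j < Nat.find hex))).le
    rw [pow_succ, pow_succ]
    linarith

theorem mainTheorem7 :
    ∃ (P : RealRAM.Cmd) (C₁ C₂ : ℝ) (c₁ c₂ : ℕ),
      ∀ (V : Type*) [Fintype V] [MetricSpace V] (w : V → ℝ≥0) (n k : ℕ) (e : Fin n ≃ V) (δ : ℝ),
        1 ≤ k → 2 ≤ δ → δ ≤ (n : ℝ) / (k : ℝ) →
        ∃ (t : ℕ) (σ : RealRAM.State) (S : Finset V),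
          RealRAM.Exec (kMeansInput e w k δ) P RealRAM.State.zero t σ ∧
          OutputsSet e σ S ∧
          IsApproxKMeans w k
            (C₁ * (Real.log ((n : ℝ) / (k : ℝ)) / Real.log δ) ^ c₁) S ∧
          (t : ℝ) ≤ C₂ * ((n : ℝ) * (k : ℝ) * δ) *
            (1 + Real.log (n : ℝ) + Real.log (aspectRatio V)) ^ c₂ := by
  refine ⟨kMeansCmd, 8 ^ 24, 16 * 1200 * 8 * 12 * 1000 * 12, 24, 4, ?_⟩
  intro V _ _ w n k e δ hk h2 hδ
  have hk1 : (1 : ℝ) ≤ k := by exact_mod_cast hk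
  have hkδ : δ * k ≤ n := (le_div_iff₀ (by linarith)).1 hδ
  have hδn : δ ≤ n := by nlinarith
  have hn2 : 2 ≤ n := by exact_mod_cast h2.trans hδn
  have hnR : (2 : ℝ) ≤ n := h2.trans hδn
  have : Nontrivial V := by
    have : Nontrivial (Fin n) := Fin.nontrivial_iff_two_le.2 hn2
    exact e.symm.nontrivial
  have hΔ := one_le_aspectRatio (V := V)
  set Δ := aspectRatio V with hΔdef
  obtain ⟨q, hqdef⟩ : ∃ q, q = ⌊δ⌋₊ := ⟨_, rfl⟩
  have hq : (q : ℝ) ≤ δ := hqdef ▸ Nat.floor_le (by linarith)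
  have hq' : δ < q + 1 := hqdef ▸ Nat.lt_floor_add_one δ
  have hq2 : 2 ≤ q := hqdef ▸ Nat.le_floor (by exact_mod_cast h2)
  have hq2R : (2 : ℝ) ≤ q := by exact_mod_cast hq2
  have hlq : 0 < Real.log q := Real.log_pos (by linarith)
  have hlδ : 0 < Real.log δ := Real.log_pos (by linarith)
  have hlog2 := Real.log_two_gt_d9
  have hln : 0 ≤ Real.log n := Real.log_nonneg (by linarith)
  have hlΔ : 0 ≤ Real.log Δ := Real.log_nonneg hΔ
  obtain ⟨M, hM, hM'⟩ := exists_stages (n := n) hk hq2 (by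
    have : (k : ℝ) * q ≤ n := by nlinarith
    exact_mod_cast this)
  have hnk : 0 ≤ Real.log ((n : ℝ) / k) := Real.log_nonneg (by linarith)
  have hD : (2 : ℝ) ^ (M + 1) ≤ 8 * (Real.log ((n : ℝ) / k) / Real.log δ) := by
    -- Since `q ≥ 2`, the rounding of `δ` is harmless: `δ < q + 1 ≤ q ^ 2`. It doubles the factor
    -- four.
    have h3 : Real.log δ ≤ 2 * Real.log q := by
      have := Real.log_le_log (by linarith) (by nlinarith : δ ≤ (q : ℝ) ^ 2)
      rw [Real.log_pow] at this
      exact_mod_cast this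
    refine hM'.trans ?_
    rw [← mul_div_assoc, ← mul_div_assoc, div_le_div_iff₀ hlq hlδ]
    nlinarith
  have hM2 : (2 : ℝ) ^ (M + 1) ≤ 16 * Real.log n := by
    refine hD.trans ?_
    have h3 : Real.log ((n : ℝ) / k) ≤ Real.log n :=
      Real.log_le_log (by positivity) (div_le_self (by linarith) hk1)
    have h4 : Real.log 2 ≤ Real.log δ := Real.log_le_log (by norm_num) h2
    rw [← mul_div_assoc, div_le_iff₀ hlδ]
    nlinarith
  obtain ⟨L, hLdef⟩ : ∃ L, L = ⌈Real.log Δ / Real.log 2⌉₊ := ⟨_, rfl⟩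
  have hL1 : Real.log Δ / Real.log 2 ≤ L := hLdef ▸ Nat.le_ceil _
  have hL2 : (L : ℝ) < Real.log Δ / Real.log 2 + 1 :=
    hLdef ▸ Nat.ceil_lt_add_one (div_nonneg hlΔ (by linarith))
  have hL : Δ ≤ 2 ^ L := by
    rw [div_le_iff₀ (by linarith), ← Real.log_pow] at hL1
    exact (Real.log_le_log_iff (by linarith) (by positivity)).1 hL1
  have hLΔ : (L : ℝ) ≤ 2 * Real.log Δ + 1 := by
    have : Real.log Δ / Real.log 2 ≤ 2 * Real.log Δ := by
      rw [div_le_iff₀ (by linarith)]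
      nlinarith
    linarith
  -- A chunk factor is at most `n ^ 2` and gets squared once more; the numbers of doublings are at
  -- most `n * (L + 6)`.
  obtain ⟨B, hB⟩ : ∃ B, B = n ^ 4 * (L + 6) := ⟨_, rfl⟩
  have hns : (n.size : ℝ) ≤ 2 * Real.log n + 1 := by
    obtain ⟨z, hz⟩ : ∃ z, n.size = z + 1 :=
      ⟨n.size - 1, by have := Nat.size_pos.2 (by omega : 0 < n); omega⟩
    have h3 : 2 ^ z ≤ n := Nat.lt_size.1 (by omega)
    have h4 : (2 : ℝ) ^ z ≤ n := by exact_mod_cast h3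
    have h5 := Real.log_le_log (by positivity) h4
    rw [Real.log_pow] at h5
    rw [hz]
    push_cast
    nlinarith
  have hBs : B.size ≤ 4 * n.size + (L + 6) := by
    rw [hB, show n ^ 4 = n * n * (n * n) by ring]
    have h3 := size_mul_le (n * n * (n * n)) (L + 6)
    have h4 := size_mul_le (n * n) (n * n)
    have h5 := size_mul_le n n
    have h6 := size_le_self (L + 6)
    omega
  have hBsR : (B.size : ℝ) ≤ 4 * n.size + (L + 6) := by exact_mod_cast hBs
  have hn4 : n ≤ B := by
    rw [hB]
    calc n ≤ n ^ 4 := Nat.le_self_pow (by norm_num) _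
      _ ≤ n ^ 4 * (L + 6) := Nat.le_mul_of_pos_right _ (by omega)
  have hkn : k ≤ n := by
    have : (k : ℝ) ≤ n := by nlinarith
    exact_mod_cast this
  have hI := kMeansInput_isMetric e w δ hk hL
  obtain ⟨t, σ, hex, ht, -, hm, hmk, f, ρ, hred⟩ :=
    runs_kMeansCmd (I := kMeansInput e w k δ) (B := B) (σ := State.zero) (q := q) (M := M) hI
      (by change 1 ≤ n; omega) (fun i hi => by
        have : (kMeansInput e w k δ).weight i = w (e ⟨i, hi⟩) := dif_pos hi
        rw [this]
        exact NNReal.coe_nonneg _) (by change 1 ≤ δ; linarith) hδn hq hq' hM hB.ge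
      ⟨hn4, hkn.trans hn4, fun _ _ => Nat.zero_le _⟩
  obtain ⟨S, hS, hS'⟩ := exists_isApproxKMeans e w δ hm hmk hred
  refine ⟨t, σ, S, hex, hS, ⟨hS'.1, hS'.2.1, fun T hT hTk => (hS'.2.2 T hT hTk).trans
    (mul_le_mul_of_nonneg_right ?_ (Finset.sum_nonneg fun _ _ => by positivity))⟩, ?_⟩
  · calc (2 : ℝ) ^ (24 * (M + 1)) = (2 ^ (M + 1)) ^ 24 := by rw [mul_comm, pow_mul]
      _ ≤ (8 * (Real.log ((n : ℝ) / k) / Real.log δ)) ^ 24 :=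
        pow_le_pow_left₀ (by positivity) hD _
      _ = _ := by rw [mul_pow]
  · set ℓ := 1 + Real.log n + Real.log Δ with hℓ
    have ht' : (t : ℝ) ≤ 2 ^ (M + 1) * (1200 * (n * k * q) * (L + 7) * (B.size + 1)) *
        (1000 * (B.size + 1)) := by
      have := ht
      unfold unit at this
      change t ≤ 2 ^ (M + 1) * (1200 * (n * k * q) * (L + 7) * (B.size + 1)) *
        (1000 * (B.size + 1)) at this
      exact_mod_cast this
    -- The four logarithmic factors come from the stages, the levels of the radii, the binary search
    -- and the bit length of the integers; the last two are both bounded by `e3`.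
    have e1 : (2 : ℝ) ^ (M + 1) ≤ 16 * ℓ := by linarith
    have e2 : (L : ℝ) + 7 ≤ 8 * ℓ := by linarith
    have e3 : (B.size : ℝ) + 1 ≤ 12 * ℓ := by linarith
    have hℓ0 : 0 ≤ ℓ := by linarith
    calc (t : ℝ) ≤ _ := ht'
      _ ≤ 16 * ℓ * (1200 * (n * k * δ) * (8 * ℓ) * (12 * ℓ)) * (1000 * (12 * ℓ)) := by
        gcongr
      _ = _ := by ring
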